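/- Let $\Omega\subset\mathbb{C}^n$ be a domain (not necessarily bounded) and let $1\le q<n$. Write $d^c=i(\bar\partial-\partial)$ and $\omega=dd^c|z|^2$. Let $\{T_j\}_{j\in J}$ be a family of closed positive currents of bidegree $(n-q,n-q)$ in $\Omega$ such that $$\int_\Omega T_j\wedge\omega^q>0\qquad\text{for all } j\in J.$$ Assume that every Borel set $E\subset\Omega$ with $\int_E T_j\wedge\omega^q=0$ for all $j\in J$ has Lebesgue measure $0$. Let $u$ be a plurisubharmonic function on $\Omega$ and, for each $j\in J$ and each positive integer $k$, let $u_{jk}$ be a bounded plurisubharmonic function on $\Omega$ such that, for each $j$, the sequence $(u_{jk})_k$ decreases pointwise to $u$ on $\Omega$ as $k\to\infty$. Suppose that $$\lim_{k\to\infty}\int_\Omega T_j\wedge(dd^cu_{jk})^q=0\qquad\text{for all } j\in J,$$ where $T_j\wedge(dd^cu_{jk})^q$ is the positive measure of Bedford and Taylor, obtained by applying $q$ times the operation $S\mapsto dd^cu_{jk}\wedge S:=dd^c(u_{jk}S)$ to $T_j$. Then $u$ is maximal in $\Omega$: for every open set $G$ that is relatively compact in $\Omega$ and every upper semicontinuous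 function $v$ on $\overline G$ that is plurisubharmonic in $G$ and satisfies $v\le u$ on $\partial G$, one has $v\le u$ in $G$. -/

import Mathlib

open scoped Distributions

noncomputable section

namespace Pluri

open MeasureTheory Filter Topology

/-- The space `ℂⁿ`. (Only its topology, linear structure and Lebesgue measure are used.) -/
abbrev Cn (n : ℕ) : Type := Fin n → ℂ

/-! ### Plurisubharmonic and maximal plurisubharmonic functions -/

/-- `u` is plurisubharmonic on the open set `U ⊆ ℂⁿ`: it takes values in `[-∞, ∞)`, is upper
semicontinuous, and satisfies the sub-mean value inequality on the boundary of every closed disc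
`{z + ζ w : |ζ| ≤ 1}` in a complex line which is contained in `U`.
The mean over the circle of the function `u` (bounded above, possibly `-∞` somewhere) is the limit
(infimum) of the means of the truncations `max (u, -N)`. The function which is identically `-∞` is
allowed. -/
structure PSHOn {n : ℕ} (U : Set (Cn n)) (u : Cn n → EReal) : Prop where
  ne_top : ∀ z ∈ U, u z ≠ ⊤
  usc : UpperSemicontinuousOn u U
  le_average : ∀ z ∈ U, ∀ w : Cn n, (∀ ζ : ℂ, ‖ζ‖ ≤ 1 → z + ζ • w ∈ U) →
    ∀ N : ℕ, u z ≤ ((Real.circleAverage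
      (fun ζ : ℂ => (max (u (z + ζ • w)) (((-(N : ℝ)) : ℝ) : EReal)).toReal) 0 1 : ℝ) : EReal)

/-- `u` is a maximal plurisubharmonic function on `Ω`. -/
def IsMaximalPSH {n : ℕ} (Ω : Set (Cn n)) (u : Cn n → EReal) : Prop :=
  PSHOn Ω u ∧
    ∀ G : Set (Cn n), IsOpen G → IsCompact (closure G) → closure G ⊆ Ω →
      ∀ v : Cn n → EReal, UpperSemicontinuousOn v (closure G) → PSHOn G v →
        (∀ z ∈ frontier G, v z ≤ u z) → ∀ z ∈ G, v z ≤ u z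

/-! ### Exterior forms -/

/-- Real alternating `m`-forms on the real vector space underlying `ℂⁿ`. -/
abbrev Form (n m : ℕ) : Type := Cn n [⋀^Fin m]→L[ℝ] ℝ

/-- The wedge product `l₁ ∧ ⋯ ∧ l_m` of real linear forms, `(v₁, …, v_m) ↦ det (l_j (v_i))`. -/
def wedgeOne {n m : ℕ} (l : Fin m → (Cn n →L[ℝ] ℝ)) : Form n m :=
  { (Matrix.detRowAlternating (R := ℝ) (n := Fin m)).compLinearMap
      (LinearMap.pi fun j => (l j : Cn n →ₗ[ℝ] ℝ)) with
    cont := by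
      change Continuous fun v : Fin m → Cn n => Matrix.det (Matrix.of fun i j => l j (v i))
      refine Continuous.matrix_det ?_
      refine continuous_matrix fun i j => ?_
      exact (l j).continuous.comp (continuous_apply i) }

/-- For complex linear forms `α₁, …, α_p` (that is, `(1,0)`-covectors), the real `(p,p)`-covector
`Re α₁ ∧ Im α₁ ∧ ⋯ ∧ Re α_p ∧ Im α_p`. Since `i α ∧ ᾱ = 2 Re α ∧ Im α`, it is equal to
`2⁻ᵖ (i α₁ ∧ ᾱ₁) ∧ ⋯ ∧ (i α_p ∧ ᾱ_p)`. -/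
def elementaryForm {n p : ℕ} (α : Fin p → (Cn n →L[ℂ] ℂ)) : Form n (2 * p) :=
  wedgeOne fun k : Fin (2 * p) =>
    if (k : ℕ) % 2 = 0 then
      Complex.reCLM.comp ((α ⟨(k : ℕ) / 2, by omega⟩).restrictScalars ℝ)
    else
      Complex.imCLM.comp ((α ⟨(k : ℕ) / 2, by omega⟩).restrictScalars ℝ)

/-- The form `ω^q`, where `ω = dd^c |z|² = 2i ∑_j dz_j ∧ dz̄_j = ∑_j 4 dx_j ∧ dy_j`, expanded:
`ω^q = ∑_{j₁, …, j_q} 4^q dx_{j₁} ∧ dy_{j₁} ∧ ⋯ ∧ dx_{j_q} ∧ dy_{j_q}`. -/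
def omegaPow (n q : ℕ) : Form n (2 * q) :=
  ∑ I : Fin q → Fin n, (4 : ℝ) ^ q •
    elementaryForm fun k => (ContinuousLinearMap.proj (I k) : Cn n →L[ℂ] ℂ)

/-- The action of a complex scalar `c` on `m`-forms, `(c^* φ)(v₁, …, v_m) = φ (c v₁, …, c v_m)`.
A covector of type `(r,s)` is multiplied by `c^r c̄^s`. -/
def pull {n m : ℕ} (c : ℂ) (φ : Form n m) : Form n m :=
  φ.compContinuousLinearMap ((c • ContinuousLinearMap.id ℂ (Cn n)).restrictScalars ℝ)

/-- The operator `d^c = i (∂̄ - ∂)` on differential forms, written as `J⁻¹ d J`, where `J` is the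
action of `i`. Indeed, on forms of type `(r,s)` the operator `J` is the multiplication by
`i^(r-s)`. -/
def dc {n m : ℕ} (φ : Cn n → Form n m) : Cn n → Form n (m + 1) :=
  fun x => pull (-Complex.I) (extDeriv (fun y => pull Complex.I (φ y)) x)

/-- The operator `dd^c = 2i ∂∂̄` on differential forms. -/
def ddc {n m : ℕ} (φ : Cn n → Form n m) : Cn n → Form n (m + 2) :=
  extDeriv (dc φ)

/-! ### Currents -/

/-- Test forms of degree `m` on `Ω`: smooth real `m`-forms with compact support in `Ω`. -/
abbrev TestForm {n : ℕ} (Ω : TopologicalSpace.Opens (Cn n)) (m : ℕ) : Type := 𝓓(Ω, Form n m)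

/-- Real currents of dimension `m` (degree `2n - m`) on `Ω`: continuous linear functionals on the
space of test forms of degree `m`. (Positive currents are real, so they are given by their values
on real test forms.) -/
abbrev Current {n : ℕ} (Ω : TopologicalSpace.Opens (Cn n)) (m : ℕ) : Type :=
  TestForm Ω m →L[ℝ] ℝ

variable {n : ℕ} {Ω : TopologicalSpace.Opens (Cn n)}

/-- The test form `χ β`, for a test function `χ` and a form `β` with constant coefficients. -/
def smulForm {m : ℕ} (χ : 𝓓(Ω, ℝ)) (β : Form n m) : TestForm Ω m :=
  TestFunction.postcompCLM (ContinuousLinearMap.toSpanSingleton ℝ β) χ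

/-- The current is closed: `dT = 0`, i.e. `T` vanishes on the differentials of test forms. -/
def IsClosedCurrent : {m : ℕ} → Current Ω m → Prop
  | 0, _ => True
  | m + 1, T => ∀ (φ : TestForm Ω m) (ψ : TestForm Ω (m + 1)),
      (∀ x, ψ x = extDeriv φ x) → T ψ = 0

/-- The current `T` of dimension `2p` has bidimension `(p,p)`, i.e. bidegree `(n-p, n-p)`:
it sees only the `(p,p)`-components of test forms. As the rotation by `e^{iθ}` multiplies the
`(r,s)`-component of a form by `e^{i(r-s)θ}`, this says that `T` does not change if test forms are
rotated (pointwise, on covectors). -/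
def IsBidim {p : ℕ} (T : Current Ω (2 * p)) : Prop :=
  ∀ (θ : ℝ) (φ ψ : TestForm Ω (2 * p)),
    (∀ x, ψ x = pull (Complex.exp (θ * Complex.I)) (φ x)) → T ψ = T φ

/-- The current `T` of bidimension `(p,p)` is positive: `T ∧ i α₁ ∧ ᾱ₁ ∧ ⋯ ∧ i α_p ∧ ᾱ_p` is a
positive distribution for all `(1,0)`-forms `α₁, …, α_p` with constant coefficients. -/
def IsPositive {p : ℕ} (T : Current Ω (2 * p)) : Prop :=
  ∀ (α : Fin p → (Cn n →L[ℂ] ℂ)) (χ : 𝓓(Ω, ℝ)), (∀ x, 0 ≤ χ x) →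
    0 ≤ T (smulForm χ (elementaryForm α))

/-- Closed positive currents of bidimension `(p,p)`, i.e. of bidegree `(n-p, n-p)`. -/
structure IsClosedPositive {p : ℕ} (T : Current Ω (2 * p)) : Prop where
  bidim : IsBidim T
  positive : IsPositive T
  closed : IsClosedCurrent T

/-! ### Measures given by positive distributions -/

/-- The measure `μ` on `Ω` (a measure on `ℂⁿ` that does not charge the complement of `Ω`) is
a Radon measure on `Ω` and represents the functional `L` on test functions. -/
structure IsRepresentingMeasure (L : 𝓓(Ω, ℝ) → ℝ) (μ : Measure (Cn n)) : Prop where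
  compl_eq_zero : μ (Ω : Set (Cn n))ᶜ = 0
  lt_top_of_isCompact : ∀ K : Set (Cn n), IsCompact K → K ⊆ Ω → μ K < ⊤
  integral_eq : ∀ χ : 𝓓(Ω, ℝ), ∫ x, χ x ∂μ = L χ

open Classical in
/-- The Radon measure on `Ω` given by a positive distribution `L`; it exists and is unique by the
Riesz representation theorem. -/
def measureOf (L : 𝓓(Ω, ℝ) → ℝ) : Measure (Cn n) :=
  if h : ∃ μ, IsRepresentingMeasure L μ then h.choose else 0

/-- The measure `T ∧ ω^q` of a positive current `T` of bidimension `(q,q)`. -/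
def traceMeasure {q : ℕ} (T : Current Ω (2 * q)) : Measure (Cn n) :=
  measureOf fun χ => T (smulForm χ (omegaPow n q))

/-- The measure given by a positive current of bidimension `(0,0)`. -/
def zeroDimMeasure (S : Current Ω 0) : Measure (Cn n) :=
  measureOf fun χ => S (smulForm χ (ContinuousAlternatingMap.constOfIsEmpty ℝ (Cn n) (Fin 0) 1))

/-! ### The product `T ∧ (dd^c u)^q` of Bedford and Taylor -/

/-- The current `T` is represented by integration: `T φ = ∫ ⟨τ (x), φ (x)⟩ dμ(x)`, where `μ` is a
measure and (the coordinates of) `τ` are locally `μ`-integrable on `Ω`. So `T` has measure coefficients, as every positive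
current does. -/
structure IsRepresentedBy {m : ℕ} (T : Current Ω m) (μ : Measure (Cn n))
    (τ : Cn n → (Form n m →L[ℝ] ℝ)) : Prop where
  locallyIntegrable : ∀ β : Form n m, LocallyIntegrableOn (fun x => τ x β) (Ω : Set (Cn n)) μ
  eq_integral : ∀ φ : TestForm Ω m, T φ = ∫ x, τ x (φ x) ∂μ

/-- `S = dd^c u ∧ T := dd^c (u T)`, where `T` is a current with measure coefficients and `u` is
a locally bounded Borel function: if `T = τ μ`, then `u T = u τ μ`, so that
`S φ = (u T) (dd^c φ) = ∫ u ⟨τ, dd^c φ⟩ dμ`. (This does not depend on the choice of `μ` and `τ`.) -/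
def IsDDcWedge {m : ℕ} (u : Cn n → ℝ) (T : Current Ω (m + 2)) (S : Current Ω m) : Prop :=
  ∃ (μ : Measure (Cn n)) (τ : Cn n → (Form n (m + 2) →L[ℝ] ℝ)), IsRepresentedBy T μ τ ∧
    ∀ φ : TestForm Ω m, S φ = ∫ x, u x * τ x (ddc φ x) ∂μ

open Classical in
/-- The current `dd^c u ∧ T = dd^c (u T)`. -/
def ddcWedge {m : ℕ} (u : Cn n → ℝ) (T : Current Ω (m + 2)) : Current Ω m :=
  if h : ∃ S, IsDDcWedge u T S then h.choose else 0

/-- The current `T ∧ (dd^c u)^p` of dimension `0`, for `T` of dimension `2p`, obtained by applying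
`p` times the operation `T ↦ dd^c u ∧ T`. -/
def ddcPowWedge (u : Cn n → ℝ) : (p : ℕ) → Current Ω (2 * p) → Current Ω 0
  | 0, T => T
  | p + 1, T => ddcPowWedge u p (ddcWedge (m := 2 * p) u T)

/-- The measure `T ∧ (dd^c u)^p`, for a closed positive current `T` of bidimension `(p,p)` and
a bounded plurisubharmonic function `u`. -/
def mongeAmpereMeasure {p : ℕ} (T : Current Ω (2 * p)) (u : Cn n → ℝ) : Measure (Cn n) :=
  zeroDimMeasure (ddcPowWedge u p T)

end Pluri

end

/-!
For a bounded plurisubharmonic function `w` on `Ω` and a competitor `v` on `G` with `v ≤ w` on the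
boundary of `G`, integrating by parts `q` times gives
`∫_G ((v - w)⁺)^q T ∧ ω^q ≤ q! M^q ∫_Ω T ∧ (dd^c w)^q`, where `|z|² ≤ M` on `G`. Each integration
by parts trades a factor `ω = dd^c |z|²` for `dd^c w`, because `(v - w)⁺ + w = max (v, w)` is
plurisubharmonic. For smooth `w` and a smooth substitute for the excess `(v - w)⁺` this is a
pointwise inequality between forms paired with a positive current; the general case follows by
mollification, where the `q` factors `dd^c w` are regularized one after the other, at
increasingly fine scales. Applied to the approximants of `u`, whose masses tend to zero, the
estimate shows that `v ≤ u` almost everywhere for the trace measure of every `T_j`, hence Lebesgue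
almost everywhere in `G`, hence everywhere in `G`, since a plurisubharmonic function is the limit
of its mollifications.
-/

open scoped Distributions ContDiff

noncomputable section

namespace Pluri

open MeasureTheory Filter Topology
open ContinuousAlternatingMap (alternatizeUncurryFin alternatizeUncurryFinCLM
  alternatizeUncurryFin_add alternatizeUncurryFin_smul alternatizeUncurryFin_apply
  alternatizeUncurryFin_alternatizeUncurryFinCLM_comp_of_symmetric)

set_option maxSynthPendingDepth 3

section AlternatingForms

variable {E F : Type*} [NormedAddCommGroup E] [NormedSpace ℝ E] [NormedAddCommGroup F]
  [NormedSpace ℝ F] {m : ℕ}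

/-- The alternatization of a bilinear map with values in alternating forms; for
`f (v, w) = l (v) k (w) β` it is `l ∧ k ∧ β`. -/
def altTwo : (E →L[ℝ] E →L[ℝ] E [⋀^Fin m]→L[ℝ] F) →L[ℝ] E [⋀^Fin (m + 2)]→L[ℝ] F :=
  (alternatizeUncurryFinCLM ℝ E F).comp
    (ContinuousLinearMap.compL ℝ E (E →L[ℝ] E [⋀^Fin m]→L[ℝ] F) (E [⋀^Fin (m + 1)]→L[ℝ] F)
      (alternatizeUncurryFinCLM ℝ E F))

lemma altTwo_eq (f : E →L[ℝ] E →L[ℝ] E [⋀^Fin m]→L[ℝ] F) :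
    altTwo f = alternatizeUncurryFin (alternatizeUncurryFinCLM ℝ E F ∘L f) := rfl

lemma altTwo_eq_zero_of_symmetric {f : E →L[ℝ] E →L[ℝ] E [⋀^Fin m]→L[ℝ] F}
    (hf : ∀ v w, f v w = f w v) : altTwo f = 0 :=
  alternatizeUncurryFin_alternatizeUncurryFinCLM_comp_of_symmetric hf

lemma altTwo_congr {f g : E →L[ℝ] E →L[ℝ] E [⋀^Fin m]→L[ℝ] F}
    (h : ∀ v w, f v w - f w v = g v w - g w v) : altTwo f = altTwo g := by
  rw [← sub_eq_zero, ← map_sub]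
  refine altTwo_eq_zero_of_symmetric fun v w => ?_
  simp only [sub_apply]
  exact sub_eq_zero.1 (by rw [← sub_eq_zero.2 (h v w)]; abel)

lemma altTwo_flip (f : E →L[ℝ] E →L[ℝ] E [⋀^Fin m]→L[ℝ] F) : altTwo f.flip = -altTwo f := by
  rw [eq_neg_iff_add_eq_zero, ← map_add]
  refine altTwo_eq_zero_of_symmetric fun v w => ?_
  change f w v + f v w = f v w + f w v
  exact add_comm _ _

/-- The exterior product `l ∧ β` of a covector and a form. -/
def wedgeCovector : (E →L[ℝ] ℝ) →L[ℝ] (E [⋀^Fin m]→L[ℝ] F) →L[ℝ] E [⋀^Fin (m + 1)]→L[ℝ] F :=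
  (ContinuousLinearMap.compL ℝ (E [⋀^Fin m]→L[ℝ] F) _ _ (alternatizeUncurryFinCLM ℝ E F)).comp
    (ContinuousLinearMap.smulRightL ℝ E (E [⋀^Fin m]→L[ℝ] F))

lemma wedgeCovector_eq (l : E →L[ℝ] ℝ) (β : E [⋀^Fin m]→L[ℝ] F) :
    wedgeCovector l β = alternatizeUncurryFin (l.smulRight β) := rfl

/-- The bilinear map `(v, w) ↦ H (v, w) β`. -/
def tensorForm :
    (E →L[ℝ] E →L[ℝ] ℝ) →L[ℝ] (E [⋀^Fin m]→L[ℝ] F) →L[ℝ] E →L[ℝ] E →L[ℝ] E [⋀^Fin m]→L[ℝ] F :=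
  ((ContinuousLinearMap.compL ℝ E (E →L[ℝ] ℝ) (E →L[ℝ] E [⋀^Fin m]→L[ℝ] F)).comp
    (ContinuousLinearMap.smulRightL ℝ E (E [⋀^Fin m]→L[ℝ] F)).flip).flip

@[simp] lemma tensorForm_apply (H : E →L[ℝ] E →L[ℝ] ℝ) (β : E [⋀^Fin m]→L[ℝ] F) (v w : E) :
    tensorForm H β v w = H v w • β := rfl

lemma altTwo_tensorForm_smulRight (l k : E →L[ℝ] ℝ) (β : E [⋀^Fin m]→L[ℝ] F) :
    altTwo (tensorForm (l.smulRight k) β) = wedgeCovector l (wedgeCovector k β) := by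
  rw [altTwo_eq, wedgeCovector_eq l]
  congr 1
  ext v : 1
  change alternatizeUncurryFinCLM ℝ E F _ = l v • alternatizeUncurryFinCLM ℝ E F _
  rw [← map_smul]
  congr 1
  ext w : 1
  change (l v • k) w • β = l v • k w • β
  rw [smul_apply, smul_eq_mul, mul_smul]

lemma wedgeCovector_comm (l k : E →L[ℝ] ℝ) (β : E [⋀^Fin m]→L[ℝ] F) :
    wedgeCovector l (wedgeCovector k β) = -wedgeCovector k (wedgeCovector l β) := by
  rw [eq_neg_iff_add_eq_zero, ← altTwo_tensorForm_smulRight, ← altTwo_tensorForm_smulRight,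
    ← map_add]
  refine altTwo_eq_zero_of_symmetric fun v w => ?_
  change (l v • k) w • β + (k v • l) w • β = (l w • k) v • β + (k w • l) v • β
  simp only [smul_apply, smul_eq_mul]
  module

lemma wedgeCovector_comm_pair (a b : E →L[ℝ] ℝ) (l k : E →L[ℝ] ℝ) (β : E [⋀^Fin m]→L[ℝ] F) :
    wedgeCovector a (wedgeCovector b (wedgeCovector l (wedgeCovector k β))) =
      wedgeCovector l (wedgeCovector k (wedgeCovector a (wedgeCovector b β))) := by
  rw [wedgeCovector_comm b l, map_neg, wedgeCovector_comm a l, neg_neg, wedgeCovector_comm b k,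
    map_neg, wedgeCovector_comm a k, neg_neg]

lemma extDeriv_smul_fun {w : E → ℝ} {η : E → E [⋀^Fin m]→L[ℝ] F} {x : E}
    (hw : DifferentiableAt ℝ w x) (hη : DifferentiableAt ℝ η x) :
    extDeriv (fun y => w y • η y) x = wedgeCovector (fderiv ℝ w x) (η x) + w x • extDeriv η x := by
  rw [extDeriv, fderiv_fun_smul hw hη, alternatizeUncurryFin_add, alternatizeUncurryFin_smul]
  exact add_comm _ _

lemma extDeriv_wedgeCovector {l : E → (E →L[ℝ] ℝ)} {φ : E → E [⋀^Fin m]→L[ℝ] F} {x : E}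
    (hl : DifferentiableAt ℝ l x) (hφ : DifferentiableAt ℝ φ x) :
    extDeriv (fun y => wedgeCovector (l y) (φ y)) x =
      altTwo (tensorForm (fderiv ℝ l x) (φ x)) - wedgeCovector (l x) (extDeriv φ x) := by
  set f : E →L[ℝ] E →L[ℝ] E [⋀^Fin m]→L[ℝ] F :=
    (ContinuousLinearMap.smulRightL ℝ E (E [⋀^Fin m]→L[ℝ] F) (l x)).comp (fderiv ℝ φ x)
  have leibniz : fderiv ℝ (fun y => wedgeCovector (l y) (φ y)) x =
      (alternatizeUncurryFinCLM ℝ E F).comp f +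
      (alternatizeUncurryFinCLM ℝ E F).comp (tensorForm (fderiv ℝ l x) (φ x)) :=
    ((wedgeCovector (E := E) (F := F) (m := m)).hasFDerivAt_of_bilinear hl.hasFDerivAt
      hφ.hasFDerivAt).fderiv
  have flip_eq : wedgeCovector (l x) (extDeriv φ x) = altTwo f.flip := by
    rw [altTwo_eq, wedgeCovector_eq]
    congr 1
    ext v : 1
    change l x v • alternatizeUncurryFinCLM ℝ E F (fderiv ℝ φ x) =
      alternatizeUncurryFinCLM ℝ E F (f.flip v)
    rw [← map_smul]
    rfl
  rw [extDeriv, leibniz, alternatizeUncurryFin_add, ← altTwo_eq, ← altTwo_eq, flip_eq,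
    altTwo_flip, sub_neg_eq_add]
  exact add_comm _ _

end AlternatingForms

section SecondDerivative

variable {E F : Type*} [NormedAddCommGroup E] [NormedSpace ℝ E] [NormedAddCommGroup F]
  [NormedSpace ℝ F]

lemma contDiff_infty_fderiv {f : E → F} (hf : ContDiff ℝ ∞ f) : ContDiff ℝ ∞ (fderiv ℝ f) :=
  (contDiff_infty_iff_fderiv.1 hf).2

lemma fderiv_fderiv_symm {f : E → F} (hf : ContDiff ℝ 2 f) (x v w : E) :
    fderiv ℝ (fderiv ℝ f) x v w = fderiv ℝ (fderiv ℝ f) x w v :=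
  (hf.contDiffAt.isSymmSndFDerivAt (by simp)) v w

end SecondDerivative

section Rotation

variable {n m : ℕ}

/-- Multiplication by a complex scalar, as a real linear map of `ℂⁿ`. -/
def scalarMap (n : ℕ) (c : ℂ) : Cn n →L[ℝ] Cn n :=
  (c • ContinuousLinearMap.id ℂ (Cn n)).restrictScalars ℝ

@[simp] lemma scalarMap_apply (c : ℂ) (v : Cn n) : scalarMap n c v = c • v := rfl

/-- Precomposition of a linear map with multiplication by `-i`; on differentials of functions it
is the passage from `d` to `d^c`. -/
def precompNegI {F : Type*} [NormedAddCommGroup F] [NormedSpace ℝ F] :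
    (Cn n →L[ℝ] F) →L[ℝ] (Cn n →L[ℝ] F) :=
  (ContinuousLinearMap.compL ℝ (Cn n) (Cn n) F).flip (scalarMap n (-Complex.I))

/-- The bilinear map `(v, w) ↦ K (v, -i w)`. -/
def twist {F : Type*} [NormedAddCommGroup F] [NormedSpace ℝ F] :
    (Cn n →L[ℝ] Cn n →L[ℝ] F) →L[ℝ] (Cn n →L[ℝ] Cn n →L[ℝ] F) :=
  ContinuousLinearMap.compL ℝ (Cn n) (Cn n →L[ℝ] F) (Cn n →L[ℝ] F) precompNegI

@[simp] lemma twist_apply {F : Type*} [NormedAddCommGroup F] [NormedSpace ℝ F]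
    (K : Cn n →L[ℝ] Cn n →L[ℝ] F) (v w : Cn n) : twist K v w = K v (-Complex.I • w) := rfl

lemma pull_apply (c : ℂ) (φ : Form n m) (v : Fin m → Cn n) :
    pull c φ v = φ fun i => c • v i := rfl

/-- `pull c` as a continuous linear map. -/
def pullCLM (c : ℂ) : Form n m →L[ℝ] Form n m :=
  ContinuousAlternatingMap.compContinuousLinearMapCLM (scalarMap n c)

lemma pull_pull (c d : ℂ) (φ : Form n m) : pull c (pull d φ) = pull (d * c) φ := by
  ext v; simp [pull_apply, mul_smul]

lemma pull_one (φ : Form n m) : pull 1 φ = φ := by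
  ext v; simp [pull_apply]

lemma pull_alternatizeUncurryFin (c : ℂ) (f : Cn n →L[ℝ] Form n m) :
    pull c (alternatizeUncurryFin f) =
      alternatizeUncurryFin ((pullCLM c).comp (f.comp (scalarMap n c))) := by
  ext v
  simp only [pull_apply, alternatizeUncurryFin_apply]
  rfl

lemma pull_wedgeCovector (c : ℂ) (l : Cn n →L[ℝ] ℝ) (β : Form n m) :
    pull c (wedgeCovector l β) = wedgeCovector (l.comp (scalarMap n c)) (pull c β) := by
  rw [wedgeCovector_eq, pull_alternatizeUncurryFin, wedgeCovector_eq]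
  congr 1

/-- The pullback, by multiplication by `c`, of a bilinear map with values in forms. -/
def pullBilin (c : ℂ) (f : Cn n →L[ℝ] Cn n →L[ℝ] Form n m) : Cn n →L[ℝ] Cn n →L[ℝ] Form n m :=
  (ContinuousLinearMap.compL ℝ (Cn n) (Form n m) (Form n m) (pullCLM c)).comp
    (f.bilinearComp (scalarMap n c) (scalarMap n c))

lemma pull_altTwo (c : ℂ) (f : Cn n →L[ℝ] Cn n →L[ℝ] Form n m) :
    pull c (altTwo f) = altTwo (pullBilin c f) := by
  rw [altTwo_eq, pull_alternatizeUncurryFin, altTwo_eq]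
  congr 1
  ext v : 1
  change pull c (alternatizeUncurryFin (f (c • v))) = alternatizeUncurryFin (pullBilin c f v)
  rw [pull_alternatizeUncurryFin]
  rfl

lemma complex_smul_eq (c : ℂ) (v : Cn n) : c • v = c.re • v + c.im • (Complex.I • v) := by
  ext i
  simp only [Pi.smul_apply, Pi.add_apply, smul_eq_mul, Complex.real_smul]
  conv_lhs => rw [← Complex.re_add_im c]
  ring

lemma twist_smul_smul {F : Type*} [NormedAddCommGroup F] [NormedSpace ℝ F] (c : ℂ)
    (K : Cn n →L[ℝ] Cn n →L[ℝ] F) (v w : Cn n) :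
    twist K (c • v) (c • w) =
      -(c.re * c.re) • K v (Complex.I • w) + (c.re * c.im) • K v w
        - (c.re * c.im) • K (Complex.I • v) (Complex.I • w)
        + (c.im * c.im) • K (Complex.I • v) w := by
  have hw : -Complex.I • c • w = -c.re • (Complex.I • w) + c.im • w := by
    ext i
    simp only [Pi.smul_apply, Pi.add_apply, smul_eq_mul, Complex.real_smul]
    conv_lhs => rw [← Complex.re_add_im c]
    push_cast
    linear_combination (- (c.im : ℂ) * w i) * Complex.I_mul_I
  rw [twist_apply, hw, complex_smul_eq c v]
  simp only [map_add, map_smul, add_apply, smul_apply]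
  module

lemma altTwo_twist_bilinearComp_scalarMap {c : ℂ} (hc : ‖c‖ = 1)
    {K : Cn n →L[ℝ] Cn n →L[ℝ] Form n m} (hK : ∀ v w, K v w = K w v) :
    altTwo ((twist K).bilinearComp (scalarMap n c) (scalarMap n c)) = altTwo (twist K) := by
  have im_sq : c.im * c.im = 1 - c.re * c.re := by
    have := Complex.normSq_eq_norm_sq c
    rw [hc, Complex.normSq_apply] at this
    linarith
  have twist_eq (v w : Cn n) : twist K v w = -K v (Complex.I • w) := by
    rw [twist_apply, neg_smul, map_neg]
  refine altTwo_congr fun v w => ?_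
  change twist K (c • v) (c • w) - twist K (c • w) (c • v) = _
  rw [twist_smul_smul, twist_smul_smul, twist_eq, twist_eq, hK w v,
    hK (Complex.I • w) (Complex.I • v), hK w (Complex.I • v), hK (Complex.I • w) v, im_sq]
  module

lemma pull_altTwo_twist {c : ℂ} (hc : ‖c‖ = 1) {K : Cn n →L[ℝ] Cn n →L[ℝ] Form n m}
    (hK : ∀ v w, K v w = K w v) :
    pull c (altTwo (twist K)) = altTwo (twist
      ((ContinuousLinearMap.compL ℝ (Cn n) (Form n m) (Form n m) (pullCLM c)).comp K)) := by
  rw [pull_altTwo, ← altTwo_twist_bilinearComp_scalarMap hc]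
  · rfl
  · exact fun v w => congrArg (pullCLM c) (hK v w)

/-- For the real Hessian `H` of a function `w` at a point, `hessWedge H β` is `dd^c w ∧ β`. -/
def hessWedge : (Cn n →L[ℝ] Cn n →L[ℝ] ℝ) →L[ℝ] Form n m →L[ℝ] Form n (m + 2) :=
  (ContinuousLinearMap.compL ℝ (Form n m) _ _ (altTwo.comp twist)).comp tensorForm

lemma hessWedge_apply (H : Cn n →L[ℝ] Cn n →L[ℝ] ℝ) (β : Form n m) :
    hessWedge H β = altTwo (twist (tensorForm H β)) := rfl

lemma pull_hessWedge {c : ℂ} (hc : ‖c‖ = 1) {H : Cn n →L[ℝ] Cn n →L[ℝ] ℝ}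
    (hH : ∀ v w, H v w = H w v) (β : Form n m) :
    pull c (hessWedge H β) = hessWedge H (pull c β) := by
  rw [hessWedge_apply, pull_altTwo_twist hc fun v w => by simp [hH v w], hessWedge_apply]
  congr 2

lemma exists_hessWedge_eq_sum (H : Cn n →L[ℝ] Cn n →L[ℝ] ℝ) :
    ∃ (ι : Type) (_ : Fintype ι) (l k : ι → (Cn n →L[ℝ] ℝ)), ∀ (m : ℕ) (β : Form n m),
      hessWedge H β = ∑ i, wedgeCovector (l i) (wedgeCovector (k i) β) := by
  let b := Module.finBasis ℝ (Cn n)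
  refine ⟨Fin (Module.finrank ℝ (Cn n)), inferInstance,
    fun i => (b.coord i).toContinuousLinearMap, fun i => twist H (b i), fun m β => ?_⟩
  simp_rw [← altTwo_tensorForm_smulRight]
  rw [← map_sum, hessWedge_apply]
  congr 1
  ext v w : 2
  rw [sum_apply, sum_apply]
  change H v (-Complex.I • w) • β = ∑ i, (b.coord i v * H (b i) (-Complex.I • w)) • β
  rw [← Finset.sum_smul]
  congr 1
  conv_lhs => rw [← b.sum_repr v, map_sum, sum_apply]
  simp

lemma hessWedge_comm (H K : Cn n →L[ℝ] Cn n →L[ℝ] ℝ) (β : Form n m) :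
    hessWedge H (hessWedge K β) = hessWedge K (hessWedge H β) := by
  obtain ⟨ι, _, l, k, hH⟩ := exists_hessWedge_eq_sum H
  obtain ⟨ι', _, l', k', hK⟩ := exists_hessWedge_eq_sum K
  simp only [hH, hK, map_sum]
  rw [Finset.sum_comm]
  simp only [wedgeCovector_comm_pair]

end Rotation

section FormCalculus

variable {n m : ℕ}

lemma extDeriv_pull (c : ℂ) {φ : Cn n → Form n m} {x : Cn n} (hφ : DifferentiableAt ℝ φ x) :
    extDeriv (fun y => pull c (φ y)) x =
      alternatizeUncurryFin ((pullCLM c).comp (fderiv ℝ φ x)) := by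
  rw [extDeriv]
  congr 1
  exact ((pullCLM c).hasFDerivAt.comp x hφ.hasFDerivAt).fderiv

lemma dc_eq {φ : Cn n → Form n m} {x : Cn n} (hφ : DifferentiableAt ℝ φ x) :
    dc φ x = alternatizeUncurryFin (precompNegI (fderiv ℝ φ x)) := by
  rw [dc, extDeriv_pull _ hφ, pull_alternatizeUncurryFin]
  congr 1
  ext v : 1
  change pull (-Complex.I) (pull Complex.I _) = fderiv ℝ φ x (-Complex.I • v)
  rw [pull_pull]
  simp [pull_one]

lemma dc_eq_comp {φ : Cn n → Form n m} (hφ : Differentiable ℝ φ) :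
    dc φ = fun y => (alternatizeUncurryFinCLM ℝ (Cn n) ℝ).comp precompNegI (fderiv ℝ φ y) :=
  funext fun y => dc_eq (hφ y)

lemma pull_I_dc {φ : Cn n → Form n m} {x : Cn n} :
    pull Complex.I (dc φ x) = extDeriv (fun y => pull Complex.I (φ y)) x := by
  rw [dc, pull_pull]
  simp [pull_one]

lemma ddc_eq {φ : Cn n → Form n m} (hφ : ContDiff ℝ 2 φ) (x : Cn n) :
    ddc φ x = altTwo (twist (fderiv ℝ (fderiv ℝ φ) x)) := by
  have hdφ : DifferentiableAt ℝ (fderiv ℝ φ) x :=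
    (hφ.fderiv_right (m := 1) le_rfl).differentiable one_ne_zero x
  rw [ddc, dc_eq_comp (hφ.differentiable two_ne_zero), extDeriv, altTwo_eq]
  congr 1
  exact (((alternatizeUncurryFinCLM ℝ (Cn n) ℝ).comp precompNegI).hasFDerivAt.comp x
    hdφ.hasFDerivAt).fderiv

lemma dc_extDeriv {φ : Cn n → Form n m} (hφ : ContDiff ℝ 2 φ) (x : Cn n) :
    dc (extDeriv φ) x = -ddc φ x := by
  have hdφ : DifferentiableAt ℝ (fderiv ℝ φ) x :=
    (hφ.fderiv_right (m := 1) le_rfl).differentiable one_ne_zero x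
  have hasFDerivAt_extDeriv : HasFDerivAt (extDeriv φ) ((alternatizeUncurryFinCLM ℝ (Cn n) ℝ).comp
      (fderiv ℝ (fderiv ℝ φ) x)) x :=
    (alternatizeUncurryFinCLM ℝ (Cn n) ℝ).hasFDerivAt.comp x hdφ.hasFDerivAt
  rw [dc_eq hasFDerivAt_extDeriv.differentiableAt, hasFDerivAt_extDeriv.fderiv, ddc_eq hφ]
  change altTwo ((fderiv ℝ (fderiv ℝ φ) x).comp (scalarMap n (-Complex.I))) = _
  rw [eq_neg_iff_add_eq_zero, ← map_add]
  refine altTwo_eq_zero_of_symmetric fun v w => ?_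
  change fderiv ℝ (fderiv ℝ φ) x (-Complex.I • v) w + fderiv ℝ (fderiv ℝ φ) x v (-Complex.I • w) =
    fderiv ℝ (fderiv ℝ φ) x (-Complex.I • w) v + fderiv ℝ (fderiv ℝ φ) x w (-Complex.I • v)
  rw [fderiv_fderiv_symm hφ x w, fderiv_fderiv_symm hφ x _ v, add_comm]

lemma ddc_extDeriv {φ : Cn n → Form n m} (hφ : ContDiff ℝ 3 φ) (x : Cn n) :
    ddc (extDeriv φ) x = 0 := by
  have hφ2 : ContDiff ℝ 2 φ := hφ.of_le (by norm_num)
  have contDiff_dc : ContDiff ℝ 2 (dc φ) := by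
    rw [dc_eq_comp (hφ2.differentiable two_ne_zero)]
    exact (ContinuousLinearMap.contDiff _).comp (hφ.fderiv_right (by norm_num))
  have dc_d : dc (extDeriv φ) = (-1 : ℝ) • extDeriv (dc φ) := by
    funext y
    rw [dc_extDeriv hφ2 y, Pi.smul_apply, neg_one_smul, ddc]
  rw [ddc, dc_d, extDeriv_smul, extDeriv_extDeriv contDiff_dc (by simp)]
  simp

end FormCalculus

section TestForms

variable {n m : ℕ} {Ω : TopologicalSpace.Opens (Cn n)}

/-- Smooth functions on `ℂⁿ`. -/
abbrev SmoothFn (n : ℕ) : Type := {w : Cn n → ℝ // ContDiff ℝ ∞ w}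

/-- The real Hessian of a function. -/
abbrev hess (w : Cn n → ℝ) (x : Cn n) : Cn n →L[ℝ] Cn n →L[ℝ] ℝ := fderiv ℝ (fderiv ℝ w) x

lemma hess_symm (w : SmoothFn n) (x v v' : Cn n) : hess w.1 x v v' = hess w.1 x v' v :=
  fderiv_fderiv_symm (contDiff_infty.1 w.2 2) x v v'

/-- A smooth map which vanishes wherever the test function `φ` does, as a test function. -/
def testOf {F F' : Type*} [NormedAddCommGroup F] [NormedSpace ℝ F] [NormedAddCommGroup F']
    [NormedSpace ℝ F'] (φ : 𝓓(Ω, F)) (f : Cn n → F') (hf : ContDiff ℝ ∞ f)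
    (h : ∀ x, φ x = 0 → f x = 0) : 𝓓(Ω, F') where
  toFun := f
  contDiff' := hf
  hasCompactSupport' := φ.hasCompactSupport.mono fun x hx hφ => hx (h x hφ)
  tsupport_subset' := (closure_mono (Function.support_subset_iff'.2 fun x hx =>
    h x (by simpa using hx))).trans φ.tsupport_subset

/-- The exterior derivative of test forms. -/
def dTest : TestForm Ω m →L[ℝ] TestForm Ω (m + 1) :=
  (TestFunction.postcompCLM (alternatizeUncurryFinCLM ℝ (Cn n) ℝ)).comp
    (TestFunction.fderivCLM ℝ ⊤ ⊤)

lemma dTest_apply (φ : TestForm Ω m) (x : Cn n) : dTest φ x = extDeriv φ x := by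
  simp [dTest, extDeriv]

/-- The operator `d^c` on test forms. -/
def dcTest : TestForm Ω m →L[ℝ] TestForm Ω (m + 1) :=
  (TestFunction.postcompCLM ((alternatizeUncurryFinCLM ℝ (Cn n) ℝ).comp precompNegI)).comp
    (TestFunction.fderivCLM ℝ ⊤ ⊤)

lemma coe_dcTest (φ : TestForm Ω m) : ⇑(dcTest φ) = dc φ := by
  rw [dc_eq_comp (φ.contDiff.differentiable (by simp))]
  funext x
  simp [dcTest]

/-- The operator `dd^c` on test forms. -/
def ddcTest : TestForm Ω m →L[ℝ] TestForm Ω (m + 2) :=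
  (dTest (m := m + 1)).comp dcTest

lemma ddcTest_apply (φ : TestForm Ω m) (x : Cn n) : ddcTest φ x = ddc φ x := by
  change dTest (dcTest φ) x = _
  rw [dTest_apply, coe_dcTest, ddc]

/-- The rotation of test forms by `c`, acting on covectors pointwise. -/
def pullTest (c : ℂ) : TestForm Ω m →L[ℝ] TestForm Ω m := TestFunction.postcompCLM (pullCLM c)

lemma pullTest_apply (c : ℂ) (φ : TestForm Ω m) (x : Cn n) : pullTest c φ x = pull c (φ x) := rfl

/-- The product of a smooth function and a test form. -/
def mulTest (w : SmoothFn n) (φ : TestForm Ω m) : TestForm Ω m :=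
  testOf φ (fun x => w.1 x • φ x) (w.2.smul φ.contDiff) fun x hx => by simp [hx]

lemma mulTest_apply (w : SmoothFn n) (φ : TestForm Ω m) (x : Cn n) :
    mulTest w φ x = w.1 x • φ x := rfl

/-- The test form `dd^c w ∧ φ`, for a smooth function `w` and a test form `φ`. -/
def hessTest (w : SmoothFn n) (φ : TestForm Ω m) : TestForm Ω (m + 2) :=
  testOf φ (fun x => hessWedge (hess w.1 x) (φ x))
    ((hessWedge.contDiff.comp (contDiff_infty_fderiv (contDiff_infty_fderiv w.2))).clm_apply
      φ.contDiff)
    fun x hx => by simp [hx]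

lemma hessTest_apply (w : SmoothFn n) (φ : TestForm Ω m) (x : Cn n) :
    hessTest w φ x = hessWedge (hess w.1 x) (φ x) := rfl

lemma pullTest_hessTest {c : ℂ} (hc : ‖c‖ = 1) (w : SmoothFn n) (φ : TestForm Ω m) :
    pullTest c (hessTest w φ) = hessTest w (pullTest c φ) := by
  ext1 x
  rw [hessTest_apply, pullTest_apply, pullTest_apply, hessTest_apply,
    pull_hessWedge hc (hess_symm w x)]

/-- The test form `l ∧ φ`, for a smooth field of covectors `l` and a test form `φ`. -/
def wedgeTest (l : Cn n → (Cn n →L[ℝ] ℝ)) (hl : ContDiff ℝ ∞ l) (φ : TestForm Ω m) :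
    TestForm Ω (m + 1) :=
  testOf φ (fun x => wedgeCovector (l x) (φ x))
    (((wedgeCovector (E := Cn n) (F := ℝ) (m := m)).contDiff.comp hl).clm_apply φ.contDiff)
    fun x hx => by simp [hx]

lemma wedgeTest_apply (l : Cn n → (Cn n →L[ℝ] ℝ)) (hl : ContDiff ℝ ∞ l) (φ : TestForm Ω m)
    (x : Cn n) : wedgeTest l hl φ x = wedgeCovector (l x) (φ x) := rfl

/-- The test form `dw ∧ φ`. -/
def dWedgeTest (w : SmoothFn n) (φ : TestForm Ω m) : TestForm Ω (m + 1) :=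
  wedgeTest (fderiv ℝ w.1) (contDiff_infty_fderiv w.2) φ

/-- The test form `d^c w ∧ φ`. -/
def dcWedgeTest (w : SmoothFn n) (φ : TestForm Ω m) : TestForm Ω (m + 1) :=
  wedgeTest (fun x => precompNegI (fderiv ℝ w.1 x))
    ((ContinuousLinearMap.contDiff _).comp (contDiff_infty_fderiv w.2)) φ

lemma dTest_mulTest (w : SmoothFn n) (φ : TestForm Ω m) :
    dTest (mulTest w φ) = dWedgeTest w φ + mulTest w (dTest φ) := by
  ext1 x
  rw [dTest_apply, add_apply, mulTest_apply, dTest_apply]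
  exact extDeriv_smul_fun (w.2.differentiable (by simp) x) (φ.contDiff.differentiable (by simp) x)

lemma dTest_dcWedgeTest (w : SmoothFn n) (φ : TestForm Ω m) :
    dTest (dcWedgeTest w φ) = hessTest w φ - dcWedgeTest w (dTest φ) := by
  have hdw := contDiff_infty_fderiv w.2
  ext1 x
  have fderiv_dc : fderiv ℝ (fun x => precompNegI (fderiv ℝ w.1 x)) x = twist (hess w.1 x) :=
    ((precompNegI (n := n) (F := ℝ)).hasFDerivAt.comp x
      (hdw.differentiable (by simp) x).hasFDerivAt).fderiv
  have leibniz := extDeriv_wedgeCovector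
    (((ContinuousLinearMap.contDiff precompNegI).comp hdw).differentiable (by simp) x)
    (φ.contDiff.differentiable (by simp) x)
  rw [dTest_apply, sub_apply, hessTest_apply, dcWedgeTest, dcWedgeTest, wedgeTest_apply,
    dTest_apply, hessWedge_apply]
  exact leibniz.trans (by rw [Function.comp_def, fderiv_dc]; rfl)

lemma pullTest_I_dWedgeTest_dcTest (w : SmoothFn n) (φ : TestForm Ω m) :
    pullTest Complex.I (dWedgeTest w (dcTest φ)) =
      -dcWedgeTest w (dTest (pullTest Complex.I φ)) := by
  ext1 x
  rw [pullTest_apply, dWedgeTest, dcWedgeTest, wedgeTest_apply, neg_apply, wedgeTest_apply,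
    pull_wedgeCovector, dTest_apply, coe_dcTest, pull_I_dc, ← neg_apply, ← map_neg]
  congr 2
  ext v
  simp [precompNegI]

/-- Apply `T` to the exact forms `d (w d^c φ)` and `d (d^c w ∧ i^* φ)`; the mixed first order terms
cancel because `T` is invariant under the complex structure. -/
lemma apply_mulTest_ddcTest {T : TestForm Ω (m + 2) →ₗ[ℝ] ℝ}
    (hT : ∀ ψ : TestForm Ω (m + 1), T (dTest ψ) = 0)
    (hI : ∀ φ, T (pullTest Complex.I φ) = T φ) (w : SmoothFn n) (φ : TestForm Ω m) :
    T (mulTest w (ddcTest φ)) = T (hessTest w φ) := by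
  have first := hT (mulTest w (dcTest φ))
  rw [dTest_mulTest, map_add, ← hI, pullTest_I_dWedgeTest_dcTest, map_neg] at first
  have second := hT (dcWedgeTest w (pullTest Complex.I φ))
  rw [dTest_dcWedgeTest, map_sub, ← pullTest_hessTest (by simp), hI] at second
  change T (mulTest w (dTest (dcTest φ))) = _
  linarith

end TestForms

section PositiveForms

open scoped ComplexOrder

variable {n m p : ℕ}

lemma wedgeOne_apply (l : Fin m → (Cn n →L[ℝ] ℝ)) (v : Fin m → Cn n) :
    wedgeOne l v = Matrix.det (Matrix.of fun i j => l j (v i)) := rfl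

lemma wedgeCovector_wedgeOne (l : Cn n →L[ℝ] ℝ) (k : Fin m → (Cn n →L[ℝ] ℝ)) :
    wedgeCovector l (wedgeOne k) = wedgeOne (Fin.cons l k : Fin (m + 1) → (Cn n →L[ℝ] ℝ)) := by
  ext v
  rw [wedgeCovector_eq, alternatizeUncurryFin_apply, wedgeOne_apply, Matrix.det_succ_column_zero]
  refine Finset.sum_congr rfl fun i _ => ?_
  simp only [ContinuousLinearMap.smulRight_apply, Matrix.of_apply, Fin.cons_zero]
  rw [ContinuousAlternatingMap.smul_apply, wedgeOne_apply, zsmul_eq_mul, smul_eq_mul, mul_assoc]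
  push_cast
  rfl

lemma wedgeOne_succ (l : Fin (m + 1) → (Cn n →L[ℝ] ℝ)) :
    wedgeOne l = wedgeCovector (l 0) (wedgeOne fun i => l i.succ) := by
  rw [wedgeCovector_wedgeOne]
  exact congrArg wedgeOne (Fin.cons_self_tail l).symm

/-- The real part of a complex linear form. -/
def rePart (α : Cn n →L[ℂ] ℂ) : Cn n →L[ℝ] ℝ := Complex.reCLM.comp (α.restrictScalars ℝ)

/-- The imaginary part of a complex linear form. -/
def imPart (α : Cn n →L[ℂ] ℂ) : Cn n →L[ℝ] ℝ := Complex.imCLM.comp (α.restrictScalars ℝ)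

@[simp] lemma rePart_apply (α : Cn n →L[ℂ] ℂ) (v : Cn n) : rePart α v = (α v).re := rfl

@[simp] lemma imPart_apply (α : Cn n →L[ℂ] ℂ) (v : Cn n) : imPart α v = (α v).im := rfl

/-- The exterior product with `Re α ∧ Im α = (i / 2) α ∧ ᾱ`. -/
def wedgeReIm (α : Cn n →L[ℂ] ℂ) : Form n m →L[ℝ] Form n (m + 2) :=
  (wedgeCovector (rePart α)).comp (wedgeCovector (imPart α))

lemma wedgeReIm_apply (α : Cn n →L[ℂ] ℂ) (β : Form n m) :
    wedgeReIm α β = wedgeCovector (rePart α) (wedgeCovector (imPart α) β) := rfl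

lemma elementaryForm_cons (a : Cn n →L[ℂ] ℂ) (α : Fin p → (Cn n →L[ℂ] ℂ)) :
    elementaryForm (Fin.cons a α : Fin (p + 1) → (Cn n →L[ℂ] ℂ)) =
      wedgeReIm a (elementaryForm α) := by
  rw [wedgeReIm_apply, elementaryForm, elementaryForm, wedgeCovector_wedgeOne]
  refine Eq.trans ?_ (wedgeCovector_wedgeOne (rePart a) _).symm
  congr 1
  funext k
  match k with
  | ⟨0, _⟩ =>
    have index : (⟨0 / 2, by omega⟩ : Fin (p + 1)) = 0 := Fin.ext (Nat.zero_div 2)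
    simp only [index]
    rfl
  | ⟨1, _⟩ =>
    have index : (⟨1 / 2, by omega⟩ : Fin (p + 1)) = 0 := Fin.ext rfl
    simp only [index]
    rfl
  | ⟨k + 2, hk⟩ =>
    have index : (⟨(k + 2) / 2, by omega⟩ : Fin (p + 1)) = Fin.succ ⟨k / 2, by omega⟩ :=
      Fin.ext (by simp)
    change _ = if k % 2 = 0 then rePart (α ⟨k / 2, by omega⟩) else imPart (α ⟨k / 2, by omega⟩)
    simp only [Nat.add_mod_right, index, Fin.cons_succ]
    rfl

/-- The symmetric bilinear form `Re (α (v) conj (α (w)))`. -/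
def leviForm (α : Cn n →L[ℂ] ℂ) : Cn n →L[ℝ] Cn n →L[ℝ] ℝ :=
  (rePart α).smulRight (rePart α) + (imPart α).smulRight (imPart α)

lemma leviForm_apply (α : Cn n →L[ℂ] ℂ) (v w : Cn n) :
    leviForm α v w = (α v).re * (α w).re + (α v).im * (α w).im := by
  simp [leviForm]

lemma hessWedge_leviForm (α : Cn n →L[ℂ] ℂ) (β : Form n m) :
    hessWedge (leviForm α) β = (2 : ℝ) • wedgeReIm α β := by
  rw [hessWedge_apply, wedgeReIm_apply, ← altTwo_tensorForm_smulRight, ← map_smul]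
  refine altTwo_congr fun v w => ?_
  simp only [twist_apply, tensorForm_apply, leviForm_apply, smul_apply,
    ContinuousLinearMap.smulRight_apply, rePart_apply, imPart_apply, map_smul, smul_eq_mul,
    Complex.mul_re, Complex.mul_im, Complex.neg_re, Complex.neg_im, Complex.I_re, Complex.I_im]
  module

lemma I_smul_I_smul (v : Cn n) : Complex.I • Complex.I • v = -v := by
  rw [smul_smul, Complex.I_mul_I, neg_one_smul]

/-- The real part of (four times) the Levi form of a function with Hessian `H`. -/
def leviPart (H : Cn n →L[ℝ] Cn n →L[ℝ] ℝ) : Cn n →L[ℝ] Cn n →L[ℝ] ℝ :=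
  H + H.bilinearComp (scalarMap n Complex.I) (scalarMap n Complex.I)

lemma leviPart_apply (H : Cn n →L[ℝ] Cn n →L[ℝ] ℝ) (v w : Cn n) :
    leviPart H v w = H v w + H (Complex.I • v) (Complex.I • w) := rfl

lemma leviPart_symm {H : Cn n →L[ℝ] Cn n →L[ℝ] ℝ} (hH : ∀ v w, H v w = H w v) (v w : Cn n) :
    leviPart H v w = leviPart H w v := by
  rw [leviPart_apply, leviPart_apply, hH v, hH (Complex.I • v)]

lemma leviPart_I_smul (H : Cn n →L[ℝ] Cn n →L[ℝ] ℝ) (v w : Cn n) :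
    leviPart H (Complex.I • v) w = -leviPart H v (Complex.I • w) := by
  simp only [leviPart_apply, I_smul_I_smul, map_neg, neg_apply]
  ring

/-- The Levi form of a function with Hessian `H` is nonnegative. -/
def LeviNonneg (H : Cn n →L[ℝ] Cn n →L[ℝ] ℝ) : Prop :=
  ∀ v, 0 ≤ H v v + H (Complex.I • v) (Complex.I • v)

lemma hessWedge_eq_zero_of_levi {D : Cn n →L[ℝ] Cn n →L[ℝ] ℝ} (hD : ∀ v w, D v w = D w v)
    (h : ∀ v, D v v + D (Complex.I • v) (Complex.I • v) = 0) (β : Form n m) :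
    hessWedge D β = 0 := by
  have polarized (v w : Cn n) : leviPart D v w = 0 := by
    have expand : leviPart D (v + w) (v + w) =
        leviPart D v v + leviPart D w w + 2 * leviPart D v w := by
      simp only [map_add, add_apply, leviPart_symm hD w v]
      ring
    have hv : leviPart D v v = 0 := h v
    have hw : leviPart D w w = 0 := h w
    have hvw : leviPart D (v + w) (v + w) = 0 := h (v + w)
    linarith
  rw [hessWedge_apply]
  refine altTwo_eq_zero_of_symmetric fun v w => ?_
  simp only [twist_apply, tensorForm_apply, neg_smul, map_neg]
  have hvIw := polarized v (Complex.I • w)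
  rw [leviPart_apply, I_smul_I_smul, map_neg, hD _ w] at hvIw
  congr 2
  linarith

/-- The Hermitian form whose real part is `leviPart H`, complex linear in its second argument. -/
def leviHermitian (H : Cn n →L[ℝ] Cn n →L[ℝ] ℝ) (v : Cn n) : Cn n →L[ℂ] ℂ :=
  StrongDual.extendRCLike ((leviPart H).flip v)

lemma leviHermitian_apply (H : Cn n →L[ℝ] Cn n →L[ℝ] ℝ) (v w : Cn n) :
    leviHermitian H v w = leviPart H w v - Complex.I * leviPart H (Complex.I • w) v :=
  StrongDual.extendRCLike_apply _ _

lemma star_leviHermitian {H : Cn n →L[ℝ] Cn n →L[ℝ] ℝ} (hH : ∀ v w, H v w = H w v)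
    (v w : Cn n) : star (leviHermitian H v w) = leviHermitian H w v := by
  rw [leviHermitian_apply, leviHermitian_apply, leviPart_I_smul, leviPart_symm hH w,
    leviPart_symm hH w]
  simp [sub_eq_add_neg]

lemma leviHermitian_self {H : Cn n →L[ℝ] Cn n →L[ℝ] ℝ} (hH : ∀ v w, H v w = H w v) (v : Cn n) :
    leviHermitian H v v = leviPart H v v := by
  have vanish : leviPart H (Complex.I • v) v = 0 := by
    have := leviPart_I_smul H v v
    rw [leviPart_symm hH v] at this
    linarith
  simp [leviHermitian_apply, vanish]

/-- The matrix of `leviHermitian H` in the standard basis. -/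
def leviMatrix (H : Cn n →L[ℝ] Cn n →L[ℝ] ℝ) : Matrix (Fin n) (Fin n) ℂ :=
  Matrix.of fun k l => leviHermitian H (Pi.single k 1) (Pi.single l 1)

lemma star_dotProduct_leviMatrix_mulVec {H : Cn n →L[ℝ] Cn n →L[ℝ] ℝ}
    (hH : ∀ v w, H v w = H w v) (v : Cn n) :
    star v ⬝ᵥ (leviMatrix H).mulVec v = leviHermitian H v v := by
  have expand (f : Cn n →L[ℂ] ℂ) (v : Cn n) : f v = ∑ l, f (Pi.single l 1) * v l := by
    conv_lhs => rw [← Finset.univ_sum_single v, map_sum]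
    refine Finset.sum_congr rfl fun l _ => ?_
    rw [mul_comm, ← smul_eq_mul, ← map_smul, ← Pi.single_smul, smul_eq_mul, mul_one]
  have row (k : Fin n) : (leviMatrix H).mulVec v k = leviHermitian H (Pi.single k 1) v := by
    rw [expand]
    rfl
  rw [← star_leviHermitian hH, expand (leviHermitian H v), star_sum]
  refine Finset.sum_congr rfl fun k _ => ?_
  rw [star_mul', star_leviHermitian hH, row, Pi.star_apply, mul_comm]

lemma posSemidef_leviMatrix {H : Cn n →L[ℝ] Cn n →L[ℝ] ℝ} (hH : ∀ v w, H v w = H w v)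
    (hL : LeviNonneg H) : (leviMatrix H).PosSemidef := by
  refine Matrix.PosSemidef.of_dotProduct_mulVec_nonneg ?_ fun v => ?_
  · ext k l
    exact star_leviHermitian hH _ _
  · rw [star_dotProduct_leviMatrix_mulVec hH, leviHermitian_self hH]
    exact_mod_cast hL v

open scoped MatrixOrder Matrix.Norms.L2Operator in
lemma exists_levi_eq_sum_sq {H : Cn n →L[ℝ] Cn n →L[ℝ] ℝ} (hH : ∀ v w, H v w = H w v)
    (hL : LeviNonneg H) : ∃ α : Fin n → (Cn n →L[ℂ] ℂ),
      ∀ v, H v v + H (Complex.I • v) (Complex.I • v) = ∑ j, Complex.normSq (α j v) := by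
  obtain ⟨B, hB⟩ := CStarAlgebra.nonneg_iff_eq_star_mul_self.mp (posSemidef_leviMatrix hH hL).nonneg
  refine ⟨fun j => (ContinuousLinearMap.proj j).comp
    (LinearMap.toContinuousLinearMap B.mulVecLin), fun v => ?_⟩
  suffices (leviPart H v v : ℂ) = ∑ j, (Complex.normSq (B.mulVec v j) : ℂ) by exact_mod_cast this
  rw [← leviHermitian_self hH, ← star_dotProduct_leviMatrix_mulVec hH, hB, ← Matrix.mulVec_mulVec,
    Matrix.dotProduct_mulVec, Matrix.star_eq_conjTranspose, Matrix.vecMul_conjTranspose, star_star]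
  exact Finset.sum_congr rfl fun j _ => (Complex.normSq_eq_conj_mul_self).symm

lemma exists_hessWedge_eq_sum_wedgeReIm {H : Cn n →L[ℝ] Cn n →L[ℝ] ℝ}
    (hH : ∀ v w, H v w = H w v) (hL : LeviNonneg H) :
    ∃ α : Fin n → (Cn n →L[ℂ] ℂ), ∀ (m : ℕ) (β : Form n m),
      hessWedge H β = ∑ j, wedgeReIm (α j) β := by
  obtain ⟨α, hα⟩ := exists_levi_eq_sum_sq hH hL
  refine ⟨α, fun m β => ?_⟩
  have same_levi : hessWedge (H - (1 / 2 : ℝ) • ∑ j, leviForm (α j)) β = 0 := by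
    refine hessWedge_eq_zero_of_levi (fun v w => ?_) (fun v => ?_) β
    · simp only [sub_apply, smul_apply, sum_apply, hH v w]
      congr 2
      exact Finset.sum_congr rfl fun j _ => by rw [leviForm_apply, leviForm_apply]; ring
    · have hαv := hα v
      simp only [sub_apply, smul_apply, sum_apply, leviForm_apply, map_smul, smul_eq_mul,
        Complex.mul_re, Complex.mul_im, Complex.I_re, Complex.I_im]
      simp only [Complex.normSq_apply] at hαv
      rw [sub_add_sub_comm, hαv, ← mul_add, ← Finset.sum_add_distrib, Finset.mul_sum,
        ← Finset.sum_sub_distrib]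
      exact Finset.sum_eq_zero fun j _ => by ring
  rw [map_sub, sub_apply, map_smul, smul_apply, map_sum, sum_apply, sub_eq_zero] at same_levi
  rw [same_levi, Finset.smul_sum]
  refine Finset.sum_congr rfl fun j _ => ?_
  rw [hessWedge_leviForm, smul_smul]
  norm_num

/-- A linear functional on `2p`-forms which is nonnegative on elementary forms: the value of a
positive current of bidimension `(p, p)` at a point. -/
def IsPosFunctional (t : Form n (2 * p) →ₗ[ℝ] ℝ) : Prop :=
  ∀ α : Fin p → (Cn n →L[ℂ] ℂ), 0 ≤ t (elementaryForm α)

/-- The form lies in the closed convex cone generated by elementary forms; the cone is described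
by duality. -/
def IsPosForm (β : Form n (2 * p)) : Prop :=
  ∀ t : Form n (2 * p) →ₗ[ℝ] ℝ, IsPosFunctional t → 0 ≤ t β

lemma isPosForm_elementaryForm (α : Fin p → (Cn n →L[ℂ] ℂ)) : IsPosForm (elementaryForm α) :=
  fun _ ht => ht α

lemma IsPosForm.hessWedge {H : Cn n →L[ℝ] Cn n →L[ℝ] ℝ} (hH : ∀ v w, H v w = H w v)
    (hL : LeviNonneg H) {β : Form n (2 * p)} (hβ : IsPosForm β) :
    IsPosForm (p := p + 1) (hessWedge H β) := by
  obtain ⟨a, ha⟩ := exists_hessWedge_eq_sum_wedgeReIm hH hL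
  intro t ht
  refine hβ (t.comp (Pluri.hessWedge H).toLinearMap) fun α => ?_
  change 0 ≤ t (Pluri.hessWedge H (elementaryForm α))
  rw [ha, map_sum]
  refine Finset.sum_nonneg fun j _ => ?_
  rw [← elementaryForm_cons]
  exact ht _

lemma IsPosForm.smul {β : Form n (2 * p)} (hβ : IsPosForm β) {a : ℝ} (ha : 0 ≤ a) :
    IsPosForm (a • β) := fun t ht => by rw [map_smul]; exact mul_nonneg ha (hβ t ht)

/-- The function `|z|²`; Mathlib's norm on `Fin n → ℂ` is the maximum norm. -/
def sqNorm (z : Cn n) : ℝ := ∑ j, Complex.normSq (z j)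

lemma sqNorm_eq : (sqNorm : Cn n → ℝ) = fun z =>
    ∑ j, (rePart (ContinuousLinearMap.proj j) z ^ 2 + imPart (ContinuousLinearMap.proj j) z ^ 2) :=
  funext fun z => Finset.sum_congr rfl fun j _ => by simp [Complex.normSq_apply, sq]

lemma contDiff_sqNorm : ContDiff ℝ ∞ (sqNorm : Cn n → ℝ) := by
  rw [sqNorm_eq]
  fun_prop

lemma fderiv_fderiv_sq (l : Cn n →L[ℝ] ℝ) (x : Cn n) :
    fderiv ℝ (fderiv ℝ fun z => l z ^ 2) x = (2 : ℝ) • l.smulRight l := by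
  have fderiv_sq : (fderiv ℝ fun z => l z ^ 2) = ⇑((2 : ℝ) • l.smulRight l) := by
    funext z
    rw [((l.hasFDerivAt (x := z)).pow 2).fderiv]
    ext v
    simp [mul_assoc]
  rw [fderiv_sq]
  exact ContinuousLinearMap.fderiv _

lemma hess_sqNorm (x : Cn n) :
    hess sqNorm x = (2 : ℝ) • ∑ j, leviForm (ContinuousLinearMap.proj j : Cn n →L[ℂ] ℂ) := by
  have diff (l : Cn n →L[ℝ] ℝ) : Differentiable ℝ fun z => l z ^ 2 := by fun_prop
  have diff' (l : Cn n →L[ℝ] ℝ) : Differentiable ℝ (fderiv ℝ fun z => l z ^ 2) :=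
    (contDiff_infty_fderiv (by fun_prop)).differentiable (by simp)
  have fderiv_sqNorm : fderiv ℝ (sqNorm : Cn n → ℝ) = fun z =>
      ∑ j, (fderiv ℝ (fun z => rePart (ContinuousLinearMap.proj j) z ^ 2) z +
        fderiv ℝ (fun z => imPart (ContinuousLinearMap.proj j) z ^ 2) z) := by
    funext z
    rw [sqNorm_eq, fderiv_fun_sum fun j _ => (diff _ z).fun_add (diff _ z)]
    exact Finset.sum_congr rfl fun j _ => fderiv_fun_add (diff _ z) (diff _ z)
  rw [hess, fderiv_sqNorm, fderiv_fun_sum fun j _ => (diff' _ x).fun_add (diff' _ x),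
    Finset.smul_sum]
  refine Finset.sum_congr rfl fun j _ => ?_
  rw [fderiv_fun_add (diff' _ x) (diff' _ x), fderiv_fderiv_sq, fderiv_fderiv_sq, leviForm,
    smul_add]

lemma hessWedge_sqNorm (x : Cn n) (β : Form n m) :
    hessWedge (hess sqNorm x) β =
      ∑ j, (4 : ℝ) • wedgeReIm (ContinuousLinearMap.proj j : Cn n →L[ℂ] ℂ) β := by
  rw [hess_sqNorm, map_smul, smul_apply, map_sum, sum_apply, Finset.smul_sum]
  refine Finset.sum_congr rfl fun j _ => ?_
  rw [hessWedge_leviForm, smul_smul]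
  norm_num

lemma hessWedge_sqNorm_omegaPow (q : ℕ) (x : Cn n) :
    hessWedge (hess sqNorm x) (omegaPow n q) = omegaPow n (q + 1) := by
  rw [omegaPow, map_sum, omegaPow]
  simp only [map_smul, hessWedge_sqNorm, Finset.smul_sum, smul_smul]
  rw [← (Fin.consEquiv fun _ : Fin (q + 1) => Fin n).sum_comp, Fintype.sum_prod_type,
    Finset.sum_comm]
  refine Finset.sum_congr rfl fun j _ => Finset.sum_congr rfl fun I _ => ?_
  rw [← elementaryForm_cons, pow_succ]
  congr 2
  funext k
  refine Fin.cases ?_ (fun k => ?_) k <;> simp [Fin.consEquiv]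

lemma leviNonneg_sqNorm (x : Cn n) : LeviNonneg (hess sqNorm x) := by
  have nonneg (w : Cn n) : 0 ≤ hess sqNorm x w w := by
    simp only [hess_sqNorm, smul_apply, sum_apply, leviForm_apply, smul_eq_mul]
    exact mul_nonneg zero_le_two (Finset.sum_nonneg fun j _ =>
      add_nonneg (mul_self_nonneg _) (mul_self_nonneg _))
  exact fun v => add_nonneg (nonneg v) (nonneg (Complex.I • v))

end PositiveForms

section Spanning

variable {n m p : ℕ}

/-- Expand `β` in the basis and average over all permutations of the arguments. -/
lemma factorial_smul_eq_sum_wedgeOne {ι : Type*} [Fintype ι] (b : Module.Basis ι ℝ (Cn n))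
    (β : Form n m) :
    (m.factorial : ℝ) • β = ∑ I : Fin m → ι, β (fun j => b (I j)) •
      wedgeOne fun j => (b.coord (I j)).toContinuousLinearMap := by
  classical
  ext v
  have expand (σ : Equiv.Perm (Fin m)) : β (fun j => v (σ j)) =
      ∑ I : Fin m → ι, (∏ j, b.coord (I j) (v (σ j))) * β fun j => b (I j) := by
    conv_lhs => rw [show (fun j => v (σ j)) = fun j => ∑ k, b.coord k (v (σ j)) • b k from
      funext fun j => (b.sum_repr (v (σ j))).symm]
    rw [ContinuousAlternatingMap.map_sum]
    exact Finset.sum_congr rfl fun I _ => β.toMultilinearMap.map_smul_univ _ _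
  have perm (σ : Equiv.Perm (Fin m)) :
      (Equiv.Perm.sign σ : ℤ) • β (fun j => v (σ j)) = β v := by
    rw [show β (fun j => v (σ j)) = Equiv.Perm.sign σ • β v from β.toAlternatingMap.map_perm v σ]
    simp only [Units.smul_def, smul_smul, ← Units.val_mul, Int.units_mul_self, Units.val_one,
      one_smul]
  have average : (m.factorial : ℝ) * β v = ∑ σ : Equiv.Perm (Fin m),
      (Equiv.Perm.sign σ : ℤ) • β (fun j => v (σ j)) := by
    simp only [perm, Finset.sum_const, Finset.card_univ, Fintype.card_perm, Fintype.card_fin,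
      nsmul_eq_mul]
  rw [ContinuousAlternatingMap.smul_apply, smul_eq_mul, average,
    ContinuousAlternatingMap.sum_apply]
  simp only [expand, ContinuousAlternatingMap.smul_apply, wedgeOne_apply, Matrix.det_apply,
    Finset.smul_sum]
  rw [Finset.sum_comm]
  refine Finset.sum_congr rfl fun I _ => Finset.sum_congr rfl fun σ _ => ?_
  simp only [Units.smul_def, zsmul_eq_mul, smul_eq_mul, Matrix.of_apply,
    LinearMap.coe_toContinuousLinearMap']
  ring

lemma linearMap_eq_zero_of_wedgeOne {t : Form n m →ₗ[ℝ] ℝ}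
    (h : ∀ l : Fin m → (Cn n →L[ℝ] ℝ), t (wedgeOne l) = 0) : t = 0 := by
  ext β
  have vanish : (m.factorial : ℝ) • t β = 0 := by
    rw [← map_smul, factorial_smul_eq_sum_wedgeOne (Module.finBasis ℝ (Cn n)) β, map_sum]
    exact Finset.sum_eq_zero fun I _ => by rw [map_smul, h, smul_zero]
  exact (smul_eq_zero.1 vanish).resolve_left (by exact_mod_cast m.factorial_ne_zero)

lemma exists_rePart_eq (l : Cn n →L[ℝ] ℝ) : ∃ α : Cn n →L[ℂ] ℂ, rePart α = l :=
  ⟨StrongDual.extendRCLike l,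
    ContinuousLinearMap.ext fun x => by simp [StrongDual.extendRCLike_apply]⟩

lemma leviForm_smul {d : ℂ} (hd : ‖d‖ = 1) (a : Cn n →L[ℂ] ℂ) : leviForm (d • a) = leviForm a := by
  have normSq_d : d.re * d.re + d.im * d.im = 1 := by
    rw [← Complex.normSq_apply, Complex.normSq_eq_norm_sq, hd, one_pow]
  ext v w
  simp only [leviForm_apply, smul_apply, smul_eq_mul, Complex.mul_re, Complex.mul_im]
  linear_combination ((a v).re * (a w).re + (a v).im * (a w).im) * normSq_d

lemma wedgeReIm_smul {d : ℂ} (hd : ‖d‖ = 1) (a : Cn n →L[ℂ] ℂ) (β : Form n m) :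
    wedgeReIm (d • a) β = wedgeReIm a β := by
  have h := hessWedge_leviForm (d • a) β
  rw [leviForm_smul hd, hessWedge_leviForm] at h
  exact (smul_right_injective _ (two_ne_zero' ℝ) h).symm

lemma wedgeReIm_pull {c : ℂ} (hc : ‖c‖ = 1) (a : Cn n →L[ℂ] ℂ) (β : Form n m) :
    wedgeReIm a (pull c β) = pull c (wedgeReIm a β) := by
  have hc0 : c ≠ 0 := norm_ne_zero_iff.1 (by rw [hc]; exact one_ne_zero)
  have re_eq : rePart a = (rePart (c⁻¹ • a)).comp (scalarMap n c) := by
    ext v; simp [hc0]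
  have im_eq : imPart a = (imPart (c⁻¹ • a)).comp (scalarMap n c) := by
    ext v; simp [hc0]
  rw [← wedgeReIm_smul (by rw [norm_inv, hc, inv_one] : ‖c⁻¹‖ = 1) a β, wedgeReIm_apply,
    wedgeReIm_apply, pull_wedgeCovector, pull_wedgeCovector, ← re_eq, ← im_eq]

/-- The functional can move complex factors between the first two covectors, as a functional does
which only sees the `(1, 1)`-part in these covectors. -/
def MovesScalars (t : Form n (m + 2) →ₗ[ℝ] ℝ) : Prop :=
  ∀ (c : ℂ) (a b : Cn n →L[ℂ] ℂ) (β : Form n m),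
    t (wedgeCovector (rePart a) (wedgeCovector (rePart (c • b)) β)) =
      t (wedgeCovector (rePart (c • a)) (wedgeCovector (rePart b) β))

lemma movesScalars_of_wedgeReIm_eq_zero {t : Form n (m + 2) →ₗ[ℝ] ℝ}
    (h : ∀ (a : Cn n →L[ℂ] ℂ) (β : Form n m), t (wedgeReIm a β) = 0) : MovesScalars t := by
  have antisymm (a b : Cn n →L[ℂ] ℂ) (β : Form n m) :
      t (wedgeCovector (rePart b) (wedgeCovector (imPart a) β)) =
        -t (wedgeCovector (rePart a) (wedgeCovector (imPart b) β)) := by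
    have re_add : rePart (a + b) = rePart a + rePart b := by ext v; simp
    have im_add : imPart (a + b) = imPart a + imPart b := by ext v; simp
    have hab := h (a + b) β
    have ha := h a β
    have hb := h b β
    rw [wedgeReIm_apply] at hab ha hb
    rw [re_add, im_add] at hab
    simp only [map_add, add_apply, ha, hb] at hab
    linarith
  intro c a b β
  have re_smul (a : Cn n →L[ℂ] ℂ) : rePart (c • a) = c.re • rePart a - c.im • imPart a := by
    ext v; simp
  have im_re : t (wedgeCovector (imPart a) (wedgeCovector (rePart b) β)) =
      t (wedgeCovector (rePart a) (wedgeCovector (imPart b) β)) := by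
    rw [wedgeCovector_comm, map_neg, antisymm, neg_neg]
  rw [re_smul, re_smul]
  simp only [map_sub, map_smul, sub_apply, smul_apply, im_re]

lemma MovesScalars.comp_wedgeCovector {t : Form n (m + 1 + 2) →ₗ[ℝ] ℝ} (ht : MovesScalars t)
    (l : Cn n →L[ℝ] ℝ) :
    MovesScalars (t.comp (wedgeCovector l : Form n (m + 2) →L[ℝ] Form n (m + 3)).toLinearMap) := by
  have rotate (a b : Cn n →L[ℝ] ℝ) (β : Form n m) :
      wedgeCovector l (wedgeCovector a (wedgeCovector b β)) =
        wedgeCovector a (wedgeCovector b (wedgeCovector l β)) := by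
    rw [wedgeCovector_comm l a, wedgeCovector_comm l b, map_neg, neg_neg]
  intro c a b β
  change t (wedgeCovector _ (wedgeCovector _ (wedgeCovector _ _))) =
    t (wedgeCovector _ (wedgeCovector _ (wedgeCovector _ _)))
  rw [rotate, ht, ← rotate]

lemma MovesScalars.apply_wedgeOne_smul {c : ℂ} : ∀ {m : ℕ} {t : Form n (m + 2) →ₗ[ℝ] ℝ},
    MovesScalars t → ∀ (a : Cn n →L[ℂ] ℂ) (x : Fin (m + 1) → (Cn n →L[ℂ] ℂ)),
      t (wedgeCovector (rePart a) (wedgeOne fun i => rePart (c • x i))) =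
        t (wedgeCovector (rePart (c ^ (m + 1) • a)) (wedgeOne fun i => rePart (x i))) := by
  intro m
  induction m with
  | zero =>
    intro t ht a x
    rw [wedgeOne_succ, ht, wedgeOne_succ fun i => rePart (x i)]
    simp only [zero_add, pow_one]
    congr 4
  | succ m ih =>
    intro t ht a x
    have tail := ih (ht.comp_wedgeCovector (rePart (x 0))) (c • a) fun i => x i.succ
    rw [wedgeOne_succ, ht, wedgeCovector_comm, map_neg, wedgeOne_succ fun i => rePart (x i),
      wedgeCovector_comm (rePart (c ^ (m + 1 + 1) • a)), map_neg, pow_succ, mul_smul]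
    exact congrArg Neg.neg tail

lemma exists_norm_eq_one_pow_eq_neg_one {k : ℕ} (hk : k ≠ 0) : ∃ c : ℂ, ‖c‖ = 1 ∧ c ^ k = -1 := by
  refine ⟨Complex.exp ((Real.pi / k : ℝ) * Complex.I), Complex.norm_exp_ofReal_mul_I _, ?_⟩
  rw [← Complex.exp_nat_mul, ← Complex.exp_pi_mul_I]
  congr 1
  push_cast
  field_simp

/-- The functional is invariant under rotations `e^{iθ}` of the covectors, which is to say that it
sees only the `(p, p)`-components of forms. -/
def RotationInvariant (t : Form n m →ₗ[ℝ] ℝ) : Prop :=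
  ∀ c : ℂ, ‖c‖ = 1 → ∀ β, t (pull c β) = t β

/-- Rotate all covectors by a root `c` of `c ^ (m + 2) = -1` and collect the factors at the first
covector. -/
lemma MovesScalars.eq_zero_of_rotationInvariant {t : Form n (m + 2) →ₗ[ℝ] ℝ}
    (ht : MovesScalars t) (hrot : RotationInvariant t) : t = 0 := by
  refine linearMap_eq_zero_of_wedgeOne fun l => ?_
  choose x hx using fun i => exists_rePart_eq (l i)
  obtain rfl : (fun i => rePart (x i)) = l := funext hx
  obtain ⟨c, hc, hcm⟩ := exists_norm_eq_one_pow_eq_neg_one (Nat.succ_ne_zero (m + 1))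
  have pull_eq : pull c (wedgeOne fun i => rePart (x i)) = wedgeOne fun i => rePart (c • x i) := by
    ext v
    rw [pull_apply, wedgeOne_apply, wedgeOne_apply]
    congr 2
    funext i j
    simp
  have collect : rePart (c ^ (m + 1) • c • x 0) = -rePart (x 0) := by
    rw [smul_smul, ← pow_succ, hcm]
    ext v
    simp
  have anti : t (wedgeOne fun i => rePart (x i)) = -t (wedgeOne fun i => rePart (x i)) := by
    conv_lhs => rw [← hrot c hc, pull_eq, wedgeOne_succ, ht.apply_wedgeOne_smul, collect, map_neg,
      neg_apply, map_neg]
    rw [wedgeOne_succ fun i => rePart (x i)]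
  exact self_eq_neg.1 anti

lemma RotationInvariant.eq_zero_of_elementaryForm : ∀ {p : ℕ} {t : Form n (2 * p) →ₗ[ℝ] ℝ},
    RotationInvariant t → (∀ α, t (elementaryForm α) = 0) → t = 0 := by
  intro p
  induction p with
  | zero =>
    intro t _ h
    refine linearMap_eq_zero_of_wedgeOne fun l => ?_
    rw [← h Fin.elim0, elementaryForm]
    congr 2
  | succ p ih =>
    intro t hrot h
    refine (movesScalars_of_wedgeReIm_eq_zero fun a β => ?_).eq_zero_of_rotationInvariant hrot
    have vanish : t.comp (wedgeReIm a).toLinearMap = 0 := by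
      refine ih (fun c hc β => ?_) fun α => ?_
      · change t (wedgeReIm a (pull c β)) = t (wedgeReIm a β)
        rw [wedgeReIm_pull hc]
        exact hrot c hc _
      · change t (wedgeReIm a (elementaryForm α)) = 0
        rw [← elementaryForm_cons]
        exact h _
    exact LinearMap.congr_fun vanish β

end Spanning

section Riesz

variable {n : ℕ} {Ω : TopologicalSpace.Opens (Cn n)}

/-- Radon measures on `Ω`, encoded as measures on `ℂⁿ` which do not charge the complement of `Ω`
and are finite on compact subsets of `Ω`. -/
structure IsRadonOn (Ω : TopologicalSpace.Opens (Cn n)) (μ : Measure (Cn n)) : Prop where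
  compl_eq_zero : μ (Ω : Set (Cn n))ᶜ = 0
  lt_top_of_isCompact : ∀ K : Set (Cn n), IsCompact K → K ⊆ Ω → μ K < ⊤

lemma isSigmaCompact_opens (Ω : TopologicalSpace.Opens (Cn n)) :
    IsSigmaCompact (Ω : Set (Cn n)) :=
  isSigmaCompact_iff_sigmaCompactSpace.mpr
    (have : LocallyCompactSpace Ω := Ω.isOpen.locallyCompactSpace
     sigmaCompactSpace_of_locallyCompact_secondCountable)

lemma IsRadonOn.sigmaFinite {μ : Measure (Cn n)} (h : IsRadonOn Ω μ) : SigmaFinite μ := by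
  obtain ⟨K, hK, hKU⟩ := isSigmaCompact_opens Ω
  refine ⟨⟨⟨fun i => K i ∪ (Ω : Set (Cn n))ᶜ, fun _ => trivial, fun i => ?_, ?_⟩⟩⟩
  · refine (measure_union_le _ _).trans_lt ?_
    rw [h.compl_eq_zero, add_zero]
    exact h.lt_top_of_isCompact _ (hK i) (hKU ▸ Set.subset_iUnion K i)
  · rw [← Set.iUnion_union, hKU, Set.union_compl_self]

lemma IsRadonOn.sum {ι : Type*} [Fintype ι] {m : ι → Measure (Cn n)}
    (h : ∀ i, IsRadonOn Ω (m i)) : IsRadonOn Ω (∑ i, m i) where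
  compl_eq_zero := by simp [(h _).compl_eq_zero]
  lt_top_of_isCompact K hK hKΩ := by
    rw [Measure.coe_finsetSum, Finset.sum_apply]
    exact ENNReal.sum_lt_top.2 fun i _ => (h i).lt_top_of_isCompact K hK hKΩ

lemma IsRadonOn.locallyIntegrableOn {μ : Measure (Cn n)} (h : IsRadonOn Ω μ) {F : Type*}
    [NormedAddCommGroup F] {f : Cn n → F} (hf : AEStronglyMeasurable f μ) {C : ℝ}
    (hC : ∀ x ∈ Ω, ‖f x‖ ≤ C) : LocallyIntegrableOn f (Ω : Set (Cn n)) μ := by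
  refine (locallyIntegrableOn_iff Ω.isOpen.isLocallyClosed).2 fun K hKΩ hK => ?_
  exact Measure.integrableOn_of_bounded (h.lt_top_of_isCompact K hK hKΩ).ne hf
    ((ae_restrict_iff' hK.measurableSet).2 (ae_of_all _ fun x hx => hC x (hKΩ hx)))

lemma isCompact_preimage_val {K : Set (Cn n)} (hK : IsCompact K) (hKΩ : K ⊆ Ω) :
    IsCompact ((Subtype.val : Ω → Cn n) ⁻¹' K) :=
  (Topology.IsInducing.subtypeVal.isCompact_preimage_iff (by simpa using hKΩ)).2 hK

lemma exists_cutoff {K : Set (Cn n)} (hK : IsCompact K) (hKΩ : K ⊆ Ω) :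
    ∃ χ : 𝓓(Ω, ℝ), (∀ x, 0 ≤ χ x) ∧ (∀ x, χ x ≤ 1) ∧ ∀ᶠ x in 𝓝ˢ K, χ x = 1 := by
  obtain ⟨K', hK', hKK', hK'Ω⟩ := exists_compact_between hK Ω.isOpen hKΩ
  obtain ⟨f, hf_one, hf_zero, hf_mem⟩ := exists_contMDiffMap_one_nhds_of_subset_interior
    (modelWithCornersSelf ℝ (Cn n)) (n := (⊤ : ℕ∞)) hK.isClosed hKK'
  have support_subset : tsupport f ⊆ K' :=
    closure_minimal (fun x hx => by_contra fun h => hx (hf_zero x h)) hK'.isClosed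
  exact ⟨⟨f, f.contMDiff.contDiff,
    hK'.of_isClosed_subset (isClosed_tsupport _) support_subset, support_subset.trans hK'Ω⟩,
    fun x => (hf_mem x).1, fun x => (hf_mem x).2, hf_one⟩

lemma test_apply_eq_zero {F : Type*} [NormedAddCommGroup F] [NormedSpace ℝ F] (χ : 𝓓(Ω, F))
    {x : Cn n} (hx : x ∉ Ω) : χ x = 0 :=
  image_eq_zero_of_notMem_tsupport fun h => hx (χ.tsupport_subset h)

open scoped CompactlySupported

/-- Restriction of test functions to `Ω`, as compactly supported continuous functions. -/
def restrictTest : 𝓓(Ω, ℝ) →ₗ[ℝ] C_c(Ω, ℝ) where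
  toFun χ := ⟨⟨fun x => χ x, χ.continuous.comp continuous_subtype_val⟩, by
    refine HasCompactSupport.intro (K := Subtype.val ⁻¹' tsupport χ) ?_ fun x hx =>
      image_eq_zero_of_notMem_tsupport (f := χ) hx
    exact isCompact_preimage_val χ.hasCompactSupport χ.tsupport_subset⟩
  map_add' _ _ := rfl
  map_smul' _ _ := rfl

lemma restrictTest_injective : Function.Injective (restrictTest (Ω := Ω)) := by
  intro χ χ' h
  ext x
  by_cases hx : x ∈ Ω
  · exact congrArg (fun f : C_c(Ω, ℝ) => f ⟨x, hx⟩) h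
  · rw [test_apply_eq_zero χ hx, test_apply_eq_zero χ' hx]

lemma exists_nonneg_restrictTest_add (y : C_c(Ω, ℝ)) :
    ∃ χ : 𝓓(Ω, ℝ), 0 ≤ restrictTest χ + y := by
  have compact : IsCompact (Subtype.val '' tsupport y) :=
    y.hasCompactSupport.image continuous_subtype_val
  obtain ⟨χ, hχ_nonneg, -, hχ_one⟩ :=
    exists_cutoff (Ω := Ω) compact (by rintro _ ⟨x, _, rfl⟩; exact x.2)
  obtain ⟨C, hC⟩ := y.continuous.bounded_above_of_compact_support y.hasCompactSupport
  refine ⟨C • χ, fun x => ?_⟩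
  change 0 ≤ C * χ x + y x
  by_cases hx : x ∈ tsupport y
  · rw [hχ_one.self_of_nhdsSet x ⟨x, hx, rfl⟩]
    have hyx : |y x| ≤ C := hC x
    linarith [(abs_le.1 hyx).1]
  · rw [image_eq_zero_of_notMem_tsupport hx, add_zero]
    exact mul_nonneg ((norm_nonneg _).trans (hC x)) (hχ_nonneg x)

lemma exists_positiveLinearMap_restrictTest (L : 𝓓(Ω, ℝ) →ₗ[ℝ] ℝ)
    (hL : ∀ χ : 𝓓(Ω, ℝ), (∀ x, 0 ≤ χ x) → 0 ≤ L χ) :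
    ∃ Λ : C_c(Ω, ℝ) →ₚ[ℝ] ℝ, ∀ χ, Λ (restrictTest χ) = L χ := by
  let e := LinearEquiv.ofInjective restrictTest (restrictTest_injective (Ω := Ω))
  have symm_apply (χ : 𝓓(Ω, ℝ)) : e.symm ⟨restrictTest χ, LinearMap.mem_range_self _ χ⟩ = χ :=
    e.symm_apply_apply χ
  let nonnegCone : PointedCone ℝ C_c(Ω, ℝ) :=
    { carrier := {f | ∀ x, 0 ≤ f x}
      add_mem' := fun hf hg x => add_nonneg (hf x) (hg x)
      zero_mem' := fun _ => le_rfl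
      smul_mem' := fun c _ hf x => mul_nonneg c.2 (hf x) }
  obtain ⟨g, hgL, hg⟩ := riesz_extension nonnegCone
    ⟨LinearMap.range restrictTest, L ∘ₗ e.symm.toLinearMap⟩
    (by
      rintro ⟨_, χ, rfl⟩ hχ
      change 0 ≤ L (e.symm _)
      rw [symm_apply]
      refine hL χ fun x => ?_
      by_cases hx : x ∈ Ω
      · exact hχ ⟨x, hx⟩
      · rw [test_apply_eq_zero χ hx])
    (fun y => by
      obtain ⟨χ, hχ⟩ := exists_nonneg_restrictTest_add y
      exact ⟨⟨restrictTest χ, LinearMap.mem_range_self _ χ⟩, hχ⟩)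
  refine ⟨PositiveLinearMap.mk₀ g hg, fun χ => ?_⟩
  exact (hgL ⟨restrictTest χ, LinearMap.mem_range_self _ χ⟩).trans (congrArg L (symm_apply χ))

lemma exists_isRepresentingMeasure (L : 𝓓(Ω, ℝ) →ₗ[ℝ] ℝ)
    (hL : ∀ χ : 𝓓(Ω, ℝ), (∀ x, 0 ≤ χ x) → 0 ≤ L χ) :
    ∃ μ, IsRepresentingMeasure (fun χ => L χ) μ := by
  have : LocallyCompactSpace Ω := Ω.isOpen.locallyCompactSpace
  obtain ⟨Λ, hΛ⟩ := exists_positiveLinearMap_restrictTest L hL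
  have hval : MeasurableEmbedding (Subtype.val : Ω → Cn n) :=
    MeasurableEmbedding.subtype_coe Ω.isOpen.measurableSet
  refine ⟨(RealRMK.rieszMeasure Λ).map Subtype.val, ?_, fun K hK hKΩ => ?_, fun χ => ?_⟩
  · rw [hval.map_apply, Set.preimage_compl, Subtype.coe_preimage_self, Set.compl_univ,
      measure_empty]
  · rw [hval.map_apply]
    exact (isCompact_preimage_val hK hKΩ).measure_lt_top
  · rw [hval.integral_map]
    exact (RealRMK.integral_rieszMeasure Λ (restrictTest χ)).trans (hΛ χ)

lemma IsRepresentingMeasure.isRadonOn {L : 𝓓(Ω, ℝ) → ℝ} {μ : Measure (Cn n)}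
    (h : IsRepresentingMeasure L μ) : IsRadonOn Ω μ := ⟨h.compl_eq_zero, h.lt_top_of_isCompact⟩

lemma isRepresentingMeasure_measureOf {L : 𝓓(Ω, ℝ) → ℝ} (h : ∃ μ, IsRepresentingMeasure L μ) :
    IsRepresentingMeasure L (measureOf L) := by
  rw [measureOf, dif_pos h]
  exact h.choose_spec

end Riesz

section Representation

variable {n m p : ℕ} {Ω : TopologicalSpace.Opens (Cn n)}

instance finiteDimensional_form (n m : ℕ) : FiniteDimensional ℝ (Form n m) :=
  have : IsNoetherian ℝ (MultilinearMap ℝ (fun _ : Fin m => Cn n) ℝ) :=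
    isNoetherian_of_isNoetherianRing_of_finite _ _
  Module.Finite.of_injective
    ((AlternatingMap.toMultilinearMapLM (S := ℝ)).comp
      (ContinuousAlternatingMap.toAlternatingMapLinear (R := ℝ) (A := ℝ)))
    fun f g h => by
      ext v
      exact congrArg (fun F : MultilinearMap ℝ (fun _ : Fin m => Cn n) ℝ => F v) h

/-- The forms on which every rotation invariant functional vanishes: those without
`(p, p)`-component if `m = 2p`. -/
def rotationSpan (n m : ℕ) : Submodule ℝ (Form n m) :=
  Submodule.span ℝ {γ | ∃ c : ℂ, ‖c‖ = 1 ∧ ∃ β, γ = pull c β - β}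

lemma RotationInvariant.rotationSpan_le_ker {t : Form n m →ₗ[ℝ] ℝ} (ht : RotationInvariant t) :
    rotationSpan n m ≤ LinearMap.ker t := by
  refine Submodule.span_le.2 ?_
  rintro _ ⟨c, hc, β, rfl⟩
  simp [ht c hc]

lemma rotationInvariant_comp_mkQ (f : Form n m ⧸ rotationSpan n m →ₗ[ℝ] ℝ) :
    RotationInvariant (f ∘ₗ (rotationSpan n m).mkQ) := by
  intro c hc β
  refine congrArg f ?_
  rw [← sub_eq_zero, ← map_sub]
  exact (Submodule.Quotient.mk_eq_zero _).2 (Submodule.subset_span ⟨c, hc, β, rfl⟩)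

lemma span_range_mkQ_elementaryForm (n p : ℕ) :
    Submodule.span ℝ (Set.range fun α : Fin p → (Cn n →L[ℂ] ℂ) =>
      (rotationSpan n (2 * p)).mkQ (elementaryForm α)) = ⊤ := by
  by_contra h
  obtain ⟨f, hf_ne, hf⟩ := Submodule.exists_le_ker_of_lt_top _ (lt_top_iff_ne_top.2 h)
  have vanish : f ∘ₗ (rotationSpan n (2 * p)).mkQ = 0 :=
    (rotationInvariant_comp_mkQ f).eq_zero_of_elementaryForm
      fun α => hf (Submodule.subset_span ⟨α, rfl⟩)
  refine hf_ne (LinearMap.ext fun x => ?_)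
  obtain ⟨β, rfl⟩ := (rotationSpan n (2 * p)).mkQ_surjective x
  exact LinearMap.congr_fun vanish β

lemma exists_eq_sum_elementaryForm (n p : ℕ) :
    ∃ (ι : Type) (_ : Fintype ι) (α : ι → Fin p → (Cn n →L[ℂ] ℂ))
      (L : ι → (Form n (2 * p) →L[ℝ] ℝ)), ∀ t : Form n (2 * p) →ₗ[ℝ] ℝ, RotationInvariant t →
        ∀ β, t β = ∑ i, L i β * t (elementaryForm (α i)) := by
  have spans := (span_range_mkQ_elementaryForm n p).ge
  have := Module.Finite.finite_basis (Module.Basis.ofSpan spans)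
  let b := (Module.Basis.ofSpan spans).reindex (Finite.equivFin _)
  have elementary (i) : ∃ α, (rotationSpan n (2 * p)).mkQ (elementaryForm α) = b i := by
    rw [Module.Basis.reindex_apply]
    exact Module.Basis.ofSpan_subset spans ⟨_, rfl⟩
  choose α hα using elementary
  refine ⟨_, inferInstance, α,
    fun i => LinearMap.toContinuousLinearMap (b.coord i ∘ₗ (rotationSpan n (2 * p)).mkQ),
    fun t ht β => ?_⟩
  have factor (β) : t β = (rotationSpan n (2 * p)).liftQ t ht.rotationSpan_le_ker
      ((rotationSpan n (2 * p)).mkQ β) := rfl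
  rw [factor, ← b.sum_repr ((rotationSpan n (2 * p)).mkQ β), map_sum]
  refine Finset.sum_congr rfl fun i _ => ?_
  rw [map_smul, smul_eq_mul, ← hα, factor (elementaryForm (α i))]
  rfl

lemma continuous_rePart : Continuous (rePart (n := n)) :=
  (ContinuousLinearMap.compL ℝ (Cn n) ℂ ℝ Complex.reCLM).continuous.comp
    (ContinuousLinearMap.restrictScalarsL ℂ (Cn n) ℂ ℝ ℝ).continuous

lemma continuous_imPart : Continuous (imPart (n := n)) :=
  (ContinuousLinearMap.compL ℝ (Cn n) ℂ ℝ Complex.imCLM).continuous.comp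
    (ContinuousLinearMap.restrictScalarsL ℂ (Cn n) ℂ ℝ ℝ).continuous

lemma continuous_elementaryForm :
    ∀ {p : ℕ}, Continuous fun α : Fin p → (Cn n →L[ℂ] ℂ) => elementaryForm α := by
  intro p
  induction p with
  | zero => exact continuous_of_discreteTopology
  | succ p ih =>
    have cons : (fun α : Fin (p + 1) → (Cn n →L[ℂ] ℂ) => elementaryForm α) = fun α =>
        wedgeCovector (rePart (α 0))
          (wedgeCovector (imPart (α 0)) (elementaryForm (Fin.tail α))) := by
      funext α
      conv_lhs => rw [← Fin.cons_self_tail α, elementaryForm_cons]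
      rfl
    have tail : Continuous fun α : Fin (p + 1) → (Cn n →L[ℂ] ℂ) => Fin.tail α :=
      continuous_pi fun i => continuous_apply _
    rw [cons]
    exact (wedgeCovector.continuous.comp (continuous_rePart.comp (continuous_apply 0))).clm_apply
      ((wedgeCovector.continuous.comp (continuous_imPart.comp (continuous_apply 0))).clm_apply
        (ih.comp tail))

lemma smulForm_apply (χ : 𝓓(Ω, ℝ)) (β : Form n m) (x : Cn n) : smulForm χ β x = χ x • β := rfl

/-- The `k`-th coefficient of a test form in a basis of the space of forms. -/
def testCoord (φ : TestForm Ω m) (k : Fin (Module.finrank ℝ (Form n m))) : 𝓓(Ω, ℝ) :=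
  TestFunction.postcompCLM
    (LinearMap.toContinuousLinearMap ((Module.finBasis ℝ (Form n m)).coord k)) φ

lemma testForm_apply_eq_sum (φ : TestForm Ω m) (x : Cn n) :
    φ x = ∑ k, smulForm (testCoord φ k) (Module.finBasis ℝ (Form n m) k) x :=
  ((Module.finBasis ℝ (Form n m)).sum_repr (φ x)).symm

lemma testForm_eq_sum (φ : TestForm Ω m) :
    φ = ∑ k, smulForm (testCoord φ k) (Module.finBasis ℝ (Form n m) k) := by
  ext1 x
  have sum_apply (s : Finset (Fin (Module.finrank ℝ (Form n m)))) (f : _ → TestForm Ω m) :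
      (∑ k ∈ s, f k) x = ∑ k ∈ s, f k x := by
    induction s using Finset.cons_induction with
    | empty => simp
    | cons a s ha ih => rw [Finset.sum_cons, Finset.sum_cons, ← ih]; rfl
  rw [sum_apply, testForm_apply_eq_sum]

/-- The functional `β ↦ T (χ β)` on constant forms given by a current and a test function. -/
def currentAt (T : Current Ω m) (χ : 𝓓(Ω, ℝ)) : Form n m →ₗ[ℝ] ℝ where
  toFun β := T (smulForm χ β)
  map_add' β γ := by
    rw [← map_add]
    exact congrArg T (DFunLike.ext _ _ fun x => smul_add (χ x) β γ)
  map_smul' c β := by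
    rw [RingHom.id_apply, ← map_smul]
    exact congrArg T (DFunLike.ext _ _ fun x => smul_comm (χ x) c β)

/-- The coefficient `χ ↦ T (χ β)` of a current, a distribution. -/
def currentCoeff (T : Current Ω m) (β : Form n m) : 𝓓(Ω, ℝ) →ₗ[ℝ] ℝ :=
  (T.comp (TestFunction.postcompCLM (ContinuousLinearMap.toSpanSingleton ℝ β))).toLinearMap

lemma IsBidim.apply_eq {T : Current Ω (2 * p)} (hT : IsBidim T) {c : ℂ} (hc : ‖c‖ = 1)
    {φ ψ : TestForm Ω (2 * p)} (h : ∀ x, ψ x = pull c (φ x)) : T ψ = T φ := by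
  refine hT (Complex.arg c) φ ψ fun x => ?_
  rw [h x]
  congr 1
  conv_lhs => rw [← Complex.norm_mul_exp_arg_mul_I c, hc]
  simp

lemma IsBidim.rotationInvariant_currentAt {T : Current Ω (2 * p)} (hT : IsBidim T)
    (χ : 𝓓(Ω, ℝ)) : RotationInvariant (currentAt T χ) :=
  fun c hc β => hT.apply_eq hc fun x => (map_smul (pullCLM c) (χ x) β).symm

lemma locallyIntegrableOn_rnDeriv_smul {μ ν : Measure (Cn n)} [SigmaFinite μ] [SigmaFinite ν]
    (hμν : μ ≪ ν) {f : Cn n → ℝ} (hf : LocallyIntegrableOn f (Ω : Set (Cn n)) μ) :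
    LocallyIntegrableOn (fun x => (μ.rnDeriv ν x).toReal • f x) (Ω : Set (Cn n)) ν := by
  rw [locallyIntegrableOn_iff Ω.isOpen.isLocallyClosed] at hf ⊢
  intro K hK hKc
  have integrable := hf K hK hKc
  rw [← integrable_indicator_iff hKc.measurableSet] at integrable ⊢
  rw [← integrable_rnDeriv_smul_iff hμν] at integrable
  refine integrable.congr (ae_of_all _ fun x => ?_)
  by_cases hx : x ∈ K <;> simp [hx]

lemma rnDeriv_smul_ae_eq_of_integral_eq {μ μ' ν : Measure (Cn n)} [SigmaFinite μ] [SigmaFinite μ']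
    [SigmaFinite ν] (hμ : μ ≪ ν) (hμ' : μ' ≪ ν) {f f' : Cn n → ℝ}
    (hf : LocallyIntegrableOn f (Ω : Set (Cn n)) μ)
    (hf' : LocallyIntegrableOn f' (Ω : Set (Cn n)) μ')
    (h : ∀ χ : 𝓓(Ω, ℝ), ∫ x, χ x * f x ∂μ = ∫ x, χ x * f' x ∂μ') :
    ∀ᵐ x ∂ν, x ∈ Ω → (μ.rnDeriv ν x).toReal • f x = (μ'.rnDeriv ν x).toReal • f' x := by
  have hg := locallyIntegrableOn_rnDeriv_smul hμ hf
  have hg' := locallyIntegrableOn_rnDeriv_smul hμ' hf'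
  have vanish := Ω.isOpen.ae_eq_zero_of_integral_contDiff_smul_eq_zero (hg.sub hg')
    fun g hg_smooth hg_compact hg_support => by
      let χ : 𝓓(Ω, ℝ) := ⟨g, hg_smooth, hg_compact, hg_support⟩
      have pairing := h χ
      rw [← integral_rnDeriv_smul hμ, ← integral_rnDeriv_smul hμ'] at pairing
      simp only [Pi.sub_apply, smul_sub]
      refine (integral_sub (χ.integrable_bilin (ContinuousLinearMap.mul ℝ ℝ) hg)
        (χ.integrable_bilin (ContinuousLinearMap.mul ℝ ℝ) hg')).trans (sub_eq_zero.2 ?_)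
      simpa only [ContinuousLinearMap.mul_apply', smul_eq_mul, mul_left_comm] using pairing
  filter_upwards [vanish] with x hx hxΩ using sub_eq_zero.1 (hx hxΩ)

lemma IsRadonOn.ae_mem {μ : Measure (Cn n)} (hμ : IsRadonOn Ω μ) : ∀ᵐ x ∂μ, x ∈ Ω :=
  ae_iff.2 hμ.compl_eq_zero

lemma IsRadonOn.ae_nonneg_of_integral_eq {μ μ' : Measure (Cn n)} (hμ : IsRadonOn Ω μ)
    (hμ' : IsRadonOn Ω μ') {f : Cn n → ℝ} (hf : LocallyIntegrableOn f (Ω : Set (Cn n)) μ)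
    (h : ∀ χ : 𝓓(Ω, ℝ), ∫ x, χ x * f x ∂μ = ∫ x, χ x ∂μ') : ∀ᵐ x ∂μ, 0 ≤ f x := by
  have := hμ.sigmaFinite
  have := hμ'.sigmaFinite
  have hμν : μ ≪ μ + μ' := Measure.AbsolutelyContinuous.rfl.add_right μ'
  have hμ'ν : μ' ≪ μ + μ' := add_comm μ' μ ▸ Measure.AbsolutelyContinuous.rfl.add_right μ
  have densities := rnDeriv_smul_ae_eq_of_integral_eq hμν hμ'ν hf
    (hμ'.locallyIntegrableOn (f := fun _ => (1 : ℝ)) aestronglyMeasurable_const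
      fun _ _ => norm_one.le) (by simpa using h)
  filter_upwards [hμν.ae_le densities, Measure.rnDeriv_pos hμν, hμ.ae_mem,
    hμν.ae_le (Measure.rnDeriv_lt_top μ (μ + μ'))] with x hx hpos hxΩ hlt
  refine nonneg_of_mul_nonneg_right (?_ : 0 ≤ (μ.rnDeriv (μ + μ') x).toReal * f x)
    (ENNReal.toReal_pos hpos.ne' hlt.ne)
  rw [← smul_eq_mul, hx hxΩ, smul_eq_mul, mul_one]
  exact ENNReal.toReal_nonneg

lemma IsRadonOn.integrable_apply_test {μ : Measure (Cn n)} (hμ : IsRadonOn Ω μ)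
    {τ : Cn n → (Form n m →L[ℝ] ℝ)} (hτ : StronglyMeasurable τ) {C : ℝ} (hC : ∀ x, ‖τ x‖ ≤ C)
    (φ : TestForm Ω m) : Integrable (fun x => τ x (φ x)) μ :=
  φ.integrable_bilin (ContinuousLinearMap.apply ℝ ℝ)
    (hμ.locallyIntegrableOn hτ.aestronglyMeasurable fun x _ => hC x)

lemma IsRadonOn.locallyIntegrableOn_apply {μ : Measure (Cn n)} (hμ : IsRadonOn Ω μ)
    {τ : Cn n → (Form n m →L[ℝ] ℝ)} (hτ : StronglyMeasurable τ) {C : ℝ} (hC : ∀ x, ‖τ x‖ ≤ C)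
    (β : Form n m) : LocallyIntegrableOn (fun x => τ x β) (Ω : Set (Cn n)) μ :=
  hμ.locallyIntegrableOn (C := C * ‖β‖)
    ((ContinuousLinearMap.apply ℝ ℝ β).continuous.comp_stronglyMeasurable hτ).aestronglyMeasurable
    fun x _ => (τ x).le_of_opNorm_le (hC x) β

lemma exists_density_le_one {X : Type*} [MeasurableSpace X] {μ ν : Measure X} [SigmaFinite μ]
    [SigmaFinite ν] (h : μ ≤ ν) : ∃ d : X → ℝ, Measurable d ∧ (∀ x, ‖d x‖ ≤ 1) ∧
      ∀ f : X → ℝ, ∫ x, d x * f x ∂ν = ∫ x, f x ∂μ := by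
  refine ⟨fun x => min 1 (μ.rnDeriv ν x).toReal,
    measurable_const.min (Measure.measurable_rnDeriv _ _).ennreal_toReal, fun x => ?_, fun f => ?_⟩
  · rw [Real.norm_of_nonneg (le_min zero_le_one ENNReal.toReal_nonneg)]
    exact min_le_left _ _
  · rw [← integral_rnDeriv_smul (Measure.absolutelyContinuous_of_le h)]
    refine integral_congr_ae ?_
    filter_upwards [Measure.rnDeriv_le_one_of_le h] with x hx
    rw [min_eq_right (by simpa using ENNReal.toReal_mono ENNReal.one_ne_top hx), smul_eq_mul]

/-- A bounded density with respect to a Radon measure, with values in the positive functionals,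
which represents a current. -/
structure IsPosRep (T : Current Ω (2 * p)) (μ : Measure (Cn n))
    (τ : Cn n → (Form n (2 * p) →L[ℝ] ℝ)) : Prop where
  radon : IsRadonOn Ω μ
  meas : StronglyMeasurable τ
  bound : ∃ C, ∀ x, ‖τ x‖ ≤ C
  eq_integral : ∀ φ : TestForm Ω (2 * p), T φ = ∫ x, τ x (φ x) ∂μ
  pos : ∀ᵐ x ∂μ, IsPosFunctional (τ x : Form n (2 * p) →ₗ[ℝ] ℝ)

lemma IsPositive.exists_isRepresentingMeasure {T : Current Ω (2 * p)} (hT : IsPositive T)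
    (α : Fin p → (Cn n →L[ℂ] ℂ)) :
    ∃ μ, IsRepresentingMeasure (fun χ : 𝓓(Ω, ℝ) => T (smulForm χ (elementaryForm α))) μ :=
  Pluri.exists_isRepresentingMeasure (currentCoeff T (elementaryForm α)) (hT α)

/-- By `exists_eq_sum_elementaryForm`, finitely many of the measures `T ∧ elementaryForm α`
determine `T`; the sum of these measures dominates all coefficients of `T`. -/
lemma exists_bounded_density {T : Current Ω (2 * p)} (hb : IsBidim T) (hp : IsPositive T) :
    ∃ (μ : Measure (Cn n)) (τ : Cn n → (Form n (2 * p) →L[ℝ] ℝ)) (C : ℝ), IsRadonOn Ω μ ∧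
      StronglyMeasurable τ ∧ (∀ x, ‖τ x‖ ≤ C) ∧
      ∀ (χ : 𝓓(Ω, ℝ)) (β : Form n (2 * p)), T (smulForm χ β) = ∫ x, τ x (smulForm χ β x) ∂μ := by
  obtain ⟨ι, _, α, L, hL⟩ := exists_eq_sum_elementaryForm n p
  choose m hm using fun i => hp.exists_isRepresentingMeasure (α i)
  have hμ : IsRadonOn Ω (∑ i, m i) := IsRadonOn.sum fun i => (hm i).isRadonOn
  have := hμ.sigmaFinite
  have sigmaFinite (i) : SigmaFinite (m i) := (hm i).isRadonOn.sigmaFinite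
  have m_le (i) : m i ≤ ∑ i, m i :=
    Finset.single_le_sum (f := m) (fun j _ => Measure.zero_le _) (Finset.mem_univ i)
  choose d hd_meas hd_le hd using fun i => exists_density_le_one (m_le i)
  refine ⟨∑ i, m i, fun x => ∑ i, d i x • L i, ∑ i, ‖L i‖, hμ,
    Finset.stronglyMeasurable_fun_sum _ fun i _ => (hd_meas i).stronglyMeasurable.smul_const (L i),
    fun x => ?_, fun χ β => ?_⟩
  · refine norm_sum_le_of_le _ fun i _ => ?_
    rw [norm_smul]
    exact mul_le_of_le_one_left (norm_nonneg _) (hd_le i x)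
  · have integrand (x) : (∑ i, d i x • L i) (smulForm χ β x) = ∑ i, L i β * (d i x * χ x) := by
      rw [smulForm_apply, map_smul, sum_apply, smul_eq_mul, Finset.mul_sum]
      refine Finset.sum_congr rfl fun i _ => ?_
      rw [smul_apply, smul_eq_mul]
      ring
    simp_rw [integrand]
    have integrable (i) : Integrable (fun x => L i β * (d i x * χ x)) (∑ i, m i) :=
      (χ.integrable_bilin (ContinuousLinearMap.mul ℝ ℝ).flip
        (hμ.locallyIntegrableOn (hd_meas i).aestronglyMeasurable fun x _ => hd_le i x)).const_mul _
    rw [integral_finsetSum _ fun i _ => integrable i]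
    refine (hL (currentAt T χ) (hb.rotationInvariant_currentAt χ) β).trans ?_
    refine Finset.sum_congr rfl fun i _ => ?_
    rw [integral_const_mul, hd, (hm i).integral_eq]
    rfl

lemma ae_isPosFunctional {μ : Measure (Cn n)} {τ : Cn n → (Form n (2 * p) →L[ℝ] ℝ)}
    (h : ∀ α, ∀ᵐ x ∂μ, 0 ≤ τ x (elementaryForm α)) :
    ∀ᵐ x ∂μ, IsPosFunctional (τ x : Form n (2 * p) →ₗ[ℝ] ℝ) := by
  filter_upwards [ae_all_iff.2 fun k : ℕ => h (TopologicalSpace.denseSeq _ k)] with x hx α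
  have closed : IsClosed {α : Fin p → (Cn n →L[ℂ] ℂ) | 0 ≤ τ x (elementaryForm α)} :=
    isClosed_le continuous_const ((τ x).continuous.comp continuous_elementaryForm)
  refine closed.closure_subset_iff.2 ?_ (TopologicalSpace.denseRange_denseSeq _ α)
  rintro _ ⟨k, rfl⟩
  exact hx k

theorem exists_isPosRep {T : Current Ω (2 * p)} (hb : IsBidim T) (hp : IsPositive T) :
    ∃ μ τ, IsPosRep T μ τ := by
  obtain ⟨μ, τ, C, hμ, hτ, hC, hT⟩ := exists_bounded_density hb hp
  refine ⟨μ, τ, hμ, hτ, ⟨C, hC⟩, fun φ => ?_, ae_isPosFunctional fun α => ?_⟩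
  · have integrand (x) : τ x (φ x) =
        ∑ k, τ x (smulForm (testCoord φ k) (Module.finBasis ℝ (Form n (2 * p)) k) x) := by
      rw [← map_sum, ← testForm_apply_eq_sum]
    simp_rw [integrand]
    rw [integral_finsetSum _ fun k _ => hμ.integrable_apply_test hτ hC _]
    conv_lhs => rw [testForm_eq_sum φ, map_sum]
    exact Finset.sum_congr rfl fun k _ => hT _ _
  · obtain ⟨m, hm⟩ := hp.exists_isRepresentingMeasure α
    refine hμ.ae_nonneg_of_integral_eq hm.isRadonOn
      (hμ.locallyIntegrableOn_apply hτ hC (elementaryForm α)) fun χ => ?_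
    rw [hm.integral_eq, hT]
    simp only [smulForm_apply, map_smul, smul_eq_mul]

lemma IsPosRep.nonneg {T : Current Ω (2 * p)} {μ : Measure (Cn n)}
    {τ : Cn n → (Form n (2 * p) →L[ℝ] ℝ)} (h : IsPosRep T μ τ) {φ : TestForm Ω (2 * p)}
    (hφ : ∀ x, IsPosForm (φ x)) : 0 ≤ T φ := by
  rw [h.eq_integral]
  refine integral_nonneg_of_ae ?_
  filter_upwards [h.pos] with x hx
  exact hφ x _ hx

lemma IsPosRep.isRepresentedBy {T : Current Ω (2 * p)} {μ : Measure (Cn n)}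
    {τ : Cn n → (Form n (2 * p) →L[ℝ] ℝ)} (h : IsPosRep T μ τ) : IsRepresentedBy T μ τ := by
  obtain ⟨C, hC⟩ := h.bound
  exact ⟨fun β => h.radon.locallyIntegrableOn_apply h.meas hC β, h.eq_integral⟩

end Representation

section Mollification

variable {n : ℕ}

/-- A smooth bump function supported in the Euclidean ball of radius `ε`. It depends only on the
Euclidean norm, hence is invariant under multiplication by unimodular complex numbers. -/
def bump (n : ℕ) (ε : ℝ) (y : Cn n) : ℝ := Real.smoothTransition (1 - sqNorm y / ε ^ 2)

lemma bump_nonneg (ε : ℝ) (y : Cn n) : 0 ≤ bump n ε y := Real.smoothTransition.nonneg _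

lemma contDiff_bump (ε : ℝ) : ContDiff ℝ ∞ (bump n ε) :=
  Real.smoothTransition.contDiff.comp (contDiff_const.sub (contDiff_sqNorm.div_const _))

lemma norm_sq_le_sqNorm (y : Cn n) (j : Fin n) : ‖y j‖ ^ 2 ≤ sqNorm y := by
  rw [← Complex.normSq_eq_norm_sq]
  exact Finset.single_le_sum (f := fun j => Complex.normSq (y j))
    (fun i _ => Complex.normSq_nonneg _) (Finset.mem_univ j)

lemma support_bump {ε : ℝ} (hε : 0 < ε) : Function.support (bump n ε) ⊆ Metric.ball 0 ε := by
  intro y hy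
  have sqNorm_lt : sqNorm y < ε ^ 2 := by
    by_contra h
    refine hy (Real.smoothTransition.zero_of_nonpos ?_)
    rw [sub_nonpos, le_div_iff₀ (by positivity)]
    linarith
  rw [mem_ball_zero_iff, pi_norm_lt_iff hε]
  exact fun j => lt_of_pow_lt_pow_left₀ 2 hε.le ((norm_sq_le_sqNorm y j).trans_lt sqNorm_lt)

lemma hasCompactSupport_bump {ε : ℝ} (hε : 0 < ε) : HasCompactSupport (bump n ε) :=
  HasCompactSupport.intro (isCompact_closedBall 0 ε) fun _ hx => by_contra fun h =>
    hx (Metric.ball_subset_closedBall (support_bump hε h))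

lemma integral_bump_pos {ε : ℝ} (hε : 0 < ε) : 0 < ∫ y, bump n ε y := by
  refine (contDiff_bump ε).continuous.integral_pos_of_hasCompactSupport_nonneg_nonzero
    (hasCompactSupport_bump hε) (bump_nonneg ε) (x := 0) ?_
  simp [bump, sqNorm]

/-- The bump function at scale `ε`, normalized to have integral `1`. -/
def mollifier (n : ℕ) (ε : ℝ) (y : Cn n) : ℝ := (∫ y, bump n ε y)⁻¹ * bump n ε y

lemma mollifier_nonneg {ε : ℝ} (hε : 0 < ε) (y : Cn n) : 0 ≤ mollifier n ε y :=
  mul_nonneg (inv_nonneg.2 (integral_bump_pos hε).le) (bump_nonneg _ _)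

lemma contDiff_mollifier (ε : ℝ) : ContDiff ℝ ∞ (mollifier n ε) :=
  contDiff_const.mul (contDiff_bump ε)

lemma support_mollifier {ε : ℝ} (hε : 0 < ε) :
    Function.support (mollifier n ε) ⊆ Metric.ball 0 ε :=
  fun _ hy => support_bump hε (right_ne_zero_of_mul hy)

lemma mollifier_eq_zero {ε : ℝ} (hε : 0 < ε) {y : Cn n} (hy : ¬ ‖y‖ ≤ ε) :
    mollifier n ε y = 0 := by
  by_contra h
  exact hy (mem_ball_zero_iff.1 (support_mollifier hε h)).le

lemma hasCompactSupport_mollifier {ε : ℝ} (hε : 0 < ε) : HasCompactSupport (mollifier n ε) :=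
  (hasCompactSupport_bump hε).mul_left

lemma integral_mollifier {ε : ℝ} (hε : 0 < ε) : ∫ y, mollifier n ε y = 1 := by
  simp only [mollifier]
  rw [integral_const_mul]
  exact inv_mul_cancel₀ (integral_bump_pos hε).ne'

lemma integrable_mollifier {ε : ℝ} (hε : 0 < ε) : Integrable (mollifier n ε) :=
  integrable_of_integral_eq_one (integral_mollifier hε)

lemma mollifier_smul (ε : ℝ) {c : ℂ} (hc : ‖c‖ = 1) (y : Cn n) :
    mollifier n ε (c • y) = mollifier n ε y := by
  have sqNorm_smul : sqNorm (c • y) = sqNorm y := by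
    refine Finset.sum_congr rfl fun j _ => ?_
    rw [Pi.smul_apply, smul_eq_mul, map_mul, Complex.normSq_eq_norm_sq c, hc, one_pow, one_mul]
  simp only [mollifier, bump, sqNorm_smul]

lemma measurePreserving_rotation {c : ℂ} (hc : ‖c‖ = 1) :
    MeasurePreserving (fun y : Cn n => c • y) := by
  have h : MeasurePreserving (fun x : ℂ => c * x) :=
    (rotation ⟨c, mem_sphere_zero_iff_norm.2 hc⟩).measurePreserving
  exact volume_preserving_pi fun _ => h

/-- The regularization of `f` at scale `ε`: its convolution with the mollifier. -/
def mollify (ε : ℝ) (f : Cn n → ℝ) (z : Cn n) : ℝ := ∫ y, mollifier n ε y * f (z - y)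

lemma mollify_eq_convolution (ε : ℝ) (f : Cn n → ℝ) :
    mollify ε f = convolution (mollifier n ε) f (ContinuousLinearMap.lsmul ℝ ℝ) volume := rfl

/-- Bounded Borel functions, the class of functions to which mollification is applied. -/
structure IsBddMeasurable (f : Cn n → ℝ) : Prop where
  measurable : Measurable f
  bdd : ∃ M, ∀ x, |f x| ≤ M

lemma IsBddMeasurable.integrable_mul_comp {f : Cn n → ℝ} (hf : IsBddMeasurable f)
    {X : Type*} [MeasurableSpace X] {μ : Measure X} {g : X → ℝ} (hg : Integrable g μ)
    {a : X → Cn n} (ha : Measurable a) :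
    Integrable (fun x => g x * f (a x)) μ := by
  obtain ⟨M, hM⟩ := hf.bdd
  exact hg.mul_bdd (c := M) (hf.measurable.comp ha).aestronglyMeasurable (ae_of_all _ fun x => hM _)

lemma IsBddMeasurable.integrable_mollifier_mul {f : Cn n → ℝ} (hf : IsBddMeasurable f) {ε : ℝ}
    (hε : 0 < ε) (z : Cn n) : Integrable fun y => mollifier n ε y * f (z - y) :=
  hf.integrable_mul_comp (integrable_mollifier hε) (measurable_const.sub measurable_id)

lemma IsBddMeasurable.locallyIntegrable {f : Cn n → ℝ} (hf : IsBddMeasurable f) :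
    LocallyIntegrable f := by
  obtain ⟨M, hM⟩ := hf.bdd
  exact locallyIntegrable_iff.2 fun K hK => Measure.integrableOn_of_bounded
    hK.measure_lt_top.ne hf.measurable.aestronglyMeasurable (ae_of_all _ hM)

lemma contDiff_mollify {f : Cn n → ℝ} (hf : IsBddMeasurable f) {ε : ℝ} (hε : 0 < ε) :
    ContDiff ℝ ∞ (mollify ε f) := by
  rw [mollify_eq_convolution]
  exact (hasCompactSupport_mollifier hε).contDiff_convolution_left _ (contDiff_mollifier ε)
    hf.locallyIntegrable

/-- The regularization `mollify ε f` as a smooth function. -/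
def smoothMollify {f : Cn n → ℝ} (hf : IsBddMeasurable f) (ε : Set.Ioi (0 : ℝ)) : SmoothFn n :=
  ⟨mollify ε f, contDiff_mollify hf ε.2⟩

lemma hasCompactSupport_mollify {f : Cn n → ℝ} (hf : HasCompactSupport f) {ε : ℝ} (hε : 0 < ε) :
    HasCompactSupport (mollify ε f) := by
  rw [mollify_eq_convolution]
  exact (hasCompactSupport_mollifier hε).convolution _ hf

lemma sub_mem_ball_of_mollifier_ne_zero {ε : ℝ} (hε : 0 < ε) {y : Cn n} (z : Cn n)
    (hy : mollifier n ε y ≠ 0) : z - y ∈ Metric.ball z ε := by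
  rw [Metric.mem_ball, dist_self_sub_left]
  exact mem_ball_zero_iff.1 (support_mollifier hε hy)

lemma mollify_mono_of_ae {f g : Cn n → ℝ} (hf : IsBddMeasurable f) (hg : IsBddMeasurable g)
    {ε : ℝ} (hε : 0 < ε) {z : Cn n} (h : ∀ᵐ y, y ∈ Metric.ball z ε → f y ≤ g y) :
    mollify ε f z ≤ mollify ε g z := by
  refine integral_mono_ae (hf.integrable_mollifier_mul hε z) (hg.integrable_mollifier_mul hε z) ?_
  filter_upwards [(Measure.measurePreserving_sub_left volume z).quasiMeasurePreserving.ae h]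
    with y hy
  by_cases h0 : mollifier n ε y = 0
  · simp only [h0, zero_mul, le_refl]
  · exact mul_le_mul_of_nonneg_left (hy (sub_mem_ball_of_mollifier_ne_zero hε z h0))
      (mollifier_nonneg hε y)

lemma mollify_mono {f g : Cn n → ℝ} (hf : IsBddMeasurable f) (hg : IsBddMeasurable g) {ε : ℝ}
    (hε : 0 < ε) {z : Cn n} (h : ∀ y ∈ Metric.ball z ε, f y ≤ g y) :
    mollify ε f z ≤ mollify ε g z :=
  mollify_mono_of_ae hf hg hε (ae_of_all _ h)

lemma mollify_congr {f g : Cn n → ℝ} {ε : ℝ} (hε : 0 < ε) {z : Cn n}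
    (h : ∀ y ∈ Metric.ball z ε, f y = g y) : mollify ε f z = mollify ε g z := by
  refine integral_congr_ae (ae_of_all _ fun y => ?_)
  by_cases h0 : mollifier n ε y = 0
  · simp only [h0, zero_mul]
  · simp only [h _ (sub_mem_ball_of_mollifier_ne_zero hε z h0)]

lemma isBddMeasurable_const (c : ℝ) : IsBddMeasurable fun _ : Cn n => c :=
  ⟨measurable_const, |c|, fun _ => le_rfl⟩

lemma IsBddMeasurable.add {f g : Cn n → ℝ} (hf : IsBddMeasurable f) (hg : IsBddMeasurable g) :
    IsBddMeasurable fun x => f x + g x := by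
  obtain ⟨A, hA⟩ := hf.bdd
  obtain ⟨B, hB⟩ := hg.bdd
  exact ⟨hf.measurable.add hg.measurable, A + B,
    fun x => (abs_add_le _ _).trans (add_le_add (hA x) (hB x))⟩

lemma mollify_const {ε : ℝ} (hε : 0 < ε) (c : ℝ) (z : Cn n) : mollify ε (fun _ => c) z = c := by
  rw [mollify, integral_mul_const, integral_mollifier hε, one_mul]

lemma mollify_add {f g : Cn n → ℝ} (hf : IsBddMeasurable f) (hg : IsBddMeasurable g) {ε : ℝ}
    (hε : 0 < ε) (z : Cn n) :
    mollify ε (fun x => f x + g x) z = mollify ε f z + mollify ε g z := by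
  rw [mollify, mollify, mollify,
    ← integral_add (hf.integrable_mollifier_mul hε z) (hg.integrable_mollifier_mul hε z)]
  simp only [mul_add]

lemma mollify_le {f : Cn n → ℝ} (hf : IsBddMeasurable f) {ε : ℝ} (hε : 0 < ε) {z : Cn n} {c : ℝ}
    (h : ∀ y ∈ Metric.ball z ε, f y ≤ c) : mollify ε f z ≤ c :=
  (mollify_mono hf (isBddMeasurable_const c) hε h).trans_eq (mollify_const hε c z)

lemma le_mollify {f : Cn n → ℝ} (hf : IsBddMeasurable f) {ε : ℝ} (hε : 0 < ε) {z : Cn n} {c : ℝ}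
    (h : ∀ y ∈ Metric.ball z ε, c ≤ f y) : c ≤ mollify ε f z :=
  (mollify_const hε c z).symm.trans_le (mollify_mono (isBddMeasurable_const c) hf hε h)

lemma abs_mollify_le {f : Cn n → ℝ} (hf : IsBddMeasurable f) {ε : ℝ} (hε : 0 < ε) {z : Cn n}
    {M : ℝ} (h : ∀ y, |f y| ≤ M) : |mollify ε f z| ≤ M :=
  abs_le.2 ⟨le_mollify hf hε fun y _ => (abs_le.1 (h y)).1,
    mollify_le hf hε fun y _ => (abs_le.1 (h y)).2⟩

lemma IsBddMeasurable.mollify {f : Cn n → ℝ} (hf : IsBddMeasurable f) {ε : ℝ} (hε : 0 < ε) :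
    IsBddMeasurable (mollify ε f) :=
  ⟨(contDiff_mollify hf hε).continuous.measurable,
    hf.bdd.imp fun _ hB _ => abs_mollify_le hf hε hB⟩

/-- The sub-mean value inequality at `z` on all complex discs centred at `z` of radius
at most `r`. -/
def SubmeanAt (f : Cn n → ℝ) (z : Cn n) (r : ℝ) : Prop :=
  ∀ w : Cn n, ‖w‖ ≤ r → f z ≤ Real.circleAverage (fun ζ : ℂ => f (z + ζ • w)) 0 1

lemma continuous_circleMap_smul (w : Cn n) : Continuous fun θ : ℝ => circleMap 0 1 θ • w :=
  (continuous_circleMap 0 1).smul continuous_const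

lemma IsBddMeasurable.circleIntegrable {f : Cn n → ℝ} (hf : IsBddMeasurable f) (z w : Cn n) :
    CircleIntegrable (fun ζ : ℂ => f (z + ζ • w)) 0 1 := by
  have integrableOn := hf.integrable_mul_comp (intervalIntegrable_const (a := 0)
    (b := 2 * Real.pi) (c := (1 : ℝ)) (μ := volume)).1 (a := fun θ => z + circleMap 0 1 θ • w)
    (measurable_const.add (continuous_circleMap_smul w).measurable)
  simp only [one_mul] at integrableOn
  exact (intervalIntegrable_iff_integrableOn_Ioc_of_le Real.two_pi_pos.le).2 integrableOn

lemma IsBddMeasurable.integrable_prod_circle {f : Cn n → ℝ} (hf : IsBddMeasurable f) {ε : ℝ}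
    (hε : 0 < ε) {a b : Cn n → Cn n} (ha : Measurable a) (hb : Measurable b) :
    Integrable (fun q : ℝ × Cn n => mollifier n ε q.2 * f (a q.2 + circleMap 0 1 q.1 • b q.2))
      ((volume.restrict (Set.Ioc 0 (2 * Real.pi))).prod volume) :=
  hf.integrable_mul_comp ((integrable_mollifier hε).comp_snd _) <|
    (ha.comp measurable_snd).add
      (((continuous_circleMap 0 1).measurable.comp measurable_fst).smul (hb.comp measurable_snd))

lemma integrable_mollifier_circleAverage {f : Cn n → ℝ} (hf : IsBddMeasurable f) {ε : ℝ}
    (hε : 0 < ε) {a b : Cn n → Cn n} (ha : Measurable a) (hb : Measurable b) :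
    Integrable fun y => mollifier n ε y *
      Real.circleAverage (fun ζ : ℂ => f (a y + ζ • b y)) 0 1 := by
  refine ((hf.integrable_prod_circle hε ha hb).integral_prod_right.const_mul
    (2 * Real.pi)⁻¹).congr (ae_of_all _ fun y => ?_)
  simp only [Real.circleAverage_def, smul_eq_mul]
  rw [integral_const_mul, intervalIntegral.integral_of_le Real.two_pi_pos.le]
  ring

lemma integral_mollifier_circleAverage {f : Cn n → ℝ} (hf : IsBddMeasurable f) {ε : ℝ}
    (hε : 0 < ε) {a b : Cn n → Cn n} (ha : Measurable a) (hb : Measurable b) :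
    ∫ y, mollifier n ε y * Real.circleAverage (fun ζ : ℂ => f (a y + ζ • b y)) 0 1 =
      Real.circleAverage (fun ζ : ℂ => ∫ y, mollifier n ε y * f (a y + ζ • b y)) 0 1 := by
  simp only [Real.circleAverage_def, smul_eq_mul]
  rw [intervalIntegral_integral_swap, ← integral_const_mul]
  · refine integral_congr_ae (ae_of_all _ fun y => ?_)
    simp only
    rw [intervalIntegral.integral_const_mul]
    ring
  · rw [Set.uIoc_of_le Real.two_pi_pos.le]
    exact hf.integrable_prod_circle hε ha hb

lemma integral_mollifier_mul_rotation (ε : ℝ) (f : Cn n → ℝ) (z : Cn n) {ζ : ℂ} (hζ : ‖ζ‖ = 1) :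
    ∫ y, mollifier n ε y * f (z + ζ • (-y)) = mollify ε f z := by
  have hζ0 : ζ ≠ 0 := norm_ne_zero_iff.1 (hζ ▸ one_ne_zero)
  rw [mollify, ← (measurePreserving_rotation hζ).integral_comp
    (MeasurableEquiv.smul₀ ζ hζ0).measurableEmbedding fun y => mollifier n ε y * f (z - y)]
  simp only [mollifier_smul ε hζ, smul_neg, sub_eq_add_neg]

lemma SubmeanAt.le_mollify {f : Cn n → ℝ} (hf : IsBddMeasurable f) {z : Cn n} {r ε : ℝ}
    (h : SubmeanAt f z r) (hε : 0 < ε) (hr : ε ≤ r) : f z ≤ mollify ε f z := by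
  calc f z = ∫ y, mollifier n ε y * f z := by
        rw [integral_mul_const, integral_mollifier hε, one_mul]
    _ ≤ ∫ y, mollifier n ε y * Real.circleAverage (fun ζ : ℂ => f (z + ζ • (-y))) 0 1 := by
        refine integral_mono ((integrable_mollifier hε).mul_const _)
          (integrable_mollifier_circleAverage hf hε measurable_const measurable_neg) fun y => ?_
        by_cases hy : ‖y‖ ≤ ε
        · exact mul_le_mul_of_nonneg_left (h _ (by rw [norm_neg]; exact hy.trans hr))
            (mollifier_nonneg hε y)
        · simp only [mollifier_eq_zero hε hy, zero_mul, le_refl]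
    _ = Real.circleAverage (fun ζ : ℂ => ∫ y, mollifier n ε y * f (z + ζ • (-y))) 0 1 :=
        integral_mollifier_circleAverage hf hε measurable_const measurable_neg
    _ = Real.circleAverage (fun _ => mollify ε f z) 0 1 :=
        Real.circleAverage_congr_sphere fun ζ hζ =>
          integral_mollifier_mul_rotation ε f z (by simpa using hζ)
    _ = mollify ε f z := Real.circleAverage_const _ _ _

lemma SubmeanAt.mollify {f : Cn n → ℝ} (hf : IsBddMeasurable f) {z : Cn n} {r ε : ℝ}
    (hε : 0 < ε) (h : ∀ y, ‖y‖ ≤ ε → SubmeanAt f (z - y) r) : SubmeanAt (mollify ε f) z r := by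
  intro w hw
  have hsub : Measurable fun y => z - y := measurable_const.sub measurable_id
  calc Pluri.mollify ε f z
      ≤ ∫ y, mollifier n ε y * Real.circleAverage (fun ζ : ℂ => f (z - y + ζ • w)) 0 1 := by
        refine integral_mono (hf.integrable_mollifier_mul hε z)
          (integrable_mollifier_circleAverage hf hε hsub measurable_const) fun y => ?_
        by_cases hy : ‖y‖ ≤ ε
        · exact mul_le_mul_of_nonneg_left (h y hy w hw) (mollifier_nonneg hε y)
        · simp only [mollifier_eq_zero hε hy, zero_mul, le_refl]
    _ = Real.circleAverage (fun ζ : ℂ => Pluri.mollify ε f (z + ζ • w)) 0 1 := by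
        rw [integral_mollifier_circleAverage hf hε hsub measurable_const]
        simp only [Pluri.mollify, sub_add_eq_add_sub]

end Mollification

section Levi

variable {n : ℕ}

lemma hasFDerivAt_taylor_two_remainder {g : Cn n → ℝ} (hg : ContDiff ℝ 2 g) (x y : Cn n) :
    HasFDerivAt (fun v => g (x + v) - g x - fderiv ℝ g x v - 1 / 2 * hess g x v v)
      (fderiv ℝ g (x + y) - fderiv ℝ g x - hess g x y) y := by
  have translate : HasFDerivAt (fun v => g (x + v)) (fderiv ℝ g (x + y)) y :=
    (hasFDerivAt_comp_add_left x).2 (hg.differentiable (by norm_num) (x + y)).hasFDerivAt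
  have quadratic :=
    (hess g x).hasFDerivAt_of_bilinear (hasFDerivAt_id (𝕜 := ℝ) y) (hasFDerivAt_id y)
  refine (((translate.sub_const (g x)).sub (fderiv ℝ g x).hasFDerivAt).sub
    (quadratic.const_mul (1 / 2))).congr_fderiv (ContinuousLinearMap.ext fun w => ?_)
  simp only [sub_apply, add_apply, smul_apply, ContinuousLinearMap.precompR_apply,
    ContinuousLinearMap.compL_apply, ContinuousLinearMap.comp_apply,
    ContinuousLinearMap.precompL_apply, ContinuousLinearMap.id_apply, id_eq, smul_eq_mul]
  rw [fderiv_fderiv_symm hg x w y]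
  ring

lemma exists_taylor_two {g : Cn n → ℝ} (hg : ContDiff ℝ 2 g) (x : Cn n) {c : ℝ} (hc : 0 < c) :
    ∃ δ > 0, ∀ v, ‖v‖ ≤ δ →
      |g (x + v) - g x - fderiv ℝ g x v - 1 / 2 * hess g x v v| ≤ c * ‖v‖ ^ 2 := by
  have fderiv_contDiff : ContDiff ℝ 1 (fderiv ℝ g) := hg.fderiv_right (by norm_num)
  have isLittleO := hasFDerivAt_iff_isLittleO_nhds_zero.1
    (fderiv_contDiff.differentiable (by norm_num) x).hasFDerivAt
  obtain ⟨δ, hδ, hbound⟩ := Metric.eventually_nhds_iff_ball.1 (isLittleO.bound hc)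
  refine ⟨δ / 2, by positivity, fun v hv => ?_⟩
  have mean_value := (convex_closedBall (0 : Cn n) ‖v‖).norm_image_sub_le_of_norm_hasFDerivWithin_le
    (C := c * ‖v‖) (fun y _ => (hasFDerivAt_taylor_two_remainder hg x y).hasFDerivWithinAt)
    (fun y hy => by
      rw [mem_closedBall_zero_iff] at hy
      refine (hbound y ?_).trans (by gcongr)
      rw [mem_ball_zero_iff]
      linarith) (Metric.mem_closedBall_self (norm_nonneg v)) (mem_closedBall_zero_iff.2 le_rfl)
  simpa [pow_two, mul_assoc] using mean_value

lemma circleMap_smul (w : Cn n) (θ : ℝ) :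
    circleMap 0 1 θ • w = Real.cos θ • w + Real.sin θ • (Complex.I • w) := by
  have circleMap_eq : circleMap 0 1 θ = (Real.cos θ : ℂ) + (Real.sin θ : ℂ) * Complex.I := by
    rw [circleMap, Complex.exp_mul_I, ← Complex.ofReal_cos, ← Complex.ofReal_sin, zero_add,
      Complex.ofReal_one, one_mul]
  rw [circleMap_eq, add_smul, mul_smul, Complex.coe_smul, Complex.coe_smul]

lemma circleAverage_linear (l : Cn n →L[ℝ] ℝ) (w : Cn n) :
    Real.circleAverage (fun ζ : ℂ => l (ζ • w)) 0 1 = 0 := by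
  simp only [Real.circleAverage_def, circleMap_smul, map_add, map_smul, smul_eq_mul]
  rw [intervalIntegral.integral_add, intervalIntegral.integral_mul_const,
    intervalIntegral.integral_mul_const, integral_cos, integral_sin]
  · simp
  · exact (Real.continuous_cos.mul continuous_const).intervalIntegrable _ _
  · exact (Real.continuous_sin.mul continuous_const).intervalIntegrable _ _

lemma circleAverage_bilinear (H : Cn n →L[ℝ] Cn n →L[ℝ] ℝ) (w : Cn n) :
    Real.circleAverage (fun ζ : ℂ => H (ζ • w) (ζ • w)) 0 1 =
      1 / 2 * (H w w + H (Complex.I • w) (Complex.I • w)) := by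
  have expand (θ : ℝ) : H (circleMap 0 1 θ • w) (circleMap 0 1 θ • w) =
      Real.cos θ ^ 2 * H w w + Real.sin θ ^ 2 * H (Complex.I • w) (Complex.I • w) +
        Real.sin θ * Real.cos θ * (H w (Complex.I • w) + H (Complex.I • w) w) := by
    simp only [circleMap_smul, map_add, map_smul, add_apply, smul_apply, smul_eq_mul]
    ring
  simp only [Real.circleAverage_def, expand]
  rw [intervalIntegral.integral_add, intervalIntegral.integral_add,
    intervalIntegral.integral_mul_const, intervalIntegral.integral_mul_const,
    intervalIntegral.integral_mul_const, integral_cos_sq, integral_sin_sq, integral_sin_mul_cos₁]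
  · norm_num
    field_simp
  all_goals exact Continuous.intervalIntegrable (by fun_prop) _ _

lemma circleAverage_taylor_two (a : ℝ) (l : Cn n →L[ℝ] ℝ) (H : Cn n →L[ℝ] Cn n →L[ℝ] ℝ)
    (w : Cn n) :
    Real.circleAverage (fun ζ : ℂ => a + (l (ζ • w) + (1 / 2 : ℝ) • H (ζ • w) (ζ • w))) 0 1 =
      a + 1 / 4 * (H w w + H (Complex.I • w) (Complex.I • w)) := by
  have circleIntegrable {F : ℂ → ℝ} (hF : Continuous F) : CircleIntegrable F 0 1 :=
    hF.continuousOn.circleIntegrable zero_le_one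
  rw [Real.circleAverage_fun_add (circleIntegrable (by fun_prop)) (circleIntegrable (by fun_prop)),
    Real.circleAverage_fun_add (circleIntegrable (by fun_prop)) (circleIntegrable (by fun_prop)),
    Real.circleAverage_fun_smul, Real.circleAverage_const, circleAverage_linear,
    circleAverage_bilinear, smul_eq_mul]
  ring

lemma SubmeanAt.neg_le_leviForm {g : Cn n → ℝ} (hg : ContDiff ℝ 2 g) {x : Cn n} {r : ℝ}
    (hr : 0 < r) (h : SubmeanAt g x r) (w : Cn n) {c : ℝ} (hc : 0 < c) :
    -(4 * c * ‖w‖ ^ 2) ≤ hess g x w w + hess g x (Complex.I • w) (Complex.I • w) := by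
  obtain ⟨δ, hδ, taylor⟩ := exists_taylor_two hg x hc
  obtain ⟨t, ht, htw⟩ : ∃ t : ℝ, 0 < t ∧ t * ‖w‖ ≤ min δ r := by
    refine ⟨min δ r / (‖w‖ + 1), by positivity, ?_⟩
    rw [div_mul_eq_mul_div, div_le_iff₀ (by positivity)]
    exact mul_le_mul_of_nonneg_left (by linarith) (by positivity)
  have norm_tw : ‖t • w‖ = t * ‖w‖ := by rw [norm_smul, Real.norm_of_nonneg ht.le]
  have hg_cont := hg.continuous
  have submean : g x ≤ g x + c * (t * ‖w‖) ^ 2 + 1 / 4 *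
      (hess g x (t • w) (t • w) + hess g x (Complex.I • t • w) (Complex.I • t • w)) := by
    refine (h (t • w) (norm_tw.trans_le (htw.trans (min_le_right _ _)))).trans ?_
    rw [← circleAverage_taylor_two _ (fderiv ℝ g x)]
    refine Real.circleAverage_mono
      (Continuous.continuousOn (by fun_prop) |>.circleIntegrable zero_le_one)
      (Continuous.continuousOn (by fun_prop) |>.circleIntegrable zero_le_one) fun ζ hζ => ?_
    have norm_ζ : ‖ζ‖ = 1 := by simpa using hζ
    have norm_ζtw : ‖ζ • t • w‖ = t * ‖w‖ := by rw [norm_smul, norm_ζ, one_mul, norm_tw]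
    have remainder := taylor (ζ • t • w) (norm_ζtw.trans_le (htw.trans (min_le_left _ _)))
    rw [norm_ζtw] at remainder
    rw [smul_eq_mul]
    linarith [(abs_le.1 remainder).2]
  rw [smul_comm Complex.I t w] at submean
  simp only [map_smul, smul_apply, smul_eq_mul] at submean
  have scaled : 0 ≤ t ^ 2 * ((hess g x w w + hess g x (Complex.I • w) (Complex.I • w)) +
    4 * c * ‖w‖ ^ 2) := by nlinarith
  linarith [nonneg_of_mul_nonneg_right scaled (by positivity)]

lemma SubmeanAt.leviNonneg {g : Cn n → ℝ} (hg : ContDiff ℝ 2 g) {x : Cn n} {r : ℝ} (hr : 0 < r)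
    (h : SubmeanAt g x r) : LeviNonneg (hess g x) := by
  intro w
  have tendsto_zero : Tendsto (fun c : ℝ => -(4 * c * ‖w‖ ^ 2)) (𝓝[>] 0) (𝓝 0) :=
    (Continuous.tendsto' (by fun_prop) _ _ (by ring)).mono_left nhdsWithin_le_nhds
  refine le_of_tendsto tendsto_zero ?_
  filter_upwards [self_mem_nhdsWithin] with c hc using h.neg_le_leviForm hg hr w hc

lemma eventually_mollify_lt {f : Cn n → ℝ} (hf : IsBddMeasurable f) {K : Set (Cn n)}
    (hK : IsCompact K) (hus : ∀ x ∈ K, UpperSemicontinuousAt f x) {w : Cn n → ℝ}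
    (hw : ∀ x ∈ K, ContinuousAt w x) (h : ∀ x ∈ K, f x < w x) :
    ∀ᶠ ε in 𝓝[>] (0 : ℝ), ∀ x ∈ K, mollify ε f x < w x := by
  have locally_lt (x) (hx : x ∈ K) :
      ∀ᶠ z : ℝ × Cn n in 𝓝 (0, x), 0 < z.1 → mollify z.1 f z.2 < w z.2 := by
    obtain ⟨c, hfc, hcw⟩ := exists_between (h x hx)
    obtain ⟨r, hr, f_lt⟩ := Metric.eventually_nhds_iff_ball.1 (hus x hx c hfc)
    have scale_lt : ∀ᶠ z : ℝ × Cn n in 𝓝 (0, x), z.1 < r / 2 :=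
      (continuous_fst.tendsto _).eventually (gt_mem_nhds (half_pos hr))
    have mem_ball : ∀ᶠ z : ℝ × Cn n in 𝓝 (0, x), z.2 ∈ Metric.ball x (r / 2) :=
      (continuous_snd.tendsto _).eventually (Metric.ball_mem_nhds _ (half_pos hr))
    have lt_w : ∀ᶠ z : ℝ × Cn n in 𝓝 (0, x), c < w z.2 :=
      (continuous_snd.tendsto (0, x)).eventually ((hw x hx).eventually (lt_mem_nhds hcw))
    filter_upwards [scale_lt, mem_ball, lt_w] with z hzr hzx hcz hz
    refine (mollify_le hf hz fun y hy => (f_lt y ?_).le).trans_lt hcz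
    rw [Metric.mem_ball] at *
    linarith [dist_triangle y z.2 x]
  rw [eventually_nhdsWithin_iff]
  filter_upwards [hK.eventually_forall_of_forall_eventually
    (P := fun ε x => 0 < ε → mollify ε f x < w x) locally_lt] with ε hε h0 x hx using hε x hx h0

lemma tendsto_mollify {f : Cn n → ℝ} (hf : IsBddMeasurable f) {x : Cn n} {r : ℝ} (hr : 0 < r)
    (h : SubmeanAt f x r) (hus : UpperSemicontinuousAt f x) :
    Tendsto (fun ε => mollify ε f x) (𝓝[>] 0) (𝓝 (f x)) := by
  refine tendsto_order.2 ⟨fun a ha => ?_, fun a ha => ?_⟩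
  · filter_upwards [Ioc_mem_nhdsGT hr] with ε hε
    exact ha.trans_le (h.le_mollify hf hε.1 hε.2)
  · have eventually_lt := eventually_mollify_lt hf (isCompact_singleton (x := x)) (w := fun _ => a)
      (by simpa using hus) (fun _ _ => continuousAt_const) (by simpa using ha)
    simpa using eventually_lt

lemma fderiv_convolution_mollifier {F : Type*} [NormedAddCommGroup F] [NormedSpace ℝ F]
    [CompleteSpace F] {g : Cn n → F} (hg : ContDiff ℝ 1 g) (hc : HasCompactSupport g) {ε : ℝ}
    (hε : 0 < ε) :
    fderiv ℝ (convolution (mollifier n ε) g (ContinuousLinearMap.lsmul ℝ ℝ) volume) =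
      convolution (mollifier n ε) (fderiv ℝ g) (ContinuousLinearMap.lsmul ℝ ℝ) volume := by
  funext x
  rw [(hc.hasFDerivAt_convolution_right (ContinuousLinearMap.lsmul ℝ ℝ)
    (integrable_mollifier hε).locallyIntegrable hg x).fderiv]
  rfl

lemma eventually_hess_mollify {g : Cn n → ℝ} (hg : ContDiff ℝ 2 g) (hc : HasCompactSupport g)
    {η : ℝ} (hη : 0 < η) :
    ∀ᶠ ε in 𝓝[>] (0 : ℝ), ∀ x, ‖hess (mollify ε g) x - hess g x‖ ≤ η := by
  have hd1 : ContDiff ℝ 1 (fderiv ℝ g) := hg.fderiv_right (by norm_num)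
  have hcont : Continuous (hess g) := hd1.continuous_fderiv (by norm_num)
  have hcs : HasCompactSupport (hess g) := (hc.fderiv (𝕜 := ℝ)).fderiv (𝕜 := ℝ)
  obtain ⟨δ, hδ, hu⟩ :=
    Metric.uniformContinuous_iff.1 (hcs.uniformContinuous_of_continuous hcont) η hη
  filter_upwards [Ioc_mem_nhdsGT hδ] with ε hε x
  rw [hess, mollify_eq_convolution, fderiv_convolution_mollifier (hg.of_le (by norm_num)) hc hε.1,
    fderiv_convolution_mollifier hd1 (hc.fderiv (𝕜 := ℝ)) hε.1, ← dist_eq_norm]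
  refine dist_convolution_le hη.le (support_mollifier hε.1) (mollifier_nonneg hε.1)
    (integral_mollifier hε.1) hcont.aestronglyMeasurable fun y hy => (hu ?_).le
  exact (Metric.mem_ball.1 hy).trans_le hε.2

end Levi

section RealPSH

variable {n : ℕ} {U : Set (Cn n)}

/-- Real valued plurisubharmonic functions which are bounded below. Upper semicontinuity makes them
locally bounded, so that Bochner integrals can be used in the sub-mean value inequality. -/
structure RealPSH (U : Set (Cn n)) (f : Cn n → ℝ) : Prop where
  usc : UpperSemicontinuousOn f U
  le_average : ∀ z ∈ U, ∀ w : Cn n, (∀ ζ : ℂ, ‖ζ‖ ≤ 1 → z + ζ • w ∈ U) →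
    f z ≤ Real.circleAverage (fun ζ : ℂ => f (z + ζ • w)) 0 1
  bddBelow : ∃ c, ∀ z ∈ U, c ≤ f z

lemma isOpen_setOf_mem_and_lt {β : Type*} [Preorder β] {f : Cn n → β} (hU : IsOpen U)
    (hf : UpperSemicontinuousOn f U) (c : β) : IsOpen {x ∈ U | f x < c} := by
  obtain ⟨V, hV, hUV⟩ := upperSemicontinuousOn_iff_preimage_Iio.1 hf c
  exact (hUV ▸ hU.inter hV : IsOpen (U ∩ f ⁻¹' Set.Iio c))

lemma RealPSH.measurable_indicator {f : Cn n → ℝ} (hU : IsOpen U) (hf : RealPSH U f)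
    {K : Set (Cn n)} (hK : MeasurableSet K) (hKU : K ⊆ U) : Measurable (K.indicator f) := by
  refine measurable_of_Iio fun c => ?_
  have preimage_eq : K.indicator f ⁻¹' Set.Iio c =
      (K ∩ {x ∈ U | f x < c}) ∪ (Kᶜ ∩ {_x | 0 < c}) := by
    ext x
    by_cases hx : x ∈ K
    · simp [hx, hKU hx]
    · simp [hx]
  rw [preimage_eq]
  exact (hK.inter (isOpen_setOf_mem_and_lt hU hf.usc c).measurableSet).union
    (hK.compl.inter (MeasurableSet.const _))

lemma RealPSH.isBddMeasurable_indicator {f : Cn n → ℝ} (hU : IsOpen U) (hf : RealPSH U f)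
    {K : Set (Cn n)} (hK : IsCompact K) (hKU : K ⊆ U) : IsBddMeasurable (K.indicator f) := by
  refine ⟨hf.measurable_indicator hU hK.measurableSet hKU, ?_⟩
  obtain ⟨A, hA⟩ := (hf.usc.mono hKU).bddAbove_of_isCompact hK
  obtain ⟨c, hc⟩ := hf.bddBelow
  refine ⟨max |A| |c|, fun x => ?_⟩
  by_cases hx : x ∈ K
  · rw [Set.indicator_of_mem hx, max_comm]
    exact abs_le_max_abs_abs (hc x (hKU hx)) (hA ⟨x, hx, rfl⟩)
  · rw [Set.indicator_of_notMem hx, abs_zero]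
    positivity

lemma RealPSH.submeanAt_indicator {f : Cn n → ℝ} (hf : RealPSH U f) {K : Set (Cn n)}
    (hKU : K ⊆ U) {z : Cn n} {r : ℝ} (hr : 0 ≤ r) (hz : Metric.closedBall z r ⊆ K) :
    SubmeanAt (K.indicator f) z r := by
  intro w hw
  have disc_mem (ζ : ℂ) (hζ : ‖ζ‖ ≤ 1) : z + ζ • w ∈ K := by
    refine hz ?_
    rw [mem_closedBall_iff_norm, add_sub_cancel_left, norm_smul]
    exact (mul_le_of_le_one_left (norm_nonneg _) hζ).trans hw
  have hzK : z ∈ K := hz (Metric.mem_closedBall_self hr)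
  rw [Set.indicator_of_mem hzK]
  refine (hf.le_average z (hKU hzK) w fun ζ hζ => hKU (disc_mem ζ hζ)).trans_eq
    (Real.circleAverage_congr_sphere fun ζ hζ => ?_)
  have norm_ζ : ‖ζ‖ = 1 := by simpa using hζ
  exact (Set.indicator_of_mem (disc_mem ζ norm_ζ.le) f).symm

lemma RealPSH.upperSemicontinuousAt_indicator {f : Cn n → ℝ} (hf : RealPSH U f)
    {K : Set (Cn n)} (hKU : K ⊆ U) {z : Cn n} (hz : K ∈ 𝓝 z) :
    UpperSemicontinuousAt (K.indicator f) z := by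
  intro c hc
  have hzK := mem_of_mem_nhds hz
  rw [Set.indicator_of_mem hzK] at hc
  have f_lt := hf.usc z (hKU hzK) c hc
  rw [nhdsWithin_eq_nhds.2 (mem_of_superset hz hKU)] at f_lt
  filter_upwards [f_lt, hz] with y hyc hyK
  rwa [Set.indicator_of_mem hyK]

lemma RealPSH.tendsto_mollify_indicator {f : Cn n → ℝ} (hU : IsOpen U) (hf : RealPSH U f)
    {K : Set (Cn n)} (hK : IsCompact K) (hKU : K ⊆ U) {z : Cn n} {r : ℝ} (hr : 0 < r)
    (hz : Metric.closedBall z r ⊆ K) :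
    Tendsto (fun ε => mollify ε (K.indicator f) z) (𝓝[>] 0) (𝓝 (f z)) := by
  have tendsto := tendsto_mollify (hf.isBddMeasurable_indicator hU hK hKU) hr
    (hf.submeanAt_indicator hKU hr.le hz) (hf.upperSemicontinuousAt_indicator hKU
      (mem_of_superset (Metric.closedBall_mem_nhds z hr) hz))
  rwa [Set.indicator_of_mem (hz (Metric.mem_closedBall_self hr.le))] at tendsto

lemma RealPSH.submeanAt_mollify_indicator {f : Cn n → ℝ} (hU : IsOpen U) (hf : RealPSH U f)
    {K : Set (Cn n)} (hK : IsCompact K) (hKU : K ⊆ U) {z : Cn n} {r ε : ℝ} (hr : 0 ≤ r)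
    (hε : 0 < ε) (hz : Metric.closedBall z (r + ε) ⊆ K) :
    SubmeanAt (mollify ε (K.indicator f)) z r := by
  refine SubmeanAt.mollify (hf.isBddMeasurable_indicator hU hK hKU) hε fun y hy =>
    hf.submeanAt_indicator hKU hr (subset_trans (Metric.closedBall_subset_closedBall' ?_) hz)
  rw [dist_eq_norm, sub_sub_cancel_left, norm_neg]
  gcongr

lemma RealPSH.leviNonneg_mollify {u : Cn n → ℝ} (hU : IsOpen U) (hu : RealPSH U u)
    {K : Set (Cn n)} (hK : IsCompact K) (hKU : K ⊆ U) {x : Cn n} {r ε : ℝ}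
    (hx : Metric.closedBall x r ⊆ K) (hε : 0 < ε) (hεr : ε < r) :
    LeviNonneg (hess (mollify ε (K.indicator u)) x) := by
  have smooth := contDiff_mollify (hu.isBddMeasurable_indicator hU hK hKU) hε
  refine (hu.submeanAt_mollify_indicator hU hK hKU (sub_pos.2 hεr).le hε ?_).leviNonneg
    (contDiff_infty.1 smooth 2) (sub_pos.2 hεr)
  rwa [sub_add_cancel]

/-- The truncation `max u (-N)` of an extended real valued function, as a real valued function;
it has the junk value `0` where `u = ⊤`. -/
def trunc (u : Cn n → EReal) (N : ℕ) (z : Cn n) : ℝ :=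
  (max (u z) (((-(N : ℝ)) : ℝ) : EReal)).toReal

lemma coe_trunc {u : Cn n → EReal} {N : ℕ} {z : Cn n} (hz : u z ≠ ⊤) :
    ((trunc u N z : ℝ) : EReal) = max (u z) (((-(N : ℝ)) : ℝ) : EReal) := by
  refine EReal.coe_toReal ?_ ?_
  · exact (max_lt (lt_top_iff_ne_top.2 hz) (EReal.coe_lt_top _)).ne
  · exact ((EReal.bot_lt_coe _).trans_le (le_max_right _ _)).ne'

lemma upperSemicontinuousOn_trunc {u : Cn n → EReal} (hu : ∀ z ∈ U, u z ≠ ⊤)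
    (h : UpperSemicontinuousOn u U) (N : ℕ) : UpperSemicontinuousOn (trunc u N) U := by
  intro z hz c hc
  change trunc u N z < c at hc
  rw [← EReal.coe_lt_coe_iff, coe_trunc (hu z hz), max_lt_iff] at hc
  filter_upwards [h z hz c hc.1, self_mem_nhdsWithin] with y hyc hyU
  change trunc u N y < c
  rw [← EReal.coe_lt_coe_iff, coe_trunc (hu y hyU), max_lt_iff]
  exact ⟨hyc, hc.2⟩

lemma PSHOn.realPSH_trunc {u : Cn n → EReal} (hu : PSHOn U u) (N : ℕ) :
    RealPSH U (trunc u N) := by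
  have neg_le_trunc (z) (hz : z ∈ U) : -(N : ℝ) ≤ trunc u N z := by
    rw [← EReal.coe_le_coe_iff, coe_trunc (hu.ne_top z hz)]
    exact le_max_right _ _
  refine ⟨upperSemicontinuousOn_trunc hu.ne_top hu.usc N, fun z hz w hw => ?_, _, neg_le_trunc⟩
  rw [← EReal.coe_le_coe_iff, coe_trunc (hu.ne_top z hz)]
  refine max_le (hu.le_average z hz w hw N) (EReal.coe_le_coe_iff.2 ?_)
  have circle_mem (ζ : ℂ) (hζ : ζ ∈ Metric.sphere (0 : ℂ) |1|) : z + ζ • w ∈ U := by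
    have norm_ζ : ‖ζ‖ = 1 := by simpa using hζ
    exact hw ζ norm_ζ.le
  by_cases hci : CircleIntegrable (fun ζ : ℂ => trunc u N (z + ζ • w)) 0 1
  · rw [← Real.circleAverage_const (-(N : ℝ)) (0 : ℂ) 1]
    exact Real.circleAverage_mono (circleIntegrable_const _ _ _) hci fun ζ hζ =>
      neg_le_trunc _ (circle_mem ζ hζ)
  · rw [Real.circleAverage.integral_undef hci]
    simp

lemma RealPSH.congr {f g : Cn n → ℝ} (hf : RealPSH U f) (h : Set.EqOn f g U) : RealPSH U g := by
  obtain ⟨c, hc⟩ := hf.bddBelow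
  refine ⟨fun z hz a ha => ?_, fun z hz w hw => ?_, c, fun z hz => h hz ▸ hc z hz⟩
  · change g z < a at ha
    rw [← h hz] at ha
    filter_upwards [hf.usc z hz a ha, self_mem_nhdsWithin] with y hya hyU
    change g y < a
    rwa [← h hyU]
  · rw [← h hz]
    refine (hf.le_average z hz w hw).trans_eq (Real.circleAverage_congr_sphere fun ζ hζ => ?_)
    have norm_ζ : ‖ζ‖ = 1 := by simpa using hζ
    exact h (hw ζ norm_ζ.le)

lemma PSHOn.realPSH_of_bounded {f : Cn n → ℝ} (hf : PSHOn U fun z => ((f z : ℝ) : EReal))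
    {M : ℝ} (hM : ∀ z ∈ U, |f z| ≤ M) : RealPSH U f := by
  obtain ⟨N, hN⟩ := exists_nat_ge M
  refine (hf.realPSH_trunc N).congr fun z hz => ?_
  rw [← EReal.coe_eq_coe_iff, coe_trunc (EReal.coe_ne_top _), max_eq_left]
  rw [EReal.coe_le_coe_iff]
  linarith [(abs_le.1 (hM z hz)).1]

lemma RealPSH.le_of_ae_le {f g : Cn n → ℝ} (hU : IsOpen U) (hf : RealPSH U f) (hg : RealPSH U g)
    (h : ∀ᵐ z, z ∈ U → f z ≤ g z) {z : Cn n} (hz : z ∈ U) : f z ≤ g z := by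
  obtain ⟨r, hr, hball⟩ := Metric.nhds_basis_closedBall.mem_iff.1 (hU.mem_nhds hz)
  have hK : IsCompact (Metric.closedBall z r) := isCompact_closedBall z r
  refine le_of_tendsto_of_tendsto (hf.tendsto_mollify_indicator hU hK hball hr subset_rfl)
    (hg.tendsto_mollify_indicator hU hK hball hr subset_rfl) ?_
  filter_upwards [self_mem_nhdsWithin] with ε hε
  refine mollify_mono_of_ae (hf.isBddMeasurable_indicator hU hK hball)
    (hg.isBddMeasurable_indicator hU hK hball) hε ?_
  filter_upwards [h] with y hy _
  exact Set.indicator_le_indicator' fun hyK => hy (hball hyK)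

lemma PSHOn.mono {u : Cn n → EReal} (hu : PSHOn U u) {V : Set (Cn n)} (hV : V ⊆ U) : PSHOn V u :=
  ⟨fun z hz => hu.ne_top z (hV hz), hu.usc.mono hV,
    fun z hz w h => hu.le_average z (hV hz) w fun ζ hζ => hV (h ζ hζ)⟩

lemma PSHOn.le_of_ae_le {u v : Cn n → EReal} (hU : IsOpen U) (hv : PSHOn U v) (hu : PSHOn U u)
    (h : ∀ᵐ z, z ∈ U → v z ≤ u z) {z : Cn n} (hz : z ∈ U) : v z ≤ u z := by
  have le_max_neg (N : ℕ) : v z ≤ max (u z) (((-(N : ℝ)) : ℝ) : EReal) := by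
    have trunc_le : trunc v N z ≤ trunc u N z := by
      refine (hv.realPSH_trunc N).le_of_ae_le hU (hu.realPSH_trunc N) ?_ hz
      filter_upwards [h] with y hy hyU
      rw [← EReal.coe_le_coe_iff, coe_trunc (hv.ne_top y hyU), coe_trunc (hu.ne_top y hyU)]
      exact max_le_max (hy hyU) le_rfl
    rw [← EReal.coe_le_coe_iff, coe_trunc (hv.ne_top z hz), coe_trunc (hu.ne_top z hz)] at trunc_le
    exact (le_max_left _ _).trans trunc_le
  by_contra! hlt
  obtain ⟨c, -, hcv⟩ := EReal.lt_iff_exists_real_btwn.1 hlt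
  obtain ⟨N, hN⟩ := exists_nat_ge (-c)
  refine absurd (le_max_neg N) (not_le.2 (max_lt hlt (lt_of_le_of_lt ?_ hcv)))
  rw [EReal.coe_le_coe_iff]
  linarith

end RealPSH

section BedfordTaylor

variable {n m p : ℕ} {Ω : TopologicalSpace.Opens (Cn n)}

lemma ddcTest_eq_zero (φ : TestForm Ω m) {x : Cn n} (hx : x ∉ tsupport φ) : ddcTest φ x = 0 := by
  have fderiv_eq_zero : fderiv ℝ (fderiv ℝ φ) x = 0 :=
    image_eq_zero_of_notMem_tsupport fun h => hx
      (tsupport_fderiv_subset ℝ (tsupport_fderiv_subset ℝ h))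
  rw [ddcTest_apply, ddc_eq (contDiff_infty.1 φ.contDiff 2), fderiv_eq_zero, map_zero, map_zero]

lemma IsRepresentedBy.integrable {T : Current Ω m} {μ : Measure (Cn n)}
    {τ : Cn n → (Form n m →L[ℝ] ℝ)} (h : IsRepresentedBy T μ τ) (φ : TestForm Ω m) :
    Integrable (fun x => τ x (φ x)) μ := by
  have integrand (x) :
      τ x (φ x) = ∑ k, testCoord φ k x * τ x (Module.finBasis ℝ (Form n m) k) := by
    rw [testForm_apply_eq_sum φ x, map_sum]
    exact Finset.sum_congr rfl fun k _ => map_smul (τ x) _ _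
  simp_rw [integrand]
  exact integrable_finsetSum _ fun k _ =>
    (testCoord φ k).integrable_bilin (ContinuousLinearMap.mul ℝ ℝ) (h.locallyIntegrable _)

lemma tendsto_integral_mollify_mul {T : Current Ω (m + 2)} {μ : Measure (Cn n)}
    {τ : Cn n → (Form n (m + 2) →L[ℝ] ℝ)} (h : IsRepresentedBy T μ τ) {u : Cn n → ℝ}
    (hu : RealPSH (Ω : Set (Cn n)) u) {K : Set (Cn n)} (hK : IsCompact K) (hKΩ : K ⊆ Ω) {r : ℝ}
    (hr : 0 < r) {φ : TestForm Ω m} (hφ : ∀ x ∈ tsupport φ, Metric.closedBall x r ⊆ K) :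
    Tendsto (fun ε => ∫ x, mollify ε (K.indicator u) x * τ x (ddcTest φ x) ∂μ) (𝓝[>] 0)
      (𝓝 (∫ x, u x * τ x (ddcTest φ x) ∂μ)) := by
  have hb := hu.isBddMeasurable_indicator Ω.isOpen hK hKΩ
  obtain ⟨M, hM⟩ := hb.bdd
  have hi := h.integrable (ddcTest φ)
  refine tendsto_integral_filter_of_dominated_convergence
    (fun x => M * ‖τ x (ddcTest φ x)‖) ?_ ?_ (hi.norm.const_mul M) (ae_of_all _ fun x => ?_)
  · filter_upwards [self_mem_nhdsWithin] with ε hε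
    exact (contDiff_mollify hb hε).continuous.aestronglyMeasurable.mul hi.aestronglyMeasurable
  · filter_upwards [self_mem_nhdsWithin] with ε hε
    refine ae_of_all _ fun x => ?_
    rw [norm_mul]
    exact mul_le_mul_of_nonneg_right (abs_mollify_le hb hε hM) (norm_nonneg _)
  · by_cases hx : x ∈ tsupport φ
    · exact (hu.tendsto_mollify_indicator Ω.isOpen hK hKΩ hr (hφ x hx)).mul_const _
    · simp only [ddcTest_eq_zero φ hx, map_zero, mul_zero, tendsto_const_nhds]

lemma IsClosedPositive.apply_dTest {T : Current Ω (2 * (p + 1))} (hT : IsClosedPositive T)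
    (ψ : TestForm Ω (2 * p + 1)) : T (dTest ψ) = 0 :=
  hT.closed ψ (dTest ψ) (dTest_apply ψ)

lemma IsClosedPositive.apply_pullTest {T : Current Ω (2 * p)} (hT : IsClosedPositive T) {c : ℂ}
    (hc : ‖c‖ = 1) (φ : TestForm Ω (2 * p)) : T (pullTest c φ) = T φ :=
  hT.bidim.apply_eq hc (pullTest_apply c φ)

lemma IsClosedPositive.apply_mulTest_ddcTest {T : Current Ω (2 * (p + 1))}
    (hT : IsClosedPositive T) (w : SmoothFn n) (φ : TestForm Ω (2 * p)) :
    T (mulTest w (ddcTest φ)) = T (hessTest w φ) :=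
  Pluri.apply_mulTest_ddcTest (m := 2 * p) (T := (T : TestForm Ω (2 * (p + 1)) →ₗ[ℝ] ℝ))
    hT.apply_dTest (hT.apply_pullTest (by simp)) w φ

lemma exists_isDDcWedge {T : Current Ω (2 * (p + 1))} (hT : IsClosedPositive T) {u : Cn n → ℝ}
    (hu : RealPSH (Ω : Set (Cn n)) u) {M : ℝ} (hM : ∀ x ∈ Ω, |u x| ≤ M) :
    ∃ S, IsDDcWedge (m := 2 * p) u T S := by
  obtain ⟨μ, τ, h⟩ := exists_isPosRep hT.bidim hT.positive
  obtain ⟨C, hC⟩ := h.bound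
  have hmeas := hu.measurable_indicator Ω.isOpen Ω.isOpen.measurableSet subset_rfl
  have hloc : LocallyIntegrableOn (fun x => (Ω : Set (Cn n)).indicator u x • τ x)
      (Ω : Set (Cn n)) μ := by
    refine h.radon.locallyIntegrableOn (C := M * C)
      (hmeas.stronglyMeasurable.smul h.meas).aestronglyMeasurable fun x hx => ?_
    rw [norm_smul, Set.indicator_of_mem (show x ∈ (Ω : Set (Cn n)) from hx)]
    exact mul_le_mul (hM x hx) (hC x) (norm_nonneg _) ((abs_nonneg _).trans (hM x hx))
  let uT : Current Ω (2 * p + 2) := TestFunction.integralAgainstBilinCLM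
    (ContinuousLinearMap.apply ℝ ℝ) μ (fun x => (Ω : Set (Cn n)).indicator u x • τ x)
  refine ⟨uT.comp ddcTest, μ, τ, h.isRepresentedBy, fun φ => ?_⟩
  change uT (ddcTest φ) = _
  rw [TestFunction.integralAgainstBilinCLM_eq_integral hloc]
  refine integral_congr_ae (ae_of_all _ fun x => ?_)
  simp only [ContinuousLinearMap.apply_apply, smul_apply, smul_eq_mul, ← ddcTest_apply]
  by_cases hx : x ∈ Ω
  · rw [Set.indicator_of_mem (show x ∈ (Ω : Set (Cn n)) from hx)]
  · rw [ddcTest_eq_zero φ fun h => hx (φ.tsupport_subset h), map_zero, mul_zero, mul_zero]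

lemma isDDcWedge_ddcWedge {u : Cn n → ℝ} {T : Current Ω (m + 2)} (h : ∃ S, IsDDcWedge u T S) :
    IsDDcWedge u T (ddcWedge u T) := by
  rw [ddcWedge, dif_pos h]
  exact h.choose_spec

lemma tendsto_apply_hessTest_smoothMollify {T : Current Ω (2 * (p + 1))}
    (hT : IsClosedPositive T) {u : Cn n → ℝ} (hu : RealPSH (Ω : Set (Cn n)) u) {M : ℝ}
    (hM : ∀ x ∈ Ω, |u x| ≤ M) {K : Set (Cn n)} (hK : IsCompact K) (hKΩ : K ⊆ Ω) {r : ℝ}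
    (hr : 0 < r) {φ : TestForm Ω (2 * p)}
    (hφ : ∀ x ∈ tsupport φ, Metric.closedBall x r ⊆ K) :
    Tendsto (fun ε => T (hessTest
        (smoothMollify (hu.isBddMeasurable_indicator Ω.isOpen hK hKΩ) ε) φ))
      atBot (𝓝 (ddcWedge (m := 2 * p) u T φ)) := by
  obtain ⟨μ, τ, h, hS⟩ := isDDcWedge_ddcWedge (exists_isDDcWedge hT hu hM)
  rw [hS]
  simp_rw [← ddcTest_apply]
  refine ((tendsto_comp_coe_Ioi_atBot (.of_dense 0)).2
    (tendsto_integral_mollify_mul h hu hK hKΩ hr hφ)).congr fun ε => ?_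
  rw [← hT.apply_mulTest_ddcTest]
  refine ((h.eq_integral _).trans (integral_congr_ae (ae_of_all _ fun x => ?_))).symm
  simp only [mulTest_apply, smoothMollify, map_smul, smul_eq_mul]

lemma exists_isCompact_closedBall_subset (φ : TestForm Ω m) :
    ∃ K : Set (Cn n), IsCompact K ∧ K ⊆ Ω ∧
      ∃ r > 0, ∀ x ∈ tsupport φ, Metric.closedBall x r ⊆ K := by
  have hc : IsCompact (tsupport φ) := φ.hasCompactSupport
  obtain ⟨r, hr, h⟩ := hc.exists_cthickening_subset_open Ω.isOpen φ.tsupport_subset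
  exact ⟨_, hc.cthickening, h, r, hr, fun x hx => Metric.closedBall_subset_cthickening hx r⟩

lemma isPosForm_zero : IsPosForm (0 : Form n (2 * p)) := fun t _ => (map_zero t).ge

lemma tsupport_pullTest_subset (c : ℂ) (φ : TestForm Ω m) :
    tsupport (pullTest c φ) ⊆ tsupport φ :=
  closure_mono (Function.support_comp_subset (map_zero (pullCLM c)) φ)

lemma isBidim_ddcWedge {T : Current Ω (2 * (p + 1))} (hT : IsClosedPositive T)
    {u : Cn n → ℝ} (hu : RealPSH (Ω : Set (Cn n)) u) {M : ℝ} (hM : ∀ x ∈ Ω, |u x| ≤ M) :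
    IsBidim (p := p) (ddcWedge (m := 2 * p) u T) := by
  intro θ φ ψ hψ
  have hc : ‖Complex.exp (θ * Complex.I)‖ = 1 := Complex.norm_exp_ofReal_mul_I θ
  obtain rfl : ψ = pullTest (Complex.exp (θ * Complex.I)) φ := by
    ext1 x
    rw [hψ, pullTest_apply]
  obtain ⟨K, hK, hKΩ, r, hr, hφ⟩ := exists_isCompact_closedBall_subset φ
  refine tendsto_nhds_unique (tendsto_apply_hessTest_smoothMollify hT hu hM hK hKΩ hr
    fun x hx => hφ x (tsupport_pullTest_subset _ φ hx)) ?_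
  simp_rw [← pullTest_hessTest hc]
  exact (tendsto_apply_hessTest_smoothMollify hT hu hM hK hKΩ hr hφ).congr fun ε =>
    (hT.apply_pullTest hc _).symm

lemma isPositive_ddcWedge {T : Current Ω (2 * (p + 1))} (hT : IsClosedPositive T)
    {u : Cn n → ℝ} (hu : RealPSH (Ω : Set (Cn n)) u) {M : ℝ} (hM : ∀ x ∈ Ω, |u x| ≤ M) :
    IsPositive (p := p) (ddcWedge (m := 2 * p) u T) := by
  intro α χ hχ
  obtain ⟨μ, τ, h⟩ := exists_isPosRep hT.bidim hT.positive
  obtain ⟨K, hK, hKΩ, r, hr, hφ⟩ :=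
    exists_isCompact_closedBall_subset (smulForm χ (elementaryForm α : Form n (2 * p)))
  refine ge_of_tendsto (tendsto_apply_hessTest_smoothMollify hT hu hM hK hKΩ hr hφ) ?_
  filter_upwards [eventually_lt_atBot (⟨r, hr⟩ : Set.Ioi (0 : ℝ))] with ε hε
  refine h.nonneg (p := p + 1) fun x => ?_
  rw [hessTest_apply]
  by_cases hx : x ∈ tsupport (smulForm χ (elementaryForm α : Form n (2 * p)))
  · exact IsPosForm.hessWedge (hess_symm _ x)
      (hu.leviNonneg_mollify Ω.isOpen hK hKΩ (hφ x hx) ε.2 hε)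
      ((isPosForm_elementaryForm α).smul (hχ x))
  · rw [image_eq_zero_of_notMem_tsupport hx, map_zero]
    exact isPosForm_zero (p := p + 1)

lemma isClosedCurrent_ddcWedge {T : Current Ω (2 * (p + 1))} (hT : IsClosedPositive T)
    {u : Cn n → ℝ} (hu : RealPSH (Ω : Set (Cn n)) u) {M : ℝ} (hM : ∀ x ∈ Ω, |u x| ≤ M) :
    IsClosedCurrent (ddcWedge (m := 2 * p) u T) := by
  obtain ⟨μ, τ, -, hS⟩ := isDDcWedge_ddcWedge (exists_isDDcWedge hT hu hM)
  cases p with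
  | zero => trivial
  | succ p =>
    intro φ ψ hψ
    obtain rfl : ψ = dTest φ := by
      ext1 x
      rw [hψ, dTest_apply]
    have ddc_eq_zero (x) : ddc (dTest φ) x = 0 := by
      rw [show ⇑(dTest φ) = extDeriv φ from funext (dTest_apply φ),
        ddc_extDeriv (contDiff_infty.1 φ.contDiff 3)]
    simp only [hS, ddc_eq_zero, map_zero, mul_zero, integral_zero]

theorem IsClosedPositive.ddcWedge {T : Current Ω (2 * (p + 1))} (hT : IsClosedPositive T)
    {u : Cn n → ℝ} (hu : RealPSH (Ω : Set (Cn n)) u) {M : ℝ} (hM : ∀ x ∈ Ω, |u x| ≤ M) :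
    IsClosedPositive (p := p) (Pluri.ddcWedge (m := 2 * p) u T) :=
  ⟨isBidim_ddcWedge hT hu hM, isPositive_ddcWedge hT hu hM, isClosedCurrent_ddcWedge hT hu hM⟩

end BedfordTaylor

section ChainEstimate

variable {n m p : ℕ} {Ω : TopologicalSpace.Opens (Cn n)}

/-- The functional `dd^c w ∧ L` for a smooth function `w`. -/
def contract (w : SmoothFn n) (L : TestForm Ω (m + 2) →ₗ[ℝ] ℝ) : TestForm Ω m →ₗ[ℝ] ℝ where
  toFun φ := L (hessTest w φ)
  map_add' φ ψ := by
    rw [← map_add]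
    congr 1
    ext1 x
    exact map_add (hessWedge (hess w.1 x)) (φ x) (ψ x)
  map_smul' c φ := by
    rw [← map_smul]
    congr 1
    ext1 x
    exact map_smul (hessWedge (hess w.1 x)) c (φ x)

lemma contract_apply (w : SmoothFn n) (L : TestForm Ω (m + 2) →ₗ[ℝ] ℝ) (φ : TestForm Ω m) :
    contract w L φ = L (hessTest w φ) := rfl

/-- Closed linear functionals on test forms of even degree. No continuity is required, so that
contractions with smooth functions stay in this class. -/
def IsClosedLin : {p : ℕ} → (TestForm Ω (2 * p) →ₗ[ℝ] ℝ) → Prop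
  | 0, _ => True
  | p + 1, L => ∀ ψ : TestForm Ω (2 * p + 1), L (dTest ψ) = 0

/-- Functionals which behave like closed positive currents, where positivity is only required on
forms vanishing off `E`. This class is stable under contraction with smooth functions that are
plurisubharmonic on `E` only. -/
structure IsClosedPosOn (E : Set (Cn n)) (L : TestForm Ω (2 * p) →ₗ[ℝ] ℝ) : Prop where
  closed : IsClosedLin L
  inv : ∀ c : ℂ, ‖c‖ = 1 → ∀ φ, L (pullTest c φ) = L φ
  pos : ∀ φ, (∀ x ∉ E, φ x = 0) → (∀ x, IsPosForm (φ x)) → 0 ≤ L φ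

lemma IsClosedPositive.isClosedPosOn {T : Current Ω (2 * p)} (hT : IsClosedPositive T)
    (E : Set (Cn n)) : IsClosedPosOn E (T : TestForm Ω (2 * p) →ₗ[ℝ] ℝ) := by
  obtain ⟨μ, τ, h⟩ := exists_isPosRep hT.bidim hT.positive
  refine ⟨?_, fun c hc φ => hT.apply_pullTest hc φ, fun φ _ hφ => h.nonneg hφ⟩
  cases p with
  | zero => trivial
  | succ p => exact hT.apply_dTest

variable {E : Set (Cn n)}

lemma IsClosedPosOn.apply_mulTest_ddcTest {L : TestForm Ω (2 * (p + 1)) →ₗ[ℝ] ℝ}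
    (hL : IsClosedPosOn E L) (w : SmoothFn n) (φ : TestForm Ω (2 * p)) :
    L (mulTest w (ddcTest φ)) = L (hessTest w φ) :=
  Pluri.apply_mulTest_ddcTest (m := 2 * p) hL.closed (hL.inv _ (by simp)) w φ

lemma IsClosedPosOn.isClosedLin_contract {L : TestForm Ω (2 * (p + 1)) →ₗ[ℝ] ℝ}
    (hL : IsClosedPosOn E L) (w : SmoothFn n) : IsClosedLin (contract (m := 2 * p) w L) := by
  cases p with
  | zero => trivial
  | succ p =>
    intro ψ
    rw [contract_apply, ← hL.apply_mulTest_ddcTest]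
    refine (congrArg L ?_).trans (map_zero L)
    ext1 x
    have coe_dTest : ⇑(dTest ψ) = extDeriv ψ := funext (dTest_apply ψ)
    rw [mulTest_apply, ddcTest_apply, coe_dTest, ddc_extDeriv (contDiff_infty.1 ψ.contDiff 3),
      smul_zero]
    rfl

lemma IsClosedPosOn.contract {L : TestForm Ω (2 * (p + 1)) →ₗ[ℝ] ℝ}
    (hL : IsClosedPosOn E L) {w : SmoothFn n} (hw : ∀ x ∈ E, LeviNonneg (hess w.1 x)) :
    IsClosedPosOn (p := p) E (contract (m := 2 * p) w L) := by
  refine ⟨hL.isClosedLin_contract w, fun c hc φ => ?_,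
    fun φ hφ hpos => hL.pos _ (fun x hx => ?_) fun x => ?_⟩
  · rw [contract_apply, contract_apply, ← pullTest_hessTest hc]
    exact hL.inv c hc _
  · rw [hessTest_apply, hφ x hx, map_zero]
  · change IsPosForm (p := p + 1) (Pluri.hessWedge _ _)
    by_cases hx : x ∈ E
    · exact (hpos x).hessWedge (hess_symm w x) (hw x hx)
    · rw [hφ x hx, map_zero]
      exact isPosForm_zero (p := p + 1)

lemma isPosForm_omegaPow (n p : ℕ) : IsPosForm (omegaPow n p) := by
  intro t ht
  rw [omegaPow, map_sum]
  refine Finset.sum_nonneg fun I _ => ?_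
  rw [map_smul, smul_eq_mul]
  exact mul_nonneg (by positivity) (ht _)

/-- The test form `χ h^k ω^p`. -/
def powForm (χ : 𝓓(Ω, ℝ)) (h : SmoothFn n) (k p : ℕ) : TestForm Ω (2 * p) :=
  mulTest ⟨fun x => h.1 x ^ k, h.2.pow k⟩ (smulForm χ (omegaPow n p))

lemma powForm_apply (χ : 𝓓(Ω, ℝ)) (h : SmoothFn n) (k p : ℕ) (x : Cn n) :
    powForm χ h k p x = (h.1 x ^ k * χ x) • omegaPow n p := by
  rw [mul_smul]
  rfl

lemma fderiv_pow_smooth (h : SmoothFn n) (k : ℕ) (x : Cn n) :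
    fderiv ℝ (fun y => h.1 y ^ (k + 1)) x = ((k + 1 : ℝ) * h.1 x ^ k) • fderiv ℝ h.1 x := by
  rw [fderiv_fun_pow (k + 1) (h.2.differentiable (by simp) x)]
  simp only [add_tsub_cancel_right, nsmul_eq_mul, Nat.cast_add, Nat.cast_one]

lemma hess_pow (h : SmoothFn n) (k : ℕ) (x v : Cn n) :
    hess (fun y => h.1 y ^ (k + 1)) x v v = (k + 1) * h.1 x ^ k * hess h.1 x v v +
      (k + 1) * k * h.1 x ^ (k - 1) * (fderiv ℝ h.1 x v) ^ 2 := by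
  have hd : DifferentiableAt ℝ h.1 x := h.2.differentiable (by simp) x
  have hd' : DifferentiableAt ℝ (fderiv ℝ h.1) x :=
    (contDiff_infty_fderiv h.2).differentiable (by simp) x
  rw [hess, funext (fderiv_pow_smooth h k), fderiv_fun_smul ((hd.fun_pow k).const_mul _) hd',
    fderiv_const_mul (hd.fun_pow k), fderiv_fun_pow k hd]
  simp only [add_apply, smul_apply, ContinuousLinearMap.smulRight_apply, smul_eq_mul, nsmul_eq_mul]
  ring

lemma hess_pow_eq_zero (h : SmoothFn n) (k : ℕ) {x : Cn n} (hx : x ∉ tsupport h.1) :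
    hess (fun y => h.1 y ^ (k + 1)) x = 0 := by
  have hsub : tsupport (fun y => h.1 y ^ (k + 1)) ⊆ tsupport h.1 :=
    closure_mono fun y hy h0 => hy (by simp [h0])
  exact image_eq_zero_of_notMem_tsupport fun hx' => hx
    (hsub (tsupport_fderiv_subset ℝ (tsupport_fderiv_subset ℝ hx')))

lemma ddc_smul_const {g : Cn n → ℝ} (hg : ContDiff ℝ ∞ g) (β : Form n m) (x : Cn n) :
    ddc (fun y => g y • β) x = hessWedge (hess g x) β := by
  have hs : ContDiff ℝ 2 fun y => g y • β := (contDiff_infty.1 hg 2).smul contDiff_const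
  rw [ddc_eq hs, hessWedge_apply]
  congr 2
  have fderiv_eq : fderiv ℝ (fun y => g y • β) = fun y => (fderiv ℝ g y).smulRight β :=
    funext fun y => ((hg.differentiable (by simp) y).hasFDerivAt.smul_const β).fderiv
  rw [fderiv_eq]
  have hess_at := ((contDiff_infty_fderiv hg).differentiable (by simp) x).hasFDerivAt
  exact (((ContinuousLinearMap.smulRightL ℝ (Cn n) (Form n m)).flip β).hasFDerivAt.comp x
    hess_at).fderiv

/-- The situation of the basic estimate on `E`, for a cutoff function `χ`: the function `w` is
plurisubharmonic on `E`, while `h ≥ 0` lives where `χ = 1` and `|z|² ≤ M`, and `h + w` is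
plurisubharmonic there. The model case is `h = (v - w)⁺`, for which `h + w = max v w`. -/
structure IsExcessPair (E : Set (Cn n)) (χ : 𝓓(Ω, ℝ)) (M : ℝ) (h w : SmoothFn n) : Prop where
  nonneg : ∀ x, 0 ≤ h.1 x
  cutoff_eq_one : ∀ x ∈ tsupport h.1, χ x = 1
  sqNorm_le : ∀ x ∈ tsupport h.1, sqNorm x ≤ M
  levi : ∀ x ∈ E, LeviNonneg (hess w.1 x)
  levi_add : ∀ x ∈ tsupport h.1, LeviNonneg (hess h.1 x + hess w.1 x)

variable {χ : 𝓓(Ω, ℝ)} {M : ℝ} {h w : SmoothFn n}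

lemma IsExcessPair.mem_of_mem_tsupport (hp : IsExcessPair E χ M h w) (hχE : ∀ x ∉ E, χ x = 0)
    {x : Cn n} (hx : x ∈ tsupport h.1) : x ∈ E :=
  by_contra fun hxE => zero_ne_one ((hχE x hxE).symm.trans (hp.cutoff_eq_one x hx))

lemma IsExcessPair.ddcTest_powForm (hp : IsExcessPair E χ M h w) (k : ℕ) (x : Cn n) :
    ddcTest (powForm χ h (k + 1) p) x =
      hessWedge (hess (fun y => h.1 y ^ (k + 1)) x) (omegaPow n p) := by
  have coe_powForm : ⇑(powForm χ h (k + 1) p) = fun y => h.1 y ^ (k + 1) • omegaPow n p := by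
    funext y
    rw [powForm_apply]
    by_cases hy : y ∈ tsupport h.1
    · rw [hp.cutoff_eq_one y hy, mul_one]
    · rw [image_eq_zero_of_notMem_tsupport hy, zero_pow k.succ_ne_zero, zero_mul]
  rw [ddcTest_apply, coe_powForm, ddc_smul_const (h.2.pow _)]

lemma sqNorm_nonneg (x : Cn n) : 0 ≤ sqNorm x :=
  Finset.sum_nonneg fun _ _ => Complex.normSq_nonneg _

-- With `ρ = |z|² - M` one has `M dd^c w - ρ dd^c h = |z|² dd^c w - ρ dd^c (h + w)`, a sum of two
-- nonnegative terms; the gradient term of `dd^c h^(k+1)` is nonnegative as well.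
lemma IsExcessPair.leviNonneg_of_mem_tsupport (hp : IsExcessPair E χ M h w)
    (hχE : ∀ x ∉ E, χ x = 0) (k : ℕ) {x : Cn n} (hx : x ∈ tsupport h.1) :
    LeviNonneg ((((k : ℝ) + 1) * M * (h.1 x ^ k * χ x)) • hess w.1 x -
      (sqNorm x - M) • hess (fun y => h.1 y ^ (k + 1)) x) := by
  intro v
  have levi_w := hp.levi x (hp.mem_of_mem_tsupport hχE hx) v
  have levi_add := hp.levi_add x hx v
  have hM : 0 ≤ M - sqNorm x := sub_nonneg.2 (hp.sqNorm_le x hx)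
  have hh := hp.nonneg x
  simp only [sub_apply, smul_apply, add_apply, smul_eq_mul, hess_pow, hp.cutoff_eq_one x hx]
    at levi_w levi_add ⊢
  set a := ((k : ℝ) + 1) * h.1 x ^ k with ha
  set b := ((k : ℝ) + 1) * k * h.1 x ^ (k - 1)
  have ha0 : 0 ≤ a := by positivity
  have hb0 : 0 ≤ b := by positivity
  have weight_term := mul_nonneg ha0 (mul_nonneg (sqNorm_nonneg x) levi_w)
  have sum_term := mul_nonneg ha0 (mul_nonneg hM levi_add)
  have gradient_term : 0 ≤ (M - sqNorm x) *
      (b * ((fderiv ℝ h.1 x v) ^ 2 + (fderiv ℝ h.1 x (Complex.I • v)) ^ 2)) :=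
    mul_nonneg hM (mul_nonneg hb0 (by positivity))
  have leading_coeff : ((k : ℝ) + 1) * M * (h.1 x ^ k * 1) = a * M := by rw [ha]; ring
  rw [leading_coeff]
  linarith

lemma IsExcessPair.leviNonneg (hp : IsExcessPair E χ M h w) (hχ0 : ∀ x, 0 ≤ χ x)
    (hχE : ∀ x ∉ E, χ x = 0) (hM0 : 0 ≤ M) (k : ℕ) (x : Cn n) :
    LeviNonneg ((((k : ℝ) + 1) * M * (h.1 x ^ k * χ x)) • hess w.1 x -
      (sqNorm x - M) • hess (fun y => h.1 y ^ (k + 1)) x) := by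
  by_cases hx : x ∈ tsupport h.1
  · exact hp.leviNonneg_of_mem_tsupport hχE k hx
  intro v
  rw [hess_pow_eq_zero h k hx]
  simp only [smul_zero, sub_zero, smul_apply, smul_eq_mul, ← mul_add]
  by_cases hE : x ∈ E
  · have hh := hp.nonneg x
    have hχx := hχ0 x
    exact mul_nonneg (by positivity) (hp.levi x hE v)
  · rw [hχE x hE, mul_zero, mul_zero, zero_mul]

/-- The function `|z|² - M`, which is nonpositive where `|z|² ≤ M`. -/
def shiftedSqNorm (n : ℕ) (M : ℝ) : SmoothFn n :=
  ⟨fun x => sqNorm x - M, contDiff_sqNorm.sub contDiff_const⟩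

lemma powForm_succ_eq_hessTest (χ : 𝓓(Ω, ℝ)) (h : SmoothFn n) (k p : ℕ) (M : ℝ) :
    powForm χ h k (p + 1) = hessTest (shiftedSqNorm n M) (powForm χ h k p) := by
  have fderiv_eq : fderiv ℝ (shiftedSqNorm n M).1 = fderiv ℝ sqNorm :=
    funext fun y => fderiv_sub_const M
  ext1 x
  rw [hessTest_apply, hess, fderiv_eq, powForm_apply, powForm_apply, map_smul]
  exact congrArg _ (hessWedge_sqNorm_omegaPow p x).symm

-- Two integrations by parts: write one factor `ω` as `dd^c (|z|² - M)` and move `dd^c` over to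
-- `h^(p+1)`.
lemma IsClosedPosOn.apply_powForm_succ_le {L : TestForm Ω (2 * (p + 1)) →ₗ[ℝ] ℝ}
    (hL : IsClosedPosOn E L) (hχ0 : ∀ x, 0 ≤ χ x) (hχE : ∀ x ∉ E, χ x = 0) (hM0 : 0 ≤ M)
    (hp : IsExcessPair E χ M h w) :
    L (powForm χ h (p + 1) (p + 1)) ≤ (p + 1) * M * L (hessTest w (powForm χ h p p)) := by
  rw [powForm_succ_eq_hessTest χ h _ p M, ← hL.apply_mulTest_ddcTest, ← sub_nonneg,
    ← smul_eq_mul, ← map_smul, ← map_sub]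
  have value (x : Cn n) : (((p : ℝ) + 1) * M) • hessTest w (powForm χ h p p) x -
      mulTest (shiftedSqNorm n M) (ddcTest (powForm χ h (p + 1) p)) x =
      hessWedge ((((p : ℝ) + 1) * M * (h.1 x ^ p * χ x)) • hess w.1 x -
        (sqNorm x - M) • hess (fun y => h.1 y ^ (p + 1)) x) (omegaPow n p) := by
    rw [hessTest_apply, mulTest_apply, hp.ddcTest_powForm, powForm_apply, map_sub, map_smul,
      map_smul, map_smul, sub_apply, smul_apply, smul_apply, smul_smul]
    rfl
  refine hL.pos _ (fun x hx => (value x).trans ?_) fun x => ?_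
  · rw [hess_pow_eq_zero h p fun hx' => hx (hp.mem_of_mem_tsupport hχE hx'), hχE x hx]
    simp
  · have levi_symm (v v' : Cn n) := hess_symm ⟨fun y => h.1 y ^ (p + 1), h.2.pow _⟩ x v v'
    have form_pos : IsPosForm (p := p + 1) _ := (isPosForm_omegaPow n p).hessWedge
      (fun v v' => by simp only [sub_apply, smul_apply, hess_symm w x v v', levi_symm v v'])
      (hp.leviNonneg hχ0 hχE hM0 p x)
    rw [← value] at form_pos
    exact form_pos

lemma IsClosedPosOn.apply_powForm_mono {L : TestForm Ω (2 * p) →ₗ[ℝ] ℝ}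
    (hL : IsClosedPosOn E L) (hχ0 : ∀ x, 0 ≤ χ x) (hχE : ∀ x ∉ E, χ x = 0) {k : ℕ}
    {h h' : SmoothFn n} (hle : ∀ x, h.1 x ^ k ≤ h'.1 x ^ k) :
    L (powForm χ h k p) ≤ L (powForm χ h' k p) := by
  rw [← sub_nonneg, ← map_sub]
  have value (x : Cn n) : (powForm χ h' k p - powForm χ h k p) x =
      ((h'.1 x ^ k - h.1 x ^ k) * χ x) • omegaPow n p := by
    rw [sub_apply, powForm_apply, powForm_apply, ← sub_smul, sub_mul]
  refine hL.pos _ (fun x hx => ?_) fun x => ?_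
  · rw [value, hχE x hx, mul_zero, zero_smul]
  · rw [value]
    exact (isPosForm_omegaPow n p).smul (mul_nonneg (sub_nonneg.2 (hle x)) (hχ0 x))

/-- The test form `dd^c w_{p-1} ∧ ⋯ ∧ dd^c w_0 ∧ φ`. -/
def hessPow (w : ℕ → SmoothFn n) (φ : TestForm Ω 0) : (p : ℕ) → TestForm Ω (2 * p)
  | 0 => φ
  | p + 1 => hessTest (m := 2 * p) (w p) (hessPow w φ p)

lemma hessTest_comm (w w' : SmoothFn n) (φ : TestForm Ω m) :
    hessTest w (hessTest w' φ) = hessTest w' (hessTest w φ) := by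
  ext1 x
  exact hessWedge_comm _ _ _

lemma hessTest_hessPow_shift (w : ℕ → SmoothFn n) (φ : TestForm Ω 0) : ∀ p,
    hessTest (m := 2 * p) (w 0) (hessPow (fun i => w (i + 1)) φ p) = hessPow w φ (p + 1)
  | 0 => rfl
  | p + 1 => by
    change hessTest (m := 2 * p + 2) _ (hessTest (m := 2 * p) _ _) =
      hessTest (m := 2 * p + 2) _ (hessPow w φ (p + 1))
    rw [hessTest_comm, ← hessTest_hessPow_shift w φ p]

-- Contract with `w 0`, and replace `h 0` by the larger `h 1` before the next contraction.
lemma IsClosedPosOn.apply_powForm_le_hessPow (hχ0 : ∀ x, 0 ≤ χ x) (hχE : ∀ x ∉ E, χ x = 0)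
    (hM0 : 0 ≤ M) : ∀ {p : ℕ} {L : TestForm Ω (2 * p) →ₗ[ℝ] ℝ} (_ : IsClosedPosOn E L)
    {h w : ℕ → SmoothFn n} (_ : ∀ i < p, IsExcessPair E χ M (h i) (w i))
    (_ : ∀ i, i + 1 < p → ∀ x, (h i).1 x ≤ (h (i + 1)).1 x),
    L (powForm χ (h 0) p p) ≤
      p.factorial * M ^ p * L (hessPow w (smulForm χ (omegaPow n 0)) p)
  | 0, L, _, h, w, _, _ => by
    have powForm_zero : powForm χ (h 0) 0 0 = smulForm χ (omegaPow n 0) := by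
      ext1 x
      rw [powForm_apply, pow_zero, one_mul]
      rfl
    rw [powForm_zero, Nat.factorial_zero, Nat.cast_one, pow_zero, one_mul, one_mul, hessPow]
  | p + 1, L, hL, h, w, hp, hmono => by
    have hL' := hL.contract (hp 0 p.succ_pos).levi
    have pow_le (x : Cn n) : (h 0).1 x ^ p ≤ (h 1).1 x ^ p := by
      rcases Nat.eq_zero_or_pos p with rfl | hpos
      · rw [pow_zero, pow_zero]
      · exact pow_le_pow_left₀ ((hp 0 p.succ_pos).nonneg x) (hmono 0 (by omega) x) p
    have ih := apply_powForm_le_hessPow hχ0 hχE hM0 hL' (h := fun i => h (i + 1))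
      (w := fun i => w (i + 1)) (fun i hi => hp _ (by omega)) fun i hi => hmono _ (by omega)
    calc L (powForm χ (h 0) (p + 1) (p + 1))
        ≤ (p + 1) * M * Pluri.contract (m := 2 * p) (w 0) L (powForm χ (h 0) p p) :=
          hL.apply_powForm_succ_le hχ0 hχE hM0 (hp 0 p.succ_pos)
      _ ≤ (p + 1) * M * (p.factorial * M ^ p * Pluri.contract (m := 2 * p) (w 0) L
            (hessPow (fun i => w (i + 1)) (smulForm χ (omegaPow n 0)) p)) := by
          gcongr
          exact (hL'.apply_powForm_mono hχ0 hχE pow_le).trans ih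
      _ = (p + 1).factorial * M ^ (p + 1) *
            L (hessPow w (smulForm χ (omegaPow n 0)) (p + 1)) := by
          rw [contract_apply, hessTest_hessPow_shift, Nat.factorial_succ]
          push_cast
          ring

end ChainEstimate

section SuccessiveApproximation

variable {n p : ℕ} {Ω : TopologicalSpace.Opens (Cn n)}

lemma hess_add {g k : Cn n → ℝ} (hg : ContDiff ℝ ∞ g) (hk : ContDiff ℝ ∞ k) (x : Cn n) :
    hess (fun y => g y + k y) x = hess g x + hess k x := by
  have fderiv_eq : fderiv ℝ (fun y => g y + k y) = fun y => fderiv ℝ g y + fderiv ℝ k y :=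
    funext fun y =>
      fderiv_fun_add (hg.differentiable (by simp) y) (hk.differentiable (by simp) y)
  rw [hess, fderiv_eq]
  exact fderiv_fun_add ((contDiff_infty_fderiv hg).differentiable (by simp) x)
    ((contDiff_infty_fderiv hk).differentiable (by simp) x)

lemma hess_const_mul {g : Cn n → ℝ} (hg : ContDiff ℝ ∞ g) (c : ℝ) (x : Cn n) :
    hess (fun y => c * g y) x = c • hess g x := by
  have fderiv_eq : fderiv ℝ (fun y => c * g y) = fun y => c • fderiv ℝ g y :=
    funext fun y => fderiv_const_mul (hg.differentiable (by simp) y) c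
  rw [hess, fderiv_eq]
  exact fderiv_fun_const_smul ((contDiff_infty_fderiv hg).differentiable (by simp) x) c

/-- The strictly plurisubharmonic regularization `f_ε + η |z|²` of `f`, for `s = (ε, η)`. -/
def regularize {f : Cn n → ℝ} (hf : IsBddMeasurable f) (s : Set.Ioi (0 : ℝ) × Set.Ioi (0 : ℝ)) :
    SmoothFn n :=
  ⟨fun x => mollify s.1 f x + s.2 * sqNorm x,
    (contDiff_mollify hf s.1.2).add (contDiff_const.mul contDiff_sqNorm)⟩

lemma hess_regularize {f : Cn n → ℝ} (hf : IsBddMeasurable f)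
    (s : Set.Ioi (0 : ℝ) × Set.Ioi (0 : ℝ)) (x : Cn n) :
    hess (regularize hf s).1 x = hess (mollify s.1 f) x + (s.2 : ℝ) • hess sqNorm x := by
  rw [← hess_const_mul contDiff_sqNorm]
  exact hess_add (contDiff_mollify hf s.1.2) (contDiff_const.mul contDiff_sqNorm) x

lemma hessPow_congr {w w' : ℕ → SmoothFn n} (φ : TestForm Ω 0) : ∀ p, (∀ i < p, w i = w' i) →
    hessPow w φ p = hessPow w' φ p
  | 0, _ => rfl
  | p + 1, h => by
    rw [hessPow, hessPow, hessPow_congr φ p fun i hi => h i (by omega), h p p.lt_succ_self]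

lemma tsupport_hessPow_subset (w : ℕ → SmoothFn n) (φ : TestForm Ω 0) : ∀ p,
    tsupport (hessPow w φ p) ⊆ tsupport φ
  | 0 => subset_rfl
  | p + 1 => by
    refine subset_trans (closure_mono ?_) (tsupport_hessPow_subset w φ p)
    refine Function.support_subset_iff'.2 fun x hx => ?_
    rw [hessPow, hessTest_apply, Function.notMem_support.1 hx, map_zero]

lemma tendsto_coe_Ioi_atBot_nhdsGT (a : ℝ) :
    Tendsto ((↑) : Set.Ioi a → ℝ) atBot (𝓝[>] a) :=
  (tendsto_comp_coe_Ioi_atBot (.of_dense a)).2 tendsto_id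

variable {u : Cn n → ℝ} {M : ℝ} {K D : Set (Cn n)} {r : ℝ}

lemma tendsto_apply_hessTest_regularize {T : Current Ω (2 * (p + 1))} (hT : IsClosedPositive T)
    (hu : RealPSH (Ω : Set (Cn n)) u) (hM : ∀ x ∈ Ω, |u x| ≤ M) (hK : IsCompact K) (hKΩ : K ⊆ Ω)
    (hr : 0 < r) {φ : TestForm Ω (2 * p)} (hφ : ∀ x ∈ tsupport φ, Metric.closedBall x r ⊆ K) :
    Tendsto (fun s => T (hessTest
        (regularize (hu.isBddMeasurable_indicator Ω.isOpen hK hKΩ) s) φ))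
      (atBot ×ˢ atBot) (𝓝 (ddcWedge (m := 2 * p) u T φ)) := by
  have mollified := (tendsto_apply_hessTest_smoothMollify hT hu hM hK hKΩ hr hφ).comp
    (tendsto_fst (g := (atBot : Filter (Set.Ioi (0 : ℝ)))))
  have weight : Tendsto (fun η : Set.Ioi (0 : ℝ) => (η : ℝ)) atBot (𝓝 0) :=
    (tendsto_coe_Ioi_atBot_nhdsGT 0).mono_right nhdsWithin_le_nhds
  have remainder := (weight.comp (tendsto_snd (f := (atBot : Filter (Set.Ioi (0 : ℝ)))))).mul_const
    (T (hessTest ⟨sqNorm, contDiff_sqNorm⟩ φ))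
  have sum := mollified.add remainder
  rw [zero_mul, add_zero] at sum
  refine sum.congr fun s => ?_
  simp only [Function.comp_apply]
  have hessTest_eq : hessTest (regularize (hu.isBddMeasurable_indicator Ω.isOpen hK hKΩ) s) φ =
      hessTest (smoothMollify (hu.isBddMeasurable_indicator Ω.isOpen hK hKΩ) s.1) φ +
        (s.2 : ℝ) • hessTest ⟨sqNorm, contDiff_sqNorm⟩ φ := by
    ext1 x
    rw [hessTest_apply, hess_regularize, map_add, map_smul]
    rfl
  rw [hessTest_eq, map_add, map_smul, smul_eq_mul]

lemma RealPSH.eventually_mollify_lt_add (hu : RealPSH (Ω : Set (Cn n)) u) (hK : IsCompact K)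
    (hKΩ : K ⊆ Ω) (hD : IsCompact D) (hr : 0 < r) (hDK : ∀ x ∈ D, Metric.closedBall x r ⊆ K)
    {ε : ℝ} (hε : 0 < ε) (hεr : ε ≤ r) {d : ℝ} (hd : 0 < d) :
    ∀ᶠ ε' in 𝓝[>] (0 : ℝ), ∀ x ∈ D,
      mollify ε' (K.indicator u) x < mollify ε (K.indicator u) x + d := by
  have hf := hu.isBddMeasurable_indicator Ω.isOpen hK hKΩ
  refine eventually_mollify_lt hf hD
    (fun x hx => hu.upperSemicontinuousAt_indicator hKΩ
      (mem_of_superset (Metric.closedBall_mem_nhds x hr) (hDK x hx)))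
    (fun x _ => ((contDiff_mollify hf hε).continuous.add continuous_const).continuousAt)
    fun x hx => ?_
  have := (hu.submeanAt_indicator hKΩ hr.le (hDK x hx)).le_mollify hf hε hεr
  linarith

/-- Parameters `s i = (ε_i, η_i)`, `i < p`, of regularizations `f_{ε_i} + η_i |z|²` with all `ε_i`
below `ε₀`, for which each mollification exceeds the previous one by less than `d` on `D`. -/
structure IsRegularizingSeq (f : Cn n → ℝ) (D : Set (Cn n)) (ε₀ d : ℝ) (p : ℕ)
    (s : ℕ → Set.Ioi (0 : ℝ) × Set.Ioi (0 : ℝ)) : Prop where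
  scale_lt : ∀ i < p, ((s i).1 : ℝ) < ε₀
  mollify_lt : ∀ i, i + 1 < p → ∀ x ∈ D, mollify (s (i + 1)).1 f x < mollify (s i).1 f x + d

lemma IsRegularizingSeq.update {f : Cn n → ℝ} {ε₀ d : ℝ}
    {s : ℕ → Set.Ioi (0 : ℝ) × Set.Ioi (0 : ℝ)} (hs : IsRegularizingSeq f D ε₀ d p s)
    {t : Set.Ioi (0 : ℝ) × Set.Ioi (0 : ℝ)} (ht : (t.1 : ℝ) < ε₀)
    (hlt : ∀ i < p, ∀ x ∈ D, mollify t.1 f x < mollify (s i).1 f x + d) :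
    IsRegularizingSeq f D ε₀ d (p + 1) (Function.update s p t) := by
  have update_of_lt (i : ℕ) (hi : i < p) : Function.update s p t i = s i :=
    Function.update_of_ne hi.ne _ _
  have update_self : Function.update s p t p = t := Function.update_self _ _ _
  refine ⟨fun i hi => ?_, fun i hi x hx => ?_⟩
  · rcases Nat.lt_succ_iff_lt_or_eq.1 hi with h | rfl
    · rw [update_of_lt i h]
      exact hs.scale_lt i h
    · rwa [update_self]
  · rw [update_of_lt i (by omega)]
    rcases Nat.lt_succ_iff_lt_or_eq.1 hi with h | h
    · rw [update_of_lt (i + 1) h]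
      exact hs.mollify_lt i h x hx
    · rw [h, update_self]
      exact hlt i (by omega) x hx

-- The regularizations are chosen one after the other: the one applied last to the test form is
-- chosen after all others, when the test form to which it is applied is already fixed.
lemma exists_isRegularizingSeq_hessPow (hu : RealPSH (Ω : Set (Cn n)) u)
    (hM : ∀ x ∈ Ω, |u x| ≤ M) (hK : IsCompact K) (hKΩ : K ⊆ Ω) (hD : IsCompact D) (hr : 0 < r)
    (hDK : ∀ x ∈ D, Metric.closedBall x r ⊆ K) {d : ℝ} (hd : 0 < d) {φ : TestForm Ω 0}
    (hφ : ∀ x ∈ tsupport φ, Metric.closedBall x r ⊆ K) {ε₀ : ℝ} (hε₀ : 0 < ε₀) (hε₀r : ε₀ ≤ r) :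
    ∀ {p : ℕ} {T : Current Ω (2 * p)} (_ : IsClosedPositive T) {tol : ℝ} (_ : 0 < tol),
    ∃ s, IsRegularizingSeq (K.indicator u) D ε₀ d p s ∧
      |T (hessPow (fun i => regularize (hu.isBddMeasurable_indicator Ω.isOpen hK hKΩ) (s i)) φ p) -
        ddcPowWedge u p T φ| < tol
  | 0, T, _, tol, htol => by
    refine ⟨fun _ => (⟨1, Set.mem_Ioi.2 one_pos⟩, ⟨1, Set.mem_Ioi.2 one_pos⟩),
      ⟨by simp, by simp⟩, ?_⟩
    simpa only [hessPow, ddcPowWedge, sub_self, abs_zero] using htol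
  | p + 1, T, hT, tol, htol => by
    obtain ⟨s, hs, happrox⟩ := exists_isRegularizingSeq_hessPow hu hM hK hKΩ hD hr hDK hd hφ hε₀
      hε₀r (hT.ddcWedge hu hM) (half_pos htol)
    set hf := hu.isBddMeasurable_indicator Ω.isOpen hK hKΩ
    set Φ := hessPow (fun i => regularize hf (s i)) φ p
    have apply_close := Metric.tendsto_nhds.1 (tendsto_apply_hessTest_regularize (φ := Φ) hT hu hM
      hK hKΩ hr fun x hx => hφ x (tsupport_hessPow_subset _ φ p hx)) (tol / 2) (half_pos htol)
    have below : ∀ᶠ ε in 𝓝[>] (0 : ℝ), ε < ε₀ := eventually_nhdsWithin_of_eventually_nhds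
      (gt_mem_nhds hε₀)
    have mono : ∀ᶠ ε in 𝓝[>] (0 : ℝ), ∀ i ∈ Set.Iio p, ∀ x ∈ D,
        mollify ε (K.indicator u) x < mollify (s i).1 (K.indicator u) x + d :=
      (Set.finite_Iio p).eventually_all.2 fun i hi => hu.eventually_mollify_lt_add hK hKΩ hD hr hDK
        (s i).1.2 ((hs.scale_lt i hi).le.trans hε₀r) hd
    obtain ⟨t, ht_apply, ht_lt, ht_mono⟩ := (apply_close.and
      (((tendsto_coe_Ioi_atBot_nhdsGT 0).eventually (below.and mono)).prod_inl atBot)).exists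
    refine ⟨Function.update s p t, hs.update ht_lt ht_mono, ?_⟩
    have head_eq : hessPow (fun i => regularize hf (Function.update s p t i)) φ p = Φ :=
      hessPow_congr φ p fun i hi => by rw [Function.update_of_ne hi.ne]
    rw [hessPow, head_eq, Function.update_self, ddcPowWedge]
    calc |T (hessTest (m := 2 * p) (regularize hf t) Φ) - ddcPowWedge u p (ddcWedge u T) φ|
        ≤ |T (hessTest (m := 2 * p) (regularize hf t) Φ) - ddcWedge (m := 2 * p) u T Φ| +
          |ddcWedge (m := 2 * p) u T Φ - ddcPowWedge u p (ddcWedge u T) φ| := abs_sub_le _ _ _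
      _ < tol / 2 + tol / 2 := add_lt_add ht_apply happrox
      _ = tol := add_halves tol

end SuccessiveApproximation

section Comparison

variable {n : ℕ} {G E : Set (Cn n)} {v w : Cn n → ℝ} {x : Cn n}

lemma upperSemicontinuousOn_sub {A : Set (Cn n)} (hv : UpperSemicontinuousOn v A)
    (hw : Continuous w) : UpperSemicontinuousOn (fun x => v x - w x) A := by
  have neg_w : UpperSemicontinuousOn (fun x => -w x) A :=
    (show Continuous fun x => -w x from hw.neg).continuousOn.upperSemicontinuousOn
  simp only [sub_eq_add_neg]
  exact hv.add neg_w

lemma RealPSH.sub_const (hG : IsOpen G) (hv : RealPSH G v) (c : ℝ) :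
    RealPSH G fun x => v x - c := by
  obtain ⟨b, hb⟩ := hv.bddBelow
  refine ⟨upperSemicontinuousOn_sub hv.usc continuous_const, fun z hz a ha => ?_,
    b - c, fun z hz => by linarith [hb z hz]⟩
  set K := (fun ζ : ℂ => z + ζ • a) '' Metric.closedBall 0 1
  have hK : IsCompact K := (isCompact_closedBall 0 1).image (by fun_prop)
  have hKG : K ⊆ G := by
    rintro _ ⟨ζ, hζ, rfl⟩
    exact ha ζ (mem_closedBall_zero_iff.1 hζ)
  have indicator_eq (θ : ℝ) :
      K.indicator v (z + circleMap 0 1 θ • a) = v (z + circleMap 0 1 θ • a) :=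
    Set.indicator_of_mem (show _ ∈ K from ⟨circleMap 0 1 θ, by simp, rfl⟩) v
  have integrable : CircleIntegrable (fun ζ : ℂ => v (z + ζ • a)) 0 1 := by
    simpa only [CircleIntegrable, indicator_eq]
      using (hv.isBddMeasurable_indicator hG hK hKG).circleIntegrable z a
  rw [Real.circleAverage_fun_sub integrable (circleIntegrable_const c 0 1),
    Real.circleAverage_const]
  exact sub_le_sub_right (hv.le_average z hz a ha) c

/-- The function `(v - w)⁺` on `G`, extended by zero. -/
def excess (G : Set (Cn n)) (v w : Cn n → ℝ) : Cn n → ℝ := G.indicator fun x => max (v x - w x) 0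

lemma excess_nonneg (G : Set (Cn n)) (v w : Cn n → ℝ) (x : Cn n) : 0 ≤ excess G v w x :=
  Set.indicator_nonneg (fun _ _ => le_max_right _ _) x

lemma excess_of_mem (hx : x ∈ G) : excess G v w x = max (v x - w x) 0 :=
  Set.indicator_of_mem hx _

lemma excess_add_of_mem (hx : x ∈ G) : excess G v w x + w x = max (v x) (w x) := by
  rw [excess_of_mem hx, max_add, sub_add_cancel, zero_add]

/-- A competitor in the definition of maximality: `v` is upper semicontinuous on the closure of the
relatively compact open set `G`, and plurisubharmonic and bounded below in `G`. -/
structure IsCompetitor (G : Set (Cn n)) (v : Cn n → ℝ) : Prop where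
  isOpen : IsOpen G
  isCompact_closure : IsCompact (closure G)
  usc : UpperSemicontinuousOn v (closure G)
  psh : RealPSH G v

lemma IsCompetitor.sub_const (hv : IsCompetitor G v) (c : ℝ) :
    IsCompetitor G fun x => v x - c :=
  ⟨hv.isOpen, hv.isCompact_closure, upperSemicontinuousOn_sub hv.usc continuous_const,
    hv.psh.sub_const hv.isOpen c⟩

lemma IsCompetitor.isBddMeasurable_excess (hv : IsCompetitor G v) (hw : IsBddMeasurable w) :
    IsBddMeasurable (excess G v w) := by
  constructor
  · have excess_eq : excess G v w = fun x => max (G.indicator v x - G.indicator w x) 0 := by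
      funext x
      by_cases hx : x ∈ G <;> simp [excess, hx]
    have hG := hv.isOpen.measurableSet
    rw [excess_eq]
    exact ((hv.psh.measurable_indicator hv.isOpen hG subset_rfl).sub
      (hw.measurable.indicator hG)).max measurable_const
  · obtain ⟨A, hA⟩ := hv.usc.bddAbove_of_isCompact hv.isCompact_closure
    obtain ⟨B, hB⟩ := hw.bdd
    refine ⟨|A| + B, fun x => ?_⟩
    have hB0 : 0 ≤ B := (abs_nonneg _).trans (hB x)
    rw [abs_of_nonneg (excess_nonneg G v w x)]
    by_cases hx : x ∈ G
    · have v_le : v x ≤ A := hA ⟨x, subset_closure hx, rfl⟩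
      rw [excess_of_mem hx]
      exact max_le (by linarith [(abs_le.1 (hB x)).1, le_abs_self A]) (by positivity)
    · rw [excess, Set.indicator_of_notMem hx]
      positivity

/-- A competitor `v` on `G` which is strictly below the bounded continuous function `w` on the
boundary. Then `max v w`, extended by `w` outside `G`, is as subharmonic as `w`. -/
structure IsComparisonPair (G : Set (Cn n)) (v w : Cn n → ℝ) : Prop extends IsCompetitor G v where
  continuous : Continuous w
  bdd : IsBddMeasurable w
  lt_of_mem_frontier : ∀ x ∈ frontier G, v x < w x

/-- The part of `closure G` where `v` is not below `w`. It contains the support of `(v - w)⁺`. -/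
def contactSet (G : Set (Cn n)) (v w : Cn n → ℝ) : Set (Cn n) := {x ∈ closure G | w x ≤ v x}

lemma excess_eq_zero (hx : x ∉ contactSet G v w) : excess G v w x = 0 :=
  Set.indicator_apply_eq_zero.2 fun hG =>
    max_eq_right (sub_nonpos.2 (not_le.1 fun hle => hx ⟨subset_closure hG, hle⟩).le)

namespace IsComparisonPair

lemma isBddMeasurable_excess_add (h : IsComparisonPair G v w) :
    IsBddMeasurable fun x => excess G v w x + w x :=
  (h.toIsCompetitor.isBddMeasurable_excess h.bdd).add h.bdd

lemma isCompact_contactSet (h : IsComparisonPair G v w) : IsCompact (contactSet G v w) := by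
  have contactSet_eq : contactSet G v w = closure G ∩ (fun x => v x - w x) ⁻¹' Set.Ici 0 := by
    ext x
    simp [contactSet]
  rw [contactSet_eq]
  exact (upperSemicontinuousOn_sub h.usc h.continuous).isCompact_inter_preimage_Ici
    h.isCompact_closure 0

lemma contactSet_subset (h : IsComparisonPair G v w) : contactSet G v w ⊆ G := by
  rintro x ⟨hx, hle⟩
  by_contra hG
  have hfr : x ∈ frontier G := h.isOpen.frontier_eq ▸ ⟨hx, hG⟩
  exact (h.lt_of_mem_frontier x hfr).not_ge hle

lemma exists_cthickening_contactSet_subset (h : IsComparisonPair G v w) :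
    ∃ r > 0, Metric.cthickening r (contactSet G v w) ⊆ G :=
  h.isCompact_contactSet.exists_cthickening_subset_open h.isOpen h.contactSet_subset

lemma submeanAt_of_mem_contactSet (h : IsComparisonPair G v w) {r : ℝ} (hr : 0 ≤ r)
    (hG : Metric.cthickening r (contactSet G v w) ⊆ G) (hx : x ∈ contactSet G v w) :
    SubmeanAt (fun y => excess G v w y + w y) x r := by
  intro a ha
  set K := Metric.cthickening r (contactSet G v w)
  have hK : IsCompact K := h.isCompact_contactSet.cthickening
  have ball_subset : Metric.closedBall x r ⊆ K := Metric.closedBall_subset_cthickening hx r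
  have submean := h.psh.submeanAt_indicator hG hr ball_subset a ha
  rw [Set.indicator_of_mem (ball_subset (Metric.mem_closedBall_self hr))] at submean
  simp only [excess_add_of_mem (h.contactSet_subset hx), max_eq_left hx.2]
  refine submean.trans (Real.circleAverage_mono
    ((h.psh.isBddMeasurable_indicator h.isOpen hK hG).circleIntegrable x a)
    (h.isBddMeasurable_excess_add.circleIntegrable x a) fun ζ hζ => ?_)
  have norm_ζ : ‖ζ‖ = 1 := by simpa using hζ
  have hmem : x + ζ • a ∈ K := ball_subset (by
    rwa [mem_closedBall_iff_norm, add_sub_cancel_left, norm_smul, norm_ζ, one_mul])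
  rw [Set.indicator_of_mem hmem, excess_add_of_mem (hG hmem)]
  exact le_max_left _ _

lemma submeanAt_of_notMem_contactSet (h : IsComparisonPair G v w) {r : ℝ} (hw : SubmeanAt w x r)
    (hx : x ∉ contactSet G v w) : SubmeanAt (fun y => excess G v w y + w y) x r := by
  intro a ha
  simp only [excess_eq_zero hx, zero_add]
  refine (hw a ha).trans (Real.circleAverage_mono (h.bdd.circleIntegrable x a)
    (h.isBddMeasurable_excess_add.circleIntegrable x a) fun ζ _ => ?_)
  exact le_add_of_nonneg_left (excess_nonneg _ _ _ _)

lemma exists_submeanAt (h : IsComparisonPair G v w) {r₀ : ℝ} (hr₀ : 0 < r₀)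
    (hE : ∀ z ∈ E, SubmeanAt w z r₀) :
    ∃ r > 0, ∀ z ∈ E, SubmeanAt (fun x => excess G v w x + w x) z r := by
  obtain ⟨r₁, hr₁, hG⟩ := h.exists_cthickening_contactSet_subset
  refine ⟨min r₀ r₁, lt_min hr₀ hr₁, fun z hz a ha => ?_⟩
  by_cases hzS : z ∈ contactSet G v w
  · exact h.submeanAt_of_mem_contactSet hr₁.le hG hzS a (ha.trans (min_le_right _ _))
  · exact h.submeanAt_of_notMem_contactSet (hE z hz) hzS a (ha.trans (min_le_left _ _))

lemma upperSemicontinuousAt_excess_add (h : IsComparisonPair G v w) (hx : x ∈ G) :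
    UpperSemicontinuousAt (fun y => excess G v w y + w y) x := by
  have usc_v : UpperSemicontinuousAt v x := fun c hc => by
    simpa only [h.isOpen.nhdsWithin_eq hx] using h.psh.usc x hx c hc
  intro c hc
  change excess G v w x + w x < c at hc
  rw [excess_add_of_mem hx] at hc
  filter_upwards [usc_v.sup (h.continuous.upperSemicontinuous x) c hc, h.isOpen.mem_nhds hx]
    with y hy hyG
  rwa [excess_add_of_mem hyG]

lemma tendsto_mollify_excess (h : IsComparisonPair G v w) {r₀ : ℝ} (hr₀ : 0 < r₀)
    (hw : SubmeanAt w x r₀) (hx : x ∈ G) :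
    Tendsto (fun δ => mollify δ (excess G v w) x) (𝓝[>] 0) (𝓝 (excess G v w x)) := by
  have hexcess := h.toIsCompetitor.isBddMeasurable_excess h.bdd
  obtain ⟨r, hr, hsub⟩ := h.exists_submeanAt (E := {x}) hr₀ fun z hz =>
    (Set.mem_singleton_iff.1 hz).symm ▸ hw
  have tendsto_max := tendsto_mollify h.isBddMeasurable_excess_add hr (hsub x rfl)
    (h.upperSemicontinuousAt_excess_add hx)
  have tendsto_w := tendsto_mollify h.bdd hr₀ hw (h.continuous.upperSemicontinuous x)
  have tendsto_sub := tendsto_max.sub tendsto_w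
  rw [add_sub_cancel_right] at tendsto_sub
  refine tendsto_sub.congr' ?_
  filter_upwards [self_mem_nhdsWithin] with δ hδ
  rw [mollify_add hexcess h.bdd hδ, add_sub_cancel_right]

lemma eventually_tsupport_subset (h : IsComparisonPair G v w) :
    ∀ᶠ δ in 𝓝[>] (0 : ℝ), tsupport (mollify δ (excess G v w)) ⊆ G := by
  obtain ⟨r, hr, hG⟩ := h.exists_cthickening_contactSet_subset
  filter_upwards [Ioc_mem_nhdsGT hr] with δ hδ
  refine (closure_minimal (Function.support_subset_iff'.2 fun x hx => ?_)
    Metric.isClosed_cthickening).trans hG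
  rw [mollify_congr (g := fun _ => 0) hδ.1 fun y hy => excess_eq_zero fun hyS => hx ?_,
    mollify_const hδ.1]
  refine Metric.closedBall_subset_cthickening hyS r ?_
  rw [Metric.mem_closedBall, dist_comm]
  exact (Metric.mem_ball.1 hy).le.trans hδ.2

end IsComparisonPair

lemma sq_norm_le_sqNorm (v : Cn n) : ‖v‖ ^ 2 ≤ sqNorm v := by
  have norm_le : ‖v‖ ≤ √(sqNorm v) := (pi_norm_le_iff_of_nonneg (Real.sqrt_nonneg _)).2 fun j =>
    Real.le_sqrt_of_sq_le (norm_sq_le_sqNorm v j)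
  calc ‖v‖ ^ 2 ≤ √(sqNorm v) ^ 2 := by gcongr
    _ = sqNorm v := Real.sq_sqrt (sqNorm_nonneg v)

lemma hess_sqNorm_apply (x v : Cn n) : hess sqNorm x v v = 2 * sqNorm v := by
  rw [hess_sqNorm]
  simp only [smul_apply, sum_apply, leviForm_apply, smul_eq_mul, sqNorm]
  congr 1

lemma leviNonneg_add_smul_hess_sqNorm {H H' : Cn n →L[ℝ] Cn n →L[ℝ] ℝ} (hH : LeviNonneg H) {η : ℝ}
    (h : ‖H' - H‖ ≤ η) (x : Cn n) : LeviNonneg (H' + η • hess sqNorm x) := by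
  intro v
  have hη : 0 ≤ η := (norm_nonneg _).trans h
  have lower_bound (a : Cn n) : H a a - η * sqNorm a ≤ H' a a := by
    have abs_le_norm : |H' a a - H a a| ≤ η * ‖a‖ ^ 2 := by
      refine ((H' - H).le_opNorm₂ a a).trans ?_
      rw [mul_assoc, ← sq]
      gcongr
    have norm_le := mul_le_mul_of_nonneg_left (sq_norm_le_sqNorm a) hη
    linarith [(abs_le.1 abs_le_norm).1]
  have at_v := lower_bound v
  have at_iv := lower_bound (Complex.I • v)
  have levi := hH v
  have weight_v := mul_nonneg hη (sqNorm_nonneg v)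
  have weight_iv := mul_nonneg hη (sqNorm_nonneg (Complex.I • v))
  simp only [add_apply, smul_apply, smul_eq_mul, hess_sqNorm_apply]
  linarith

-- `(v - w)⁺ + w` is subharmonic on discs, and so is its mollification. Replacing the mollification
-- of `w` by `w` itself costs an arbitrarily small multiple of `|z|²`.
lemma IsComparisonPair.eventually_leviNonneg (h : IsComparisonPair G v w) (hws : ContDiff ℝ ∞ w)
    (hwc : HasCompactSupport w) {r₀ : ℝ} (hr₀ : 0 < r₀) (hE : ∀ z ∈ E, SubmeanAt w z r₀)
    (hGE : ∀ x ∈ closure G, Metric.closedBall x r₀ ⊆ E) {η : ℝ} (hη : 0 < η) :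
    ∀ᶠ δ in 𝓝[>] (0 : ℝ), ∀ x ∈ closure G,
      LeviNonneg (hess (mollify δ (excess G v w)) x + (hess w x + η • hess sqNorm x)) := by
  obtain ⟨r, hr, hsub⟩ := h.exists_submeanAt hr₀ hE
  have hexcess := h.toIsCompetitor.isBddMeasurable_excess h.bdd
  filter_upwards [eventually_hess_mollify (contDiff_infty.1 hws 2) hwc hη, Ioc_mem_nhdsGT hr₀]
    with δ hess_close hδ x hx
  have levi_max : LeviNonneg (hess (mollify δ fun x => excess G v w x + w x) x) := by
    refine SubmeanAt.leviNonneg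
      (contDiff_infty.1 (contDiff_mollify h.isBddMeasurable_excess_add hδ.1) 2) hr
      (SubmeanAt.mollify h.isBddMeasurable_excess_add hδ.1 fun y hy => hsub _ (hGE x hx ?_))
    rw [mem_closedBall_iff_norm, sub_sub_cancel_left, norm_neg]
    exact hy.trans hδ.2
  have mollify_eq : (mollify δ fun x => excess G v w x + w x) =
      fun x => mollify δ (excess G v w) x + mollify δ w x :=
    funext fun x => mollify_add hexcess h.bdd hδ.1 x
  rw [mollify_eq, hess_add (contDiff_mollify hexcess hδ.1) (contDiff_mollify h.bdd hδ.1)]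
    at levi_max
  rw [← add_assoc]
  refine leviNonneg_add_smul_hess_sqNorm levi_max ?_ x
  rw [add_sub_add_left_eq_sub, norm_sub_rev]
  exact hess_close x

end Comparison

section MassEstimate

variable {n q : ℕ} {Ω : TopologicalSpace.Opens (Cn n)}

lemma lintegral_le_of_tendsto {ι X : Type*} [MeasurableSpace X] {μ : Measure X} {l : Filter ι}
    [l.IsCountablyGenerated] [l.NeBot] {F : ι → X → ENNReal} {g : X → ENNReal} {B : ι → ENNReal}
    {b : ENNReal} (hF : ∀ i, Measurable (F i)) (hlim : ∀ᵐ x ∂μ, Tendsto (F · x) l (𝓝 (g x)))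
    (hB : ∀ᶠ i in l, ∫⁻ x, F i x ∂μ ≤ B i) (hb : Tendsto B l (𝓝 b)) : ∫⁻ x, g x ∂μ ≤ b := by
  calc ∫⁻ x, g x ∂μ = ∫⁻ x, liminf (F · x) l ∂μ :=
        lintegral_congr_ae (hlim.mono fun x hx => hx.liminf_eq.symm)
    _ ≤ liminf (fun i => ∫⁻ x, F i x ∂μ) l := lintegral_liminf_le hF
    _ ≤ liminf B l := liminf_le_liminf hB
    _ = b := hb.liminf_eq

lemma IsClosedPositive.ddcPowWedge {u : Cn n → ℝ} (hu : RealPSH (Ω : Set (Cn n)) u) {M : ℝ}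
    (hM : ∀ x ∈ Ω, |u x| ≤ M) : ∀ {p : ℕ} {T : Current Ω (2 * p)}, IsClosedPositive T →
    IsClosedPositive (p := 0) (Pluri.ddcPowWedge u p T)
  | 0, _, hT => hT
  | p + 1, T, hT =>
    IsClosedPositive.ddcPowWedge (T := Pluri.ddcWedge (m := 2 * p) u T) hu hM (hT.ddcWedge hu hM)

lemma isRepresentingMeasure_traceMeasure {T : Current Ω (2 * q)} (hT : IsClosedPositive T) :
    IsRepresentingMeasure (fun χ : 𝓓(Ω, ℝ) => T (smulForm χ (omegaPow n q))) (traceMeasure T) := by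
  obtain ⟨μ, τ, h⟩ := exists_isPosRep hT.bidim hT.positive
  exact isRepresentingMeasure_measureOf (exists_isRepresentingMeasure
    (currentCoeff T (omegaPow n q)) fun χ hχ => h.nonneg fun x =>
      (isPosForm_omegaPow n q).smul (hχ x))

lemma omegaPow_zero :
    omegaPow n 0 = ContinuousAlternatingMap.constOfIsEmpty ℝ (Cn n) (Fin 0) 1 := by
  ext v
  simp [omegaPow, elementaryForm, wedgeOne_apply]

lemma zeroDimMeasure_eq_traceMeasure (S : Current Ω (2 * 0)) :
    zeroDimMeasure S = traceMeasure S := by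
  rw [traceMeasure, omegaPow_zero]
  rfl

lemma IsRadonOn.integrable_testFunction {μ : Measure (Cn n)} (hμ : IsRadonOn Ω μ) (χ : 𝓓(Ω, ℝ)) :
    Integrable χ μ := by
  simpa using χ.integrable_bilin (ContinuousLinearMap.mul ℝ ℝ) (hμ.locallyIntegrableOn
    (f := fun _ => (1 : ℝ)) aestronglyMeasurable_const (C := 1) (by simp))

lemma ofReal_apply_eq_lintegral {T : Current Ω (2 * q)} (hT : IsClosedPositive T) {χ : 𝓓(Ω, ℝ)}
    (hχ : ∀ x, 0 ≤ χ x) : ENNReal.ofReal (T (smulForm χ (omegaPow n q))) =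
      ∫⁻ x, ENNReal.ofReal (χ x) ∂traceMeasure T := by
  have h := isRepresentingMeasure_traceMeasure hT
  rw [← h.integral_eq χ]
  exact ofReal_integral_eq_lintegral_ofReal (h.isRadonOn.integrable_testFunction χ) (ae_of_all _ hχ)

lemma ofReal_ddcPowWedge_le_mongeAmpereMeasure {T : Current Ω (2 * q)} (hT : IsClosedPositive T)
    {u : Cn n → ℝ} (hu : RealPSH (Ω : Set (Cn n)) u) {M : ℝ} (hM : ∀ x ∈ Ω, |u x| ≤ M)
    {χ : 𝓓(Ω, ℝ)} (hχ0 : ∀ x, 0 ≤ χ x) (hχ1 : ∀ x, χ x ≤ 1) :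
    ENNReal.ofReal (ddcPowWedge u q T (smulForm χ (omegaPow n 0))) ≤
      mongeAmpereMeasure T u (Ω : Set (Cn n)) := by
  rw [mongeAmpereMeasure, zeroDimMeasure_eq_traceMeasure]
  refine (ofReal_apply_eq_lintegral (hT.ddcPowWedge hu hM) hχ0).trans_le ?_
  rw [← lintegral_indicator_one Ω.isOpen.measurableSet]
  refine lintegral_mono fun x => ?_
  by_cases hx : x ∈ (Ω : Set (Cn n))
  · rw [Set.indicator_of_mem hx]
    exact ENNReal.ofReal_le_one.2 (hχ1 x)
  · simp [test_apply_eq_zero χ hx]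

lemma lintegral_pow_le_apply_powForm {T : Current Ω (2 * q)} (hT : IsClosedPositive T)
    {χ : 𝓓(Ω, ℝ)} (hχ0 : ∀ x, 0 ≤ χ x) {G : Set (Cn n)} (hG : MeasurableSet G)
    (hχ : ∀ x ∈ G, χ x = 1) {h : SmoothFn n} (hh : ∀ x, 0 ≤ h.1 x) :
    ∫⁻ x in G, ENNReal.ofReal (h.1 x ^ q) ∂traceMeasure T ≤
      ENNReal.ofReal (T (powForm χ h q q)) := by
  let hχq : 𝓓(Ω, ℝ) := testOf χ (fun x => h.1 x ^ q * χ x) ((h.2.pow q).mul χ.contDiff)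
    fun x hx => by simp [hx]
  have powForm_eq : powForm χ h q q = smulForm hχq (omegaPow n q) := by
    ext1 x
    rw [powForm_apply]
    rfl
  have nonneg (x : Cn n) : 0 ≤ hχq x := mul_nonneg (pow_nonneg (hh x) q) (hχ0 x)
  rw [powForm_eq, ofReal_apply_eq_lintegral hT nonneg]
  refine (setLIntegral_congr_fun hG fun x hx => ?_).trans_le (setLIntegral_le_lintegral G _)
  change _ = ENNReal.ofReal (h.1 x ^ q * χ x)
  rw [hχ x hx, mul_one]

/-- Neighbourhoods `E` of `D` and `K ⊆ Ω` of `E`, with room `r` around `D` and `2 * r` around `E`,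
and a cutoff function `χ` which is `1` on `D` and supported in `E`. -/
structure IsCutoffNhds (D E K : Set (Cn n)) (r : ℝ) (χ : 𝓓(Ω, ℝ)) : Prop where
  isCompact : IsCompact K
  subset : K ⊆ Ω
  pos : 0 < r
  closedBall_two_mul_subset : ∀ x ∈ E, Metric.closedBall x (2 * r) ⊆ K
  closedBall_subset : ∀ x ∈ D, Metric.closedBall x r ⊆ E
  cutoff_nonneg : ∀ x, 0 ≤ χ x
  cutoff_le_one : ∀ x, χ x ≤ 1
  cutoff_eq_one : ∀ x ∈ D, χ x = 1
  tsupport_subset : tsupport χ ⊆ E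

lemma exists_isCutoffNhds {D : Set (Cn n)} (hD : IsCompact D) (hDΩ : D ⊆ Ω) :
    ∃ E K r, ∃ χ : 𝓓(Ω, ℝ), IsCutoffNhds D E K r χ := by
  obtain ⟨R, hR, hRΩ⟩ := hD.exists_cthickening_subset_open Ω.isOpen hDΩ
  have hr : 0 < R / 3 := by positivity
  obtain ⟨χ, nonneg, le_one, eq_one⟩ := exists_cutoff (Ω := ⟨Metric.thickening (R / 3) D,
    Metric.isOpen_thickening⟩) hD (Metric.self_subset_thickening hr D)
  have tsupport_subset : tsupport χ ⊆ Metric.cthickening (R / 3) D :=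
    χ.tsupport_subset.trans (Metric.thickening_subset_cthickening _ _)
  have thickening_subset : Metric.cthickening (R / 3) D ⊆ Ω :=
    (Metric.cthickening_mono (by linarith) D).trans hRΩ
  exact ⟨Metric.cthickening (R / 3) D, Metric.cthickening R D, R / 3,
    ⟨χ, χ.contDiff, χ.hasCompactSupport, tsupport_subset.trans thickening_subset⟩,
    { isCompact := hD.cthickening
      subset := hRΩ
      pos := hr
      closedBall_two_mul_subset := fun x hx =>
        (Metric.closedBall_subset_cthickening hx _).trans
          ((Metric.cthickening_cthickening_subset (by positivity) hr.le D).trans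
            (Metric.cthickening_mono (by linarith) D))
      closedBall_subset := fun x hx => Metric.closedBall_subset_cthickening hx _
      cutoff_nonneg := nonneg
      cutoff_le_one := le_one
      cutoff_eq_one := fun x hx => eq_one.self_of_nhdsSet x hx
      tsupport_subset := tsupport_subset }⟩

namespace IsCutoffNhds

variable {D E K : Set (Cn n)} {r : ℝ} {χ : 𝓓(Ω, ℝ)} {x : Cn n}

lemma mem (hN : IsCutoffNhds D E K r χ) (hx : x ∈ D) : x ∈ E :=
  hN.closedBall_subset x hx (Metric.mem_closedBall_self hN.pos.le)

lemma cutoff_eq_zero (hN : IsCutoffNhds D E K r χ) (hx : x ∉ E) : χ x = 0 :=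
  image_eq_zero_of_notMem_tsupport fun h => hx (hN.tsupport_subset h)

lemma tsupport_smulForm_subset (hN : IsCutoffNhds D E K r χ) {m : ℕ} (β : Form n m) :
    tsupport (smulForm χ β) ⊆ E := by
  refine (closure_mono (Function.support_subset_iff'.2 fun x hx => ?_)).trans hN.tsupport_subset
  rw [smulForm_apply, Function.notMem_support.1 hx, zero_smul]

lemma isBddMeasurable_indicator (hN : IsCutoffNhds D E K r χ) {u : Cn n → ℝ}
    (hu : RealPSH (Ω : Set (Cn n)) u) : IsBddMeasurable (K.indicator u) :=
  hu.isBddMeasurable_indicator Ω.isOpen hN.isCompact hN.subset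

lemma le_mollify (hN : IsCutoffNhds D E K r χ) {u : Cn n → ℝ} (hu : RealPSH (Ω : Set (Cn n)) u)
    {ε : ℝ} (hε : 0 < ε) (hεr : ε ≤ r) (hx : x ∈ E) : u x ≤ mollify ε (K.indicator u) x := by
  have h2r : 0 ≤ 2 * r := by linarith [hN.pos]
  have ball_subset := hN.closedBall_two_mul_subset x hx
  have le := (hu.submeanAt_indicator hN.subset h2r ball_subset).le_mollify
    (hN.isBddMeasurable_indicator hu) hε (by linarith)
  rwa [Set.indicator_of_mem (ball_subset (Metric.mem_closedBall_self h2r))] at le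

lemma submeanAt_mollify (hN : IsCutoffNhds D E K r χ) {u : Cn n → ℝ}
    (hu : RealPSH (Ω : Set (Cn n)) u) {ε : ℝ} (hε : 0 < ε) (hεr : ε ≤ r) (hx : x ∈ E) :
    SubmeanAt (mollify ε (K.indicator u)) x r :=
  hu.submeanAt_mollify_indicator Ω.isOpen hN.isCompact hN.subset hN.pos.le hε
    ((Metric.closedBall_subset_closedBall (by linarith)).trans (hN.closedBall_two_mul_subset x hx))

lemma leviNonneg_regularize (hN : IsCutoffNhds D E K r χ) {u : Cn n → ℝ}
    (hu : RealPSH (Ω : Set (Cn n)) u) {s : Set.Ioi (0 : ℝ) × Set.Ioi (0 : ℝ)} (hs : (s.1 : ℝ) ≤ r)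
    (hx : x ∈ E) : LeviNonneg (hess (regularize (hN.isBddMeasurable_indicator hu) s).1 x) := by
  have levi_mollify := hu.leviNonneg_mollify Ω.isOpen hN.isCompact hN.subset
    (hN.closedBall_two_mul_subset x hx) s.1.2 (by linarith [hN.pos])
  rw [hess_regularize]
  intro a
  have levi_u := levi_mollify a
  have levi_sqNorm := mul_nonneg (le_of_lt s.2.2) (leviNonneg_sqNorm x a)
  simp only [add_apply, smul_apply, smul_eq_mul] at levi_u levi_sqNorm ⊢
  linarith

end IsCutoffNhds

end MassEstimate

section ExcessEstimate

variable {n q : ℕ} {Ω : TopologicalSpace.Opens (Cn n)} {G E K : Set (Cn n)} {r : ℝ} {χ : 𝓓(Ω, ℝ)}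
  {u v : Cn n → ℝ}

lemma IsCutoffNhds.isComparisonPair (hN : IsCutoffNhds (closure G) E K r χ)
    (hu : RealPSH (Ω : Set (Cn n)) u) (hv : IsCompetitor G v) (hvu : ∀ x ∈ frontier G, v x ≤ u x)
    {c : ℝ} (hc : 0 < c) {ε : ℝ} (hε : 0 < ε) (hεr : ε ≤ r) :
    IsComparisonPair G (fun x => v x - c) (mollify ε (K.indicator u)) where
  toIsCompetitor := hv.sub_const c
  continuous := (contDiff_mollify (hN.isBddMeasurable_indicator hu) hε).continuous
  bdd := (hN.isBddMeasurable_indicator hu).mollify hε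
  lt_of_mem_frontier x hx := by
    have u_le := hN.le_mollify hu hε hεr (hN.mem (frontier_subset_closure hx))
    linarith [hvu x hx]

/-- The mollification at scale `t` of `(v - c - f_ε)⁺`, where `f_ε` is the mollification of `f`. -/
def smoothExcess {f : Cn n → ℝ} (hv : IsCompetitor G v) (hf : IsBddMeasurable f) (c : ℝ)
    (ε t : Set.Ioi (0 : ℝ)) : SmoothFn n :=
  smoothMollify ((hv.sub_const c).isBddMeasurable_excess (hf.mollify ε.2)) t

lemma smoothExcess_mono {f : Cn n → ℝ} (hv : IsCompetitor G v) (hf : IsBddMeasurable f) {c c' : ℝ}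
    {ε ε' : Set.Ioi (0 : ℝ)} (h : ∀ x ∈ G, c' + mollify ε' f x ≤ c + mollify ε f x)
    (t : Set.Ioi (0 : ℝ)) (x : Cn n) :
    (smoothExcess hv hf c ε t).1 x ≤ (smoothExcess hv hf c' ε' t).1 x := by
  refine mollify_mono ((hv.sub_const c).isBddMeasurable_excess (hf.mollify ε.2))
    ((hv.sub_const c').isBddMeasurable_excess (hf.mollify ε'.2)) t.2 fun y _ => ?_
  exact Set.indicator_le_indicator' fun hy => max_le_max (by linarith [h y hy]) le_rfl

lemma IsCutoffNhds.eventually_isExcessPair (hN : IsCutoffNhds (closure G) E K r χ)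
    (hu : RealPSH (Ω : Set (Cn n)) u) (hv : IsCompetitor G v) (hvu : ∀ x ∈ frontier G, v x ≤ u x)
    {M : ℝ} (hM : ∀ x ∈ closure G, sqNorm x ≤ M) {c : ℝ} (hc : 0 < c)
    {s : Set.Ioi (0 : ℝ) × Set.Ioi (0 : ℝ)} (hs : (s.1 : ℝ) ≤ r) :
    ∀ᶠ t in atBot, IsExcessPair E χ M
      (smoothExcess hv (hN.isBddMeasurable_indicator hu) c s.1 t)
      (regularize (hN.isBddMeasurable_indicator hu) s) := by
  have hf := hN.isBddMeasurable_indicator hu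
  have pair := hN.isComparisonPair hu hv hvu hc s.1.2 hs
  have compactSupport : HasCompactSupport (K.indicator u) :=
    HasCompactSupport.intro hN.isCompact fun x hx => Set.indicator_of_notMem hx u
  have levi := pair.eventually_leviNonneg (contDiff_mollify hf s.1.2)
    (hasCompactSupport_mollify compactSupport s.1.2) hN.pos
    (fun _ hz => hN.submeanAt_mollify hu s.1.2 hs hz) hN.closedBall_subset s.2.2
  filter_upwards [(tendsto_coe_Ioi_atBot_nhdsGT 0).eventually pair.eventually_tsupport_subset,
    (tendsto_coe_Ioi_atBot_nhdsGT 0).eventually levi] with t htG ht_levi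
  have mem_closure (x : Cn n) (hx : x ∈ tsupport (smoothExcess hv hf c s.1 t).1) : x ∈ closure G :=
    subset_closure (htG hx)
  refine ⟨fun x => ?_, fun x hx => hN.cutoff_eq_one x (mem_closure x hx),
    fun x hx => hM x (mem_closure x hx), fun x hx => hN.leviNonneg_regularize hu hs hx,
    fun x hx => ?_⟩
  · exact Pluri.le_mollify ((hv.sub_const c).isBddMeasurable_excess (hf.mollify s.1.2)) t.2
      fun y _ => excess_nonneg _ _ _ _
  · rw [hess_regularize]
    exact ht_levi x (mem_closure x hx)

lemma lintegral_smoothFn_pow_le {T : Current Ω (2 * q)} (hT : IsClosedPositive T) {M : ℝ}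
    (hM0 : 0 ≤ M) (hq : 1 ≤ q) (hN : IsCutoffNhds (closure G) E K r χ) (hG : MeasurableSet G)
    {h w : ℕ → SmoothFn n} (hp : ∀ i < q, IsExcessPair E χ M (h i) (w i))
    (hmono : ∀ i, i + 1 < q → ∀ x, (h i).1 x ≤ (h (i + 1)).1 x) :
    ∫⁻ x in G, ENNReal.ofReal ((h 0).1 x ^ q) ∂traceMeasure T ≤ ENNReal.ofReal
      (q.factorial * M ^ q * T (hessPow w (smulForm χ (omegaPow n 0)) q)) :=
  (lintegral_pow_le_apply_powForm hT hN.cutoff_nonneg hG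
    (fun x hx => hN.cutoff_eq_one x (subset_closure hx)) (hp 0 hq).nonneg).trans
    (ENNReal.ofReal_le_ofReal ((hT.isClosedPosOn E).apply_powForm_le_hessPow hN.cutoff_nonneg
      (fun _ hx => hN.cutoff_eq_zero hx) hM0 hp hmono))

-- The `i`-th of the `q` integrations by parts uses the pair of `v - (q - i) d` and the `i`-th
-- regularization of `u`. The mollifications of `u` grow by less than `d` from one to the next, so
-- the excesses increase with `i`.
lemma lintegral_excess_pow_le {T : Current Ω (2 * q)} (hT : IsClosedPositive T) (hq : 1 ≤ q)
    (hN : IsCutoffNhds (closure G) E K r χ) (hu : RealPSH (Ω : Set (Cn n)) u)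
    (hv : IsCompetitor G v) (hvu : ∀ x ∈ frontier G, v x ≤ u x) {M : ℝ} (hM0 : 0 ≤ M)
    (hM : ∀ x ∈ closure G, sqNorm x ≤ M) {d ε₀ : ℝ} (hd : 0 < d) (hε₀ : ε₀ ≤ r)
    {s : ℕ → Set.Ioi (0 : ℝ) × Set.Ioi (0 : ℝ)}
    (hs : IsRegularizingSeq (K.indicator u) (closure G) ε₀ d q s) :
    ∫⁻ x in G, ENNReal.ofReal
        (excess G (fun x => v x - q * d) (mollify (s 0).1 (K.indicator u)) x ^ q) ∂traceMeasure T ≤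
      ENNReal.ofReal (q.factorial * M ^ q *
        T (hessPow (fun i => regularize (hN.isBddMeasurable_indicator hu) (s i))
          (smulForm χ (omegaPow n 0)) q)) := by
  have hf := hN.isBddMeasurable_indicator hu
  have scale_le (i : ℕ) (hi : i < q) : ((s i).1 : ℝ) ≤ r := (hs.scale_lt i hi).le.trans hε₀
  let h (t : Set.Ioi (0 : ℝ)) (i : ℕ) : SmoothFn n := smoothExcess hv hf ((q - i) * d) (s i).1 t
  have h_mono (t : Set.Ioi (0 : ℝ)) (i : ℕ) (hi : i + 1 < q) (x : Cn n) :
      (h t i).1 x ≤ (h t (i + 1)).1 x :=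
    smoothExcess_mono hv hf (fun y hy => by
      have := hs.mollify_lt i hi y (subset_closure hy)
      push_cast
      linarith) t x
  have h_pairs : ∀ᶠ t in atBot, ∀ i ∈ Set.Iio q,
      IsExcessPair E χ M (h t i) (regularize hf (s i)) :=
    (Set.finite_Iio q).eventually_all.2 fun i hi => hN.eventually_isExcessPair hu hv hvu hM
      (mul_pos (sub_pos.2 (Nat.cast_lt.2 hi)) hd) (scale_le i hi)
  have h_tendsto (x : Cn n) (hx : x ∈ G) : Tendsto (fun t => (h t 0).1 x) atBot
      (𝓝 (excess G (fun x => v x - q * d) (mollify (s 0).1 (K.indicator u)) x)) := by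
    have pair := hN.isComparisonPair hu hv hvu (c := q * d)
      (mul_pos (Nat.cast_pos.2 hq) hd) (s 0).1.2 (scale_le 0 hq)
    simpa [h] using! (pair.tendsto_mollify_excess hN.pos (hN.submeanAt_mollify hu (s 0).1.2
      (scale_le 0 hq) (hN.mem (subset_closure hx))) hx).comp (tendsto_coe_Ioi_atBot_nhdsGT 0)
  refine lintegral_le_of_tendsto (F := fun t x => ENNReal.ofReal ((h t 0).1 x ^ q))
    (fun t => ((h t 0).2.continuous.measurable.pow_const q).ennreal_ofReal)
    ((ae_restrict_iff' hv.isOpen.measurableSet).2 (ae_of_all _ fun x hx =>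
      ENNReal.tendsto_ofReal ((h_tendsto x hx).pow q)))
    (h_pairs.mono fun t ht => ?_) tendsto_const_nhds
  exact lintegral_smoothFn_pow_le hT hM0 hq hN hv.isOpen.measurableSet ht (h_mono t)

lemma IsCutoffNhds.exists_isRegularizingSeq {D : Set (Cn n)} (hN : IsCutoffNhds D E K r χ)
    (hu : RealPSH (Ω : Set (Cn n)) u) {A : ℝ} (hA : ∀ x ∈ Ω, |u x| ≤ A) (hD : IsCompact D)
    {T : Current Ω (2 * q)} (hT : IsClosedPositive T) :
    ∃ (δ : ℕ → ℝ) (s : ℕ → ℕ → Set.Ioi (0 : ℝ) × Set.Ioi (0 : ℝ)), (∀ l, 0 < δ l) ∧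
      Tendsto δ atTop (𝓝 0) ∧
      (∀ l, IsRegularizingSeq (K.indicator u) D (min (δ l) r) (δ l) q (s l)) ∧
      Tendsto (fun l => T (hessPow (fun i =>
          regularize (hN.isBddMeasurable_indicator hu) (s l i)) (smulForm χ (omegaPow n 0)) q))
        atTop (𝓝 (ddcPowWedge u q T (smulForm χ (omegaPow n 0)))) := by
  obtain ⟨δ, -, hδ_pos, hδ⟩ := exists_seq_strictAnti_tendsto (0 : ℝ)
  have exists_seq (l : ℕ) := exists_isRegularizingSeq_hessPow hu hA hN.isCompact hN.subset hD
    (mul_pos two_pos hN.pos) (fun x hx => hN.closedBall_two_mul_subset x (hN.mem hx)) (hδ_pos l)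
    (φ := smulForm χ (omegaPow n 0))
    (fun x hx => hN.closedBall_two_mul_subset x (hN.tsupport_smulForm_subset _ hx))
    (lt_min (hδ_pos l) hN.pos) ((min_le_right _ _).trans (by linarith [hN.pos])) hT (hδ_pos l)
  choose s hs happrox using exists_seq
  exact ⟨δ, s, hδ_pos, hδ, hs, tendsto_iff_dist_tendsto_zero.2
    (squeeze_zero (fun _ => dist_nonneg) (fun l => (happrox l).le) hδ)⟩

lemma IsCutoffNhds.tendsto_excess (hN : IsCutoffNhds (closure G) E K r χ)
    (hu : RealPSH (Ω : Set (Cn n)) u) {ι : Type*} {l : Filter ι} {ε c : ι → ℝ}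
    (hε : Tendsto ε l (𝓝[>] 0)) (hc : Tendsto c l (𝓝 0)) (v : Cn n → ℝ) {x : Cn n} (hx : x ∈ G) :
    Tendsto (fun i => excess G (fun x => v x - c i) (mollify (ε i) (K.indicator u)) x) l
      (𝓝 (max (v x - u x) 0)) := by
  have mollify_tendsto := (hu.tendsto_mollify_indicator Ω.isOpen hN.isCompact hN.subset
    (mul_pos two_pos hN.pos)
    (hN.closedBall_two_mul_subset x (hN.mem (subset_closure hx)))).comp hε
  have v_tendsto := hc.const_sub (v x)
  rw [sub_zero] at v_tendsto
  simp only [excess_of_mem hx]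
  exact (v_tendsto.sub mollify_tendsto).max tendsto_const_nhds

theorem lintegral_pow_sub_le {T : Current Ω (2 * q)} (hT : IsClosedPositive T) (hq : 1 ≤ q)
    (hu : RealPSH (Ω : Set (Cn n)) u) {A : ℝ} (hA : ∀ x ∈ Ω, |u x| ≤ A) (hv : IsCompetitor G v)
    (hGΩ : closure G ⊆ Ω) (hvu : ∀ x ∈ frontier G, v x ≤ u x) {M : ℝ} (hM0 : 0 ≤ M)
    (hM : ∀ x ∈ closure G, sqNorm x ≤ M) :
    ∫⁻ x in G, ENNReal.ofReal (max (v x - u x) 0 ^ q) ∂traceMeasure T ≤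
      ENNReal.ofReal (q.factorial * M ^ q) * mongeAmpereMeasure T u (Ω : Set (Cn n)) := by
  obtain ⟨E, K, r, χ, hN⟩ := exists_isCutoffNhds hv.isCompact_closure hGΩ
  have hf := hN.isBddMeasurable_indicator hu
  obtain ⟨δ, s, hδ_pos, hδ, hs, bound_tendsto⟩ :=
    hN.exists_isRegularizingSeq hu hA hv.isCompact_closure hT
  have scale_tendsto : Tendsto (fun l => ((s l 0).1 : ℝ)) atTop (𝓝[>] 0) :=
    tendsto_nhdsWithin_iff.2 ⟨squeeze_zero (fun l => le_of_lt (s l 0).1.2)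
      (fun l => ((hs l).scale_lt 0 hq).le.trans (min_le_left _ _)) hδ,
      Eventually.of_forall fun l => (s l 0).1.2⟩
  have shift_tendsto : Tendsto (fun l => q * δ l) atTop (𝓝 0) := by
    simpa using hδ.const_mul (q : ℝ)
  have measurable_excess (l : ℕ) : Measurable (excess G (fun x => v x - q * δ l)
      (mollify (s l 0).1 (K.indicator u))) :=
    ((hv.sub_const _).isBddMeasurable_excess (hf.mollify (s l 0).1.2)).measurable
  refine (lintegral_le_of_tendsto (fun l => ((measurable_excess l).pow_const q).ennreal_ofReal)
    ((ae_restrict_iff' hv.isOpen.measurableSet).2 (ae_of_all _ fun x hx =>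
      ENNReal.tendsto_ofReal ((hN.tendsto_excess hu scale_tendsto shift_tendsto v hx).pow q)))
    (Eventually.of_forall fun l => lintegral_excess_pow_le hT hq hN hu hv hvu hM0 hM (hδ_pos l)
      (min_le_right _ _) (hs l))
    (ENNReal.tendsto_ofReal (bound_tendsto.const_mul _))).trans ?_
  rw [ENNReal.ofReal_mul (by positivity)]
  gcongr
  exact ofReal_ddcPowWedge_le_mongeAmpereMeasure hT hu hA hN.cutoff_nonneg hN.cutoff_le_one

end ExcessEstimate

section Maximality

variable {n q : ℕ} {Ω : TopologicalSpace.Opens (Cn n)} {G : Set (Cn n)}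

lemma measurableSet_setOf_mem_and_lt {u v : Cn n → EReal} (hG : IsOpen G)
    (hu : UpperSemicontinuousOn u G) (hv : UpperSemicontinuousOn v G) :
    MeasurableSet {x ∈ G | u x < v x} := by
  have eq_iUnion : {x ∈ G | u x < v x} =
      ⋃ c : ℚ, {x ∈ G | u x < ((c : ℝ) : EReal)} ∩ (G \ {x ∈ G | v x < ((c : ℝ) : EReal)}) := by
    ext x
    simp only [Set.mem_iUnion, Set.mem_inter_iff, Set.mem_sdiff]
    constructor
    · rintro ⟨hx, hlt⟩
      obtain ⟨c, hu_lt, hlt_v⟩ := EReal.lt_iff_exists_rat_btwn.1 hlt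
      exact ⟨c, ⟨hx, hu_lt⟩, hx, fun h => absurd h.2 (not_lt.2 hlt_v.le)⟩
    · rintro ⟨c, ⟨hx, hu_lt⟩, _, hnot⟩
      exact ⟨hx, hu_lt.trans_le (not_lt.1 fun h => hnot ⟨hx, h⟩)⟩
  rw [eq_iUnion]
  exact MeasurableSet.iUnion fun c => (isOpen_setOf_mem_and_lt hG hu _).measurableSet.inter
    (hG.measurableSet.diff (isOpen_setOf_mem_and_lt hG hv _).measurableSet)

lemma max_trunc_sub_le {v : Cn n → EReal} {x : Cn n} (hx : v x ≠ ⊤) {N : ℕ} {a b : ℝ}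
    (ha : -(N : ℝ) ≤ a) (hba : b ≤ a) (N' : ℕ) :
    max (trunc v N x - a) 0 ≤ max (trunc v N' x - b) 0 := by
  rcases le_or_gt (trunc v N x) a with hle | hlt
  · rw [max_eq_right (sub_nonpos.2 hle)]
    exact le_max_right _ _
  have neg_le_v : ((-(N : ℝ) : ℝ) : EReal) ≤ v x := by
    rw [← EReal.coe_lt_coe_iff, coe_trunc hx, lt_max_iff] at hlt
    exact (EReal.coe_le_coe_iff.2 ha).trans
      (hlt.resolve_right (not_lt.2 (EReal.coe_le_coe_iff.2 ha))).le
  have trunc_le : trunc v N x ≤ trunc v N' x := by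
    rw [← EReal.coe_le_coe_iff, coe_trunc hx, coe_trunc hx]
    exact max_le (le_max_left _ _) (le_max_of_le_left neg_le_v)
  exact max_le_max (sub_le_sub trunc_le hba) le_rfl

lemma ae_le_of_lintegral_pow_eq_zero {X : Type*} [MeasurableSpace X] {μ : Measure X} {f g : X → ℝ}
    (hf : AEMeasurable f μ) (hg : AEMeasurable g μ) (hq : q ≠ 0)
    (h : ∫⁻ x, ENNReal.ofReal (max (f x - g x) 0 ^ q) ∂μ = 0) : ∀ᵐ x ∂μ, f x ≤ g x := by
  have measurable : AEMeasurable (fun x => ENNReal.ofReal (max (f x - g x) 0 ^ q)) μ :=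
    (((hf.sub hg).max aemeasurable_const).pow_const q).ennreal_ofReal
  rw [lintegral_eq_zero_iff' measurable] at h
  filter_upwards [h] with x hx
  have pow_nonpos : max (f x - g x) 0 ^ q ≤ 0 := ENNReal.ofReal_eq_zero.1 hx
  have max_eq : max (f x - g x) 0 = 0 :=
    (pow_eq_zero_iff hq).1 (pow_nonpos.antisymm (pow_nonneg (le_max_right _ _) q))
  exact sub_nonpos.1 (max_eq_right_iff.1 max_eq)

lemma exists_forall_sqNorm_le {D : Set (Cn n)} (hD : IsCompact D) :
    ∃ M, 0 ≤ M ∧ ∀ x ∈ D, sqNorm x ≤ M := by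
  obtain ⟨M, hM⟩ := hD.bddAbove_image (f := sqNorm) contDiff_sqNorm.continuous.continuousOn
  exact ⟨max M 0, le_max_right _ _, fun x hx => (hM ⟨x, hx, rfl⟩).trans (le_max_left _ _)⟩

/-- The functions `w k` are bounded and plurisubharmonic on `U`, and decrease to `u` there. -/
structure IsDecreasingApprox (U : Set (Cn n)) (w : ℕ → Cn n → ℝ) (u : Cn n → EReal) : Prop where
  psh : ∀ k, PSHOn U fun z => ((w k z : ℝ) : EReal)
  bdd : ∀ k, ∃ M : ℝ, ∀ z ∈ U, |w k z| ≤ M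
  antitone : ∀ z ∈ U, Antitone fun k => w k z
  tendsto : ∀ z ∈ U, Tendsto (fun k => ((w k z : ℝ) : EReal)) atTop (𝓝 (u z))

namespace IsDecreasingApprox

variable {U : Set (Cn n)} {w : ℕ → Cn n → ℝ} {u : Cn n → EReal}

lemma le (h : IsDecreasingApprox U w u) (k : ℕ) {z : Cn n} (hz : z ∈ U) : u z ≤ w k z :=
  le_of_tendsto (h.tendsto z hz) (eventually_atTop.2 ⟨k, fun _ hl =>
    EReal.coe_le_coe_iff.2 (h.antitone z hz hl)⟩)

lemma exists_nat_bound (h : IsDecreasingApprox U w u) (k : ℕ) :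
    ∃ N : ℕ, ∀ z ∈ U, |w k z| ≤ N := by
  obtain ⟨M, hM⟩ := h.bdd k
  obtain ⟨N, hN⟩ := exists_nat_ge M
  exact ⟨N, fun z hz => (hM z hz).trans hN⟩

lemma realPSH (h : IsDecreasingApprox U w u) (k : ℕ) : RealPSH U (w k) :=
  let ⟨_, hM⟩ := h.bdd k
  (h.psh k).realPSH_of_bounded hM

end IsDecreasingApprox

/-- The data against which maximality of `u` on `Ω` is tested: `v` is plurisubharmonic on the
relatively compact open subset `G` of `Ω`, upper semicontinuous up to the boundary, and at most
`u` there. -/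
structure IsMaximalityTest (Ω : Set (Cn n)) (u : Cn n → EReal) (G : Set (Cn n))
    (v : Cn n → EReal) : Prop where
  isOpen : IsOpen G
  isCompact_closure : IsCompact (closure G)
  closure_subset : closure G ⊆ Ω
  usc : UpperSemicontinuousOn v (closure G)
  psh : PSHOn G v
  le_of_mem_frontier : ∀ z ∈ frontier G, v z ≤ u z

namespace IsMaximalityTest

variable {u v : Cn n → EReal} {w : ℕ → Cn n → ℝ}

lemma subset {U : Set (Cn n)} (h : IsMaximalityTest U u G v) : G ⊆ U :=
  subset_closure.trans h.closure_subset

lemma ne_top {U : Set (Cn n)} (h : IsMaximalityTest U u G v) (hu : PSHOn U u) {z : Cn n}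
    (hz : z ∈ closure G) : v z ≠ ⊤ := by
  by_cases hzG : z ∈ G
  · exact h.psh.ne_top z hzG
  · have hfr : z ∈ frontier G := h.isOpen.frontier_eq ▸ ⟨hz, hzG⟩
    exact ((h.le_of_mem_frontier z hfr).trans_lt
      (lt_top_iff_ne_top.2 (hu.ne_top z (h.closure_subset hz)))).ne

lemma isCompetitor_trunc {U : Set (Cn n)} (h : IsMaximalityTest U u G v) (hu : PSHOn U u) (N : ℕ) :
    IsCompetitor G (trunc v N) :=
  ⟨h.isOpen, h.isCompact_closure, upperSemicontinuousOn_trunc (fun _ hz => h.ne_top hu hz) h.usc N,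
    h.psh.realPSH_trunc N⟩

lemma lintegral_pow_trunc_sub_le (h : IsMaximalityTest (Ω : Set (Cn n)) u G v) (hq : 1 ≤ q)
    {T : Current Ω (2 * q)} (hT : IsClosedPositive T) (hu : PSHOn (Ω : Set (Cn n)) u)
    (hw : IsDecreasingApprox (Ω : Set (Cn n)) w u) {k N : ℕ} (hN : ∀ z ∈ Ω, |w k z| ≤ N) {M : ℝ}
    (hM0 : 0 ≤ M) (hM : ∀ x ∈ closure G, sqNorm x ≤ M) :
    ∫⁻ x in G, ENNReal.ofReal (max (trunc v N x - w k x) 0 ^ q) ∂traceMeasure T ≤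
      ENNReal.ofReal (q.factorial * M ^ q) * mongeAmpereMeasure T (w k) (Ω : Set (Cn n)) := by
  refine lintegral_pow_sub_le hT hq (hw.realPSH k) hN (h.isCompetitor_trunc hu N)
    h.closure_subset (fun x hx => ?_) hM0 hM
  have hxΩ := h.closure_subset (frontier_subset_closure hx)
  rw [← EReal.coe_le_coe_iff, coe_trunc (h.ne_top hu (frontier_subset_closure hx))]
  exact max_le ((h.le_of_mem_frontier x hx).trans (hw.le k hxΩ))
    (EReal.coe_le_coe_iff.2 (abs_le.1 (hN x hxΩ)).1)

-- For `l ≥ k` the integrand for `k` is at most the one for `l`, whose integral tends to zero.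
lemma lintegral_pow_trunc_sub_eq_zero (h : IsMaximalityTest (Ω : Set (Cn n)) u G v) (hq : 1 ≤ q)
    {T : Current Ω (2 * q)} (hT : IsClosedPositive T) (hu : PSHOn (Ω : Set (Cn n)) u)
    (hw : IsDecreasingApprox (Ω : Set (Cn n)) w u)
    (hmass : Tendsto (fun k => mongeAmpereMeasure T (w k) (Ω : Set (Cn n))) atTop (𝓝 0))
    {k N : ℕ} (hN : ∀ z ∈ Ω, |w k z| ≤ N) :
    ∫⁻ x in G, ENNReal.ofReal (max (trunc v N x - w k x) 0 ^ q) ∂traceMeasure T = 0 := by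
  obtain ⟨M, hM0, hM⟩ := exists_forall_sqNorm_le h.isCompact_closure
  have bound_tendsto := ENNReal.Tendsto.const_mul hmass
    (Or.inr (ENNReal.ofReal_ne_top (r := q.factorial * M ^ q)))
  rw [mul_zero] at bound_tendsto
  refine le_antisymm (ge_of_tendsto bound_tendsto ?_) zero_le
  filter_upwards [eventually_ge_atTop k] with l hkl
  obtain ⟨N', hN'⟩ := hw.exists_nat_bound l
  refine (setLIntegral_mono' h.isOpen.measurableSet fun x hx => ?_).trans
    (h.lintegral_pow_trunc_sub_le hq hT hu hw hN' hM0 hM)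
  exact ENNReal.ofReal_le_ofReal (pow_le_pow_left₀ (le_max_right _ _) (max_trunc_sub_le
    (h.psh.ne_top x hx) (abs_le.1 (hN x (h.subset hx))).1 (hw.antitone x (h.subset hx) hkl) N') q)

lemma ae_le_approx (h : IsMaximalityTest (Ω : Set (Cn n)) u G v) (hq : 1 ≤ q)
    {T : Current Ω (2 * q)} (hT : IsClosedPositive T) (hu : PSHOn (Ω : Set (Cn n)) u)
    (hw : IsDecreasingApprox (Ω : Set (Cn n)) w u)
    (hmass : Tendsto (fun k => mongeAmpereMeasure T (w k) (Ω : Set (Cn n))) atTop (𝓝 0)) (k : ℕ) :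
    ∀ᵐ z ∂traceMeasure T, z ∈ G → v z ≤ w k z := by
  obtain ⟨N, hN⟩ := hw.exists_nat_bound k
  have hG := h.isOpen.measurableSet
  have measurable_v := (aemeasurable_indicator_iff hG (μ := traceMeasure T)).1
    ((h.psh.realPSH_trunc N).measurable_indicator h.isOpen hG subset_rfl).aemeasurable
  have measurable_w := (aemeasurable_indicator_iff hG (μ := traceMeasure T)).1
    ((hw.realPSH k).measurable_indicator Ω.isOpen hG h.subset).aemeasurable
  have trunc_le := ae_le_of_lintegral_pow_eq_zero measurable_v measurable_w (by omega)
    (h.lintegral_pow_trunc_sub_eq_zero hq hT hu hw hmass hN)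
  rw [ae_restrict_iff' hG] at trunc_le
  filter_upwards [trunc_le] with z hz hzG
  have hle := EReal.coe_le_coe_iff.2 (hz hzG)
  rw [coe_trunc (h.psh.ne_top z hzG)] at hle
  exact (le_max_left _ _).trans hle

theorem ae_le (h : IsMaximalityTest (Ω : Set (Cn n)) u G v) (hq : 1 ≤ q)
    {T : Current Ω (2 * q)} (hT : IsClosedPositive T) (hu : PSHOn (Ω : Set (Cn n)) u)
    (hw : IsDecreasingApprox (Ω : Set (Cn n)) w u)
    (hmass : Tendsto (fun k => mongeAmpereMeasure T (w k) (Ω : Set (Cn n))) atTop (𝓝 0)) :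
    ∀ᵐ z ∂traceMeasure T, z ∈ G → v z ≤ u z := by
  filter_upwards [ae_all_iff.2 (h.ae_le_approx hq hT hu hw hmass)] with z hz hzG
  exact ge_of_tendsto' (hw.tendsto z (h.subset hzG)) fun k => hz k hzG

end IsMaximalityTest

end Maximality

end Pluri

end

theorem mainTheorem2_general {n q : ℕ} (hq : 1 ≤ q) (Ω : TopologicalSpace.Opens (Pluri.Cn n))
    {J : Type*} (T : J → Pluri.Current Ω (2 * q)) (hT : ∀ j, Pluri.IsClosedPositive (T j))
    (hnull : ∀ E : Set (Pluri.Cn n), MeasurableSet E → E ⊆ (Ω : Set (Pluri.Cn n)) →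
      (∀ j, Pluri.traceMeasure (T j) E = 0) → MeasureTheory.volume E = 0)
    (u : Pluri.Cn n → EReal) (hu : Pluri.PSHOn (Ω : Set (Pluri.Cn n)) u)
    (v : J → ℕ → Pluri.Cn n → ℝ)
    (hv : ∀ j, Pluri.IsDecreasingApprox (Ω : Set (Pluri.Cn n)) (v j) u)
    (hmass : ∀ j, Filter.Tendsto
      (fun k => Pluri.mongeAmpereMeasure (T j) (v j k) (Ω : Set (Pluri.Cn n)))
      Filter.atTop (nhds 0)) :
    Pluri.IsMaximalPSH (Ω : Set (Pluri.Cn n)) u := by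
  refine ⟨hu, fun G hG hGc hGΩ w hw hwG hwu z hz => ?_⟩
  have test : Pluri.IsMaximalityTest (Ω : Set (Pluri.Cn n)) u G w := ⟨hG, hGc, hGΩ, hw, hwG, hwu⟩
  have huG : Pluri.PSHOn G u := hu.mono test.subset
  have null : MeasureTheory.volume {x ∈ G | u x < w x} = 0 := by
    refine hnull _ (Pluri.measurableSet_setOf_mem_and_lt hG huG.usc hwG.usc)
      (fun x hx => test.subset hx.1) fun j => ?_
    rw [MeasureTheory.measure_eq_zero_iff_ae_notMem]
    filter_upwards [test.ae_le hq (hT j) hu (hv j) (hmass j)] with x hle hx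
    exact hx.2.not_ge (hle hx.1)
  rw [MeasureTheory.measure_eq_zero_iff_ae_notMem] at null
  refine hwG.le_of_ae_le hG huG ?_ hz
  filter_upwards [null] with x hx hxG
  exact not_lt.1 fun hlt => hx ⟨hxG, hlt⟩

theorem mainTheorem2 {n q : ℕ} (hq : 1 ≤ q) (hqn : q < n)
    (Ω : TopologicalSpace.Opens (Pluri.Cn n)) (hΩ : IsConnected (Ω : Set (Pluri.Cn n)))
    {J : Type*} (T : J → Pluri.Current Ω (2 * q))
    (hT : ∀ j, Pluri.IsClosedPositive (T j))
    (hpos : ∀ j, 0 < Pluri.traceMeasure (T j) (Ω : Set (Pluri.Cn n)))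
    (hnull : ∀ E : Set (Pluri.Cn n), MeasurableSet E → E ⊆ (Ω : Set (Pluri.Cn n)) →
      (∀ j, Pluri.traceMeasure (T j) E = 0) → MeasureTheory.volume E = 0)
    (u : Pluri.Cn n → EReal) (hu : Pluri.PSHOn (Ω : Set (Pluri.Cn n)) u)
    (v : J → ℕ → Pluri.Cn n → ℝ)
    (hv : ∀ j k, Pluri.PSHOn (Ω : Set (Pluri.Cn n)) (fun z => ((v j k z : ℝ) : EReal)))
    (hvb : ∀ j k, ∃ M : ℝ, ∀ z ∈ Ω, |v j k z| ≤ M)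
    (hanti : ∀ j, ∀ z ∈ Ω, Antitone (fun k => v j k z))
    (hlim : ∀ j, ∀ z ∈ Ω, Filter.Tendsto (fun k => ((v j k z : ℝ) : EReal)) Filter.atTop (nhds (u z)))
    (hmass : ∀ j, Filter.Tendsto
      (fun k => Pluri.mongeAmpereMeasure (T j) (v j k) (Ω : Set (Pluri.Cn n)))
      Filter.atTop (nhds 0)) :
    Pluri.IsMaximalPSH (Ω : Set (Pluri.Cn n)) u :=
  mainTheorem2_general hq Ω T hT hnull u hu v (fun j => ⟨hv j, hvb j, hanti j, hlim j⟩) hmass
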